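/- On compact complex manifolds of dimension $n$, the existence of a Hermitian metric whose fundamental form $F$ satisfies $dd^cF^{n-2}=0$ and $dd^cF^{n-3}=0$ is not preserved by blow-up. (Here a Hermitian metric is a smooth Riemannian metric $g$ with $g(JX,JY)=g(X,Y)$, its fundamental form is $F(X,Y)=g(JX,Y)$, $F^k$ is the $k$-th wedge power, and $d^c=J^{-1}dJ$.) More precisely, the following example with $n=5$ exists. Let $G=(\mathbb{C}^5,*)$ be the nilpotent Lie group with $$w*z=\bigl(w_1+z_1,\;w_2+z_2,\;w_3+z_3,\;w_4+z_4,\;w_5+z_5+B(w,z)\bigr),$$ $$B(w,z)=(-1-3i)\,w_1z_2+\overline{w}_1z_1+\overline{w}_2z_2-4\,w_3z_4+2\,\overline{w}_3z_3+2\,\overline{w}_4z_4 ,$$ whose left translations are holomorphic for the standard complex structure of $\mathbb{C}^5$, and let $\eta^i=dz_i$ $(1\le i\le 4)$, $\eta^5=dz_5-B(z,dz)$ be its left-invariant $(1,0)$-coframe. There is a discrete subgroup $\Gamma\subset G$ such that: 1. $M=\Gamma\backslash G$ is a compact (Hausdorff) complex manifold of dimension $5$, with the complex structure for which the projection $p\colon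 G\to M$ is a local biholomorphism; 2. the Hermitian metric on $M$ whose fundamental form $F$ satisfies $p^*F=\frac{i}{2}\sum_{j=1}^5\eta^j\wedge\overline{\eta^j}$ satisfies $dd^cF^{3}=0$ and $dd^cF^{2}=0$; 3. $Y=p(\{z\in G: z_2=z_4=0\})$ is a compact complex submanifold of $M$ of dimension $3$; 4. the blow-up $\pi\colon\tilde M_Y\to M$ of $M$ along $Y$ is a compact complex manifold of dimension $5$ that admits no Hermitian metric whose fundamental form $\tilde F$ satisfies both $dd^c\tilde F^{3}=0$ and $dd^c\tilde F^{2}=0$. -/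

import Mathlib

open scoped Manifold ContDiff ComplexConjugate

noncomputable section

/-! ### Exterior algebra of real alternating forms -/

section Wedge

variable {V : Type*} [AddCommGroup V] [Module ℝ V] [TopologicalSpace V]

theorem formTensor_update {p q : ℕ} [DecidableEq (Fin (p + q))] (α : V [⋀^Fin p]→L[ℝ] ℝ)
    (β : V [⋀^Fin q]→L[ℝ] ℝ) (m : Fin (p + q) → V) (i : Fin (p + q)) (z : V) :
    α (fun k => Function.update m i z (Fin.castAdd q k)) *
        β (fun k => Function.update m i z (Fin.natAdd p k)) =
      Fin.addCases (motive := fun _ => ℝ)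
        (fun j => α (Function.update (fun k => m (Fin.castAdd q k)) j z) *
          β (fun k => m (Fin.natAdd p k)))
        (fun j => α (fun k => m (Fin.castAdd q k)) *
          β (Function.update (fun k => m (Fin.natAdd p k)) j z)) i := by
  refine Fin.addCases (fun j => ?_) (fun j => ?_) i
  · simp only [Fin.addCases_left]
    congr 2
    · ext k
      simp [Function.update_apply]
    · ext k
      rw [Function.update_of_ne]
      intro h
      have := congrArg Fin.val h
      simp at this
      omega
  · simp only [Fin.addCases_right]
    congr 2
    · ext k
      rw [Function.update_of_ne]
      intro h
      have := congrArg Fin.val h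
      simp at this
      omega
    · ext k
      simp [Function.update_apply]

/-- The (not yet antisymmetrised) product
`(v₁, …, v_{p+q}) ↦ α (v₁, …, v_p) * β (v_{p+1}, …, v_{p+q})`. -/
def formTensor {p q : ℕ} (α : V [⋀^Fin p]→L[ℝ] ℝ) (β : V [⋀^Fin q]→L[ℝ] ℝ) :
    ContinuousMultilinearMap ℝ (fun _ : Fin (p + q) => V) ℝ where
  toFun v := α (fun i => v (Fin.castAdd q i)) * β (fun i => v (Fin.natAdd p i))
  map_update_add' := by
    intro _ m i x y
    simp only [formTensor_update]
    refine Fin.addCases (fun j => ?_) (fun j => ?_) i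
    · simp [add_mul]
    · simp [mul_add]
  map_update_smul' := by
    intro _ m i c x
    simp only [formTensor_update]
    refine Fin.addCases (fun j => ?_) (fun j => ?_) i
    · simp [mul_assoc]
    · simp [mul_left_comm]
  cont := by
    refine (α.cont.comp ?_).mul (β.cont.comp ?_) <;> fun_prop

/-- The wedge product
`(α ∧ β)(v) = 1/(p! q!) ∑_σ sign σ • α (v_{σ 1}, …, v_{σ p}) β (v_{σ (p+1)}, …, v_{σ (p+q)})`. -/
def wedge {p q : ℕ} (α : V [⋀^Fin p]→L[ℝ] ℝ) (β : V [⋀^Fin q]→L[ℝ] ℝ) :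
    V [⋀^Fin (p + q)]→L[ℝ] ℝ :=
  ((p.factorial * q.factorial : ℝ)⁻¹) •
    ContinuousMultilinearMap.alternatization (formTensor α β)

/-- The `k`-fold wedge power `F ∧ ⋯ ∧ F` of a `2`-form. -/
def wedgePow (F : V [⋀^Fin 2]→L[ℝ] ℝ) : (k : ℕ) → V [⋀^Fin (2 * k)]→L[ℝ] ℝ
  | 0 => ContinuousAlternatingMap.constOfIsEmpty ℝ V (Fin 0) 1
  | k + 1 => wedge (wedgePow F k) F

end Wedge

/-- Multiplication by `i` on a complex vector space, as a real linear map. -/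
def multI (V : Type*) [AddCommGroup V] [Module ℂ V] [TopologicalSpace V]
    [ContinuousConstSMul ℂ V] : V →L[ℝ] V :=
  (Complex.I • ContinuousLinearMap.id ℂ V).restrictScalars ℝ

/-- The model space `ℂⁿ`. -/
abbrev Cn (n : ℕ) : Type := Fin n → ℂ

/-! ### Operators on forms on open subsets of `ℂⁿ` -/

/-- The action of the complex structure on `k`-forms: `(J α)(v₁, …, v_k) = α (J v₁, …, J v_k)`. -/
def Jform {n k : ℕ} (α : Cn n → Cn n [⋀^Fin k]→L[ℝ] ℝ) : Cn n → Cn n [⋀^Fin k]→L[ℝ] ℝ :=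
  fun u => (α u).compContinuousLinearMap (multI (Cn n))

/-- The inverse action `(J⁻¹ α)(v₁, …, v_k) = α (-J v₁, …, -J v_k)`. -/
def JinvForm {n k : ℕ} (α : Cn n → Cn n [⋀^Fin k]→L[ℝ] ℝ) : Cn n → Cn n [⋀^Fin k]→L[ℝ] ℝ :=
  fun u => (α u).compContinuousLinearMap (-multI (Cn n))

/-- `dᶜ = J⁻¹ d J`. -/
def dcForm {n k : ℕ} (α : Cn n → Cn n [⋀^Fin k]→L[ℝ] ℝ) : Cn n → Cn n [⋀^Fin (k + 1)]→L[ℝ] ℝ :=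
  JinvForm (extDeriv (Jform α))

/-- `d dᶜ`. -/
def ddcForm {n k : ℕ} (α : Cn n → Cn n [⋀^Fin k]→L[ℝ] ℝ) :
    Cn n → Cn n [⋀^Fin (k + 1 + 1)]→L[ℝ] ℝ :=
  extDeriv (dcForm α)

/-! ### Forms and Hermitian metrics on complex manifolds -/

section Manifolds

variable (n : ℕ) (M : Type*) [TopologicalSpace M] [ChartedSpace (Cn n) M]

/-- The tangent space of a complex manifold; it is a complex vector space and its complex
structure `J` is multiplication by `i`. -/
abbrev Tan (x : M) : Type := TangentSpace 𝓘(ℂ, Cn n) x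

variable {n M}

/-- The differential, at `u` in the target of a chart `e`, of the parametrisation `e⁻¹`. -/
def chartInvDeriv (e : OpenPartialHomeomorph M (Cn n)) (u : Cn n) :
    Cn n →L[ℝ] Tan n M (e.symm u) :=
  (mfderiv 𝓘(ℂ, Cn n) 𝓘(ℂ, Cn n) e.symm u : Cn n →L[ℂ] Tan n M (e.symm u)).restrictScalars ℝ

/-- The expression of a `k`-form in a chart, i.e. its pull-back by the inverse of the chart. -/
def formInChart {k : ℕ} (α : ∀ x : M, Tan n M x [⋀^Fin k]→L[ℝ] ℝ)
    (e : OpenPartialHomeomorph M (Cn n)) : Cn n → Cn n [⋀^Fin k]→L[ℝ] ℝ :=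
  fun u => (α (e.symm u)).compContinuousLinearMap (chartInvDeriv e u)

/-- `d dᶜ α = 0` on the manifold: it holds in every chart of the atlas. -/
def IsDdcClosed {k : ℕ} (α : ∀ x : M, Tan n M x [⋀^Fin k]→L[ℝ] ℝ) : Prop :=
  ∀ e ∈ atlas (Cn n) M, ∀ u ∈ e.target, ddcForm (formInChart α e) u = 0

variable (n M)

/-- A Hermitian metric: a smooth Riemannian metric for which `J` is an isometry. Smoothness is
that of the coefficients of the metric in the charts of the atlas. -/
structure HermitianMetric where
  /-- the scalar product on each tangent space -/
  val : ∀ x : M, Tan n M x →ₗ[ℝ] Tan n M x →ₗ[ℝ] ℝ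
  symm : ∀ (x : M) (v w : Tan n M x), val x v w = val x w v
  pos : ∀ (x : M) (v : Tan n M x), v ≠ 0 → 0 < val x v v
  isometry_J : ∀ (x : M) (v w : Tan n M x),
    val x (multI (Tan n M x) v) (multI (Tan n M x) w) = val x v w
  smooth : ∀ e ∈ atlas (Cn n) M, ∀ a b : Cn n,
    ContDiffOn ℝ ∞ (fun u => val (e.symm u) (chartInvDeriv e u a) (chartInvDeriv e u b)) e.target

variable {n M}

theorem HermitianMetric.val_J_self (g : HermitianMetric n M) (x : M) (v : Tan n M x) :
    g.val x (multI (Tan n M x) v) v = 0 := by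
  have h1 := g.isometry_J x (multI (Tan n M x) v) v
  have h2 : multI (Tan n M x) (multI (Tan n M x) v) = -v := by
    simp [multI, smul_smul]
  rw [h2, map_neg, LinearMap.neg_apply, g.symm x v] at h1
  linarith

theorem HermitianMetric.continuous_val (g : HermitianMetric n M) (x : M) :
    Continuous fun v : Tan n M x × Tan n M x => g.val x v.1 v.2 := by
  let c : Cn n ≃L[ℂ] Tan n M x := ContinuousLinearEquiv.refl ℂ (Cn n)
  let e : Cn n ≃L[ℝ] Tan n M x := c.restrictScalars ℝ
  let B : Cn n →ₗ[ℝ] Cn n →ₗ[ℝ] ℝ := (g.val x).compl₁₂ e.toLinearMap e.toLinearMap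
  have hB : Continuous fun v : Cn n × Cn n => B v.1 v.2 :=
    B.toContinuousBilinearMap.continuous₂
  have h : (fun v : Tan n M x × Tan n M x => g.val x v.1 v.2) =
      fun v => B (e.symm v.1) (e.symm v.2) := by
    ext v
    simp [B]
  rw [h]
  exact hB.comp ((e.symm.continuous.comp continuous_fst).prodMk
    (e.symm.continuous.comp continuous_snd))

/-- The fundamental form `F (X, Y) = g (J X, Y)`. -/
def HermitianMetric.fundamentalForm (g : HermitianMetric n M) (x : M) :
    Tan n M x [⋀^Fin 2]→L[ℝ] ℝ where
  toFun v := g.val x (multI (Tan n M x) (v 0)) (v 1)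
  map_update_add' := by
    intro _ m i a b
    fin_cases i <;> simp
  map_update_smul' := by
    intro _ m i c a
    fin_cases i <;> simp
  cont := (g.continuous_val x).comp
    (((multI (Tan n M x)).continuous.comp (continuous_apply 0)).prodMk (continuous_apply 1))
  map_eq_zero_of_eq' := by
    intro v i j h hij
    have h01 : v 0 = v 1 := by
      fin_cases i <;> fin_cases j <;> simp_all
    simp only [h01]
    exact g.val_J_self x (v 1)

/-- `d dᶜ F^k = 0` for the fundamental form `F` of the metric. -/
def HermitianMetric.DdcPowClosed (g : HermitianMetric n M) (k : ℕ) : Prop :=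
  IsDdcClosed (fun x => wedgePow (g.fundamentalForm x) k)

/-- On an `n`-dimensional manifold (`n ≥ 3`): `d dᶜ F^(n-2) = 0` (i.e. the metric is
astheno-Kähler) and `d dᶜ F^(n-3) = 0`. -/
def HermitianMetric.IsDdcSpecial (g : HermitianMetric n M) : Prop :=
  g.DdcPowClosed (n - 2) ∧ g.DdcPowClosed (n - 3)

end Manifolds

/-! ### Complex submanifolds and blow-ups -/

section Blowup

variable {n : ℕ} {M : Type*} [TopologicalSpace M] [ChartedSpace (Cn n) M]

/-- A holomorphic chart `φ` is adapted to `Y` if `Y` is given in it by the vanishing of the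
coordinates with (zero-based) index at least `d`. -/
def IsAdaptedChart (d : ℕ) (Y : Set M) (φ : OpenPartialHomeomorph M (Cn n)) : Prop :=
  φ ∈ IsManifold.maximalAtlas 𝓘(ℂ, Cn n) ω M ∧
    ∀ x ∈ φ.source, x ∈ Y ↔ ∀ i : Fin n, d ≤ (i : ℕ) → φ x i = 0

variable (n) in
/-- `Y` is a `d`-dimensional complex submanifold of the `n`-dimensional manifold `M`. -/
def IsComplexSubmanifold (d : ℕ) (Y : Set M) : Prop :=
  ∀ y ∈ Y, ∃ φ : OpenPartialHomeomorph M (Cn n), y ∈ φ.source ∧ IsAdaptedChart d Y φ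

/-- The indices of the coordinates normal to `{z_i = 0 for d ≤ i}`. -/
abbrev NormalIdx (n d : ℕ) : Type := {i : Fin n // d ≤ (i : ℕ)}

/-- The normal coordinates of a point of `ℂⁿ`. -/
def normalPart (d : ℕ) (z : Cn n) : NormalIdx n d → ℂ := fun i => z i

/-- The local model of the blow-up of an open set `U ⊆ ℂⁿ` along `{z_i = 0 for d ≤ i}`:
`{(z, ℓ) | z ∈ U, z'' ∈ ℓ} ⊆ U × ℙ(ℂ^{n-d})`, with `z''` the normal part of `z`. -/
def blowupModel (d : ℕ) (U : Set (Cn n)) : Set (Cn n × Projectivization ℂ (NormalIdx n d → ℂ)) :=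
  {zl | zl.1 ∈ U ∧ normalPart d zl.1 ∈ zl.2.submodule}

/-- The `j`-th standard affine coordinates on the part `ℓ_j ≠ 0` of the local model:
`z_i` for `i < d`, `z_j` for `i = j`, and `ℓ_i / ℓ_j` for the other normal indices `i`. -/
def blowupCoord (d : ℕ) (j : NormalIdx n d)
    (zl : Cn n × Projectivization ℂ (NormalIdx n d → ℂ)) : Cn n := fun i =>
  if h : d ≤ (i : ℕ) then
    if i = j then zl.1 i else zl.2.rep ⟨i, h⟩ / zl.2.rep j
  else zl.1 i

variable {B : Type*} [TopologicalSpace B] [ChartedSpace (Cn n) B]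

variable (n) in
/-- `π : B → M` is the blow-up of the `n`-dimensional manifold `M` along the `d`-dimensional complex submanifold `Y`: it is
biholomorphic over the complement of `Y`, and over an adapted chart `φ` around any point of `Y`
there is an identification `q ↦ (φ (π q), ℓ q)` of `B` with the local model, compatible with the
projections, which is biholomorphic, i.e. the standard affine coordinates of the model are
holomorphic charts of `B`. -/
structure IsBlowup (d : ℕ) (Y : Set M) (π : B → M) : Prop where
  holomorphic : ContMDiff 𝓘(ℂ, Cn n) 𝓘(ℂ, Cn n) ω π
  bijOn_compl : Set.BijOn π (π ⁻¹' Yᶜ) Yᶜ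
  localDiffeo_compl : IsLocalDiffeomorphOn 𝓘(ℂ, Cn n) 𝓘(ℂ, Cn n) ω π (π ⁻¹' Yᶜ)
  local_model : ∀ y ∈ Y, ∃ φ : OpenPartialHomeomorph M (Cn n),
    y ∈ φ.source ∧ IsAdaptedChart d Y φ ∧
    ∃ l : B → Projectivization ℂ (NormalIdx n d → ℂ),
      Set.BijOn (fun q => (φ (π q), l q)) (π ⁻¹' φ.source) (blowupModel d φ.target) ∧
      ∀ j : NormalIdx n d, ∃ ψ ∈ IsManifold.maximalAtlas 𝓘(ℂ, Cn n) ω B,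
        ψ.source = {q | π q ∈ φ.source ∧ (l q).rep j ≠ 0} ∧
        ∀ q ∈ ψ.source, ψ q = blowupCoord d j (φ (π q), l q)

end Blowup

/-! ### The nilmanifold -/

/-- The form `B (w, z) = a₁ w₁ z₂ + a₄ w̄₁ z₁ + b₄ w̄₂ z₂ + c₁ w₃ z₄ + c₄ w̄₃ z₃ + d₄ w̄₄ z₄` with
`a₁ = -1 - 3i`, `a₄ = 1`, `b₄ = 1`, `c₁ = -4`, `c₄ = 2`, `d₄ = 2` (coordinates of `ℂ⁵` are
numbered from `0` in the code). -/
def nilForm (w z : Cn 5) : ℂ :=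
  (-1 - 3 * Complex.I) * w 0 * z 1 + 1 * conj (w 0) * z 0 + 1 * conj (w 1) * z 1
    + (-4) * w 2 * z 3 + 2 * conj (w 2) * z 2 + 2 * conj (w 3) * z 3

/-- The group `(ℂ⁵, ∗)`,
`w ∗ z = (w₁ + z₁, w₂ + z₂, w₃ + z₃, w₄ + z₄, w₅ + z₅ + B (w, z))`. -/
def NilG : Type := Cn 5

instance : TopologicalSpace NilG := inferInstanceAs (TopologicalSpace (Cn 5))

instance : ChartedSpace (Cn 5) NilG := inferInstanceAs (ChartedSpace (Cn 5) (Cn 5))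

def nilMul (w z : Cn 5) : Cn 5 :=
  ![w 0 + z 0, w 1 + z 1, w 2 + z 2, w 3 + z 3, w 4 + z 4 + nilForm w z]

def nilInv (w : Cn 5) : Cn 5 :=
  ![-w 0, -w 1, -w 2, -w 3, -w 4 + nilForm w w]

theorem nilMul_assoc (a b c : Cn 5) : nilMul (nilMul a b) c = nilMul a (nilMul b c) := by
  ext i
  fin_cases i <;> simp [nilMul, nilForm] <;> ring

theorem nilMul_zero_left (a : Cn 5) : nilMul 0 a = a := by
  ext i
  fin_cases i <;> simp [nilMul, nilForm]

theorem nilMul_zero_right (a : Cn 5) : nilMul a 0 = a := by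
  ext i
  fin_cases i <;> simp [nilMul, nilForm]

theorem nilMul_inv_left (a : Cn 5) : nilMul (nilInv a) a = 0 := by
  ext i
  fin_cases i <;> simp [nilMul, nilInv, nilForm]; ring

instance : Group NilG where
  mul := nilMul
  mul_assoc := nilMul_assoc
  one := (0 : Cn 5)
  one_mul := nilMul_zero_left
  mul_one := nilMul_zero_right
  inv := nilInv
  inv_mul_cancel := nilMul_inv_left

/-- The left-invariant `(1,0)`-coframe at `z`, evaluated at a tangent vector `v`: `η^i = dz_i` for
`i ≤ 4` and `η^5 = dz_5 - B (z, dz)`. -/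
def nilCoframe (z v : Cn 5) : Fin 5 → ℂ :=
  ![v 0, v 1, v 2, v 3, v 4 - nilForm z v]

/-- The quotient `Γ \ G` by left translations, with the quotient topology. -/
abbrev Nilmanifold (Γ : Subgroup NilG) : Type := Quotient (QuotientGroup.rightRel Γ)

/-- The projection `G → Γ \ G`. -/
def nilProj (Γ : Subgroup NilG) : NilG → Nilmanifold Γ := Quotient.mk _

/-- The image in `Γ \ G` of the subgroup `{z₂ = z₄ = 0}` of `G`. -/
def nilY (Γ : Subgroup NilG) : Set (Nilmanifold Γ) :=
  nilProj Γ '' {z : Cn 5 | z 1 = 0 ∧ z 3 = 0}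

/-- The metric on `Γ \ G` whose pull-back to `G` is `Re ∑ η^j ⊗ conj η^j`; equivalently, its
fundamental form pulls back to `(i/2) ∑ η^j ∧ conj η^j`. -/
def IsNilDiagonal (Γ : Subgroup NilG) [ChartedSpace (Cn 5) (Nilmanifold Γ)]
    (g : HermitianMetric 5 (Nilmanifold Γ)) : Prop :=
  ∀ (z : NilG) (v w : Tan 5 NilG z),
    g.val (nilProj Γ z) (mfderiv 𝓘(ℂ, Cn 5) 𝓘(ℂ, Cn 5) (nilProj Γ) z v)
        (mfderiv 𝓘(ℂ, Cn 5) 𝓘(ℂ, Cn 5) (nilProj Γ) z w) =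
      (∑ j, nilCoframe z v j * conj (nilCoframe z w j)).re

end

open scoped Topology

noncomputable section

/-! ### Complex manifolds presented by étale covers -/

/-! Metric on the nilmanifold. In the coordinates of `G` the fundamental form is F = ω + V, where ω
(`baseForm`) is the constant Kähler form of the first four coordinates and V (`vertForm`) is (i/2)
η⁵ ∧ conj η⁵. Since V ∧ V = 0, one has F² = ω² + 2 ω ∧ V and F³ = ω³ + 3 ω² ∧ V. As ω is closed,
both equations follow from ω ∧ dd^c V = 0. The form B is real linear in the base point, so V is a
quadratic polynomial there and dd^c V is given by its constant Hessian `vertHess`. Splitting B into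
its linear part `nilLin` and its antilinear part `nilAnti` turns the claim into an equality of two
alternating sums, `altSum_baseForm_mul_nilLin` and `altSum_baseForm_mul_nilAnti`. Both give the
coefficients 10, 10, 16, 16 on the four products of three coordinate forms; this is what the
constants in B are chosen for.

Quotient and blow-up. Γ is the set of points with Gaussian integer coordinates. A Gaussian integer
of norm less than 1 is zero, and every complex number is within 3/4 of one; these two facts give
discreteness, local injectivity, compactness and adapted charts. The coordinates z₂, z₄ trivialise
the normal bundle of Y, so the exceptional divisor is E = Y × ℙ¹. The blow-up is built as a set of
pairs (point, line) and is glued from its two families of affine coordinates.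

Obstruction. Only dd^c F² = 0 is used, restricted to E, which has dimension 4. On Y the structure
form has only the antilinear terms `yForm`, so dd^c of (i/2) η ∧ conj η is a nonzero constant
multiple of the volume form in the two horizontal complex directions. Integrating F² ∧ dd^c((i/2) η
∧ conj η) over E by parts would give zero, while positivity of F² gives a nonzero number.

Instead of Stokes' theorem on E, the integration by parts is carried out on the cover ℂ⁴ of Y × ℂ*,
whose last coordinate is a logarithm on ℂ*. Coefficients in the left invariant frame are averaged
over the periods (`yMean`), and the averages depend only on r, the real part of the logarithm.
Cartan's formula applied twice (`yMean_ddcForm`) says that the derivative in r of an explicit flux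
`divFlux` is 16 times the mean of F²(e₂, ie₂, e₃, ie₃), which is positive by
`HermitianMetric.wedgePow_two_pos`. The flux tends to 0 at both ends (`tendsto_divFlux`): there the
logarithmic vector field e₃ vanishes at a point of ℙ¹, while the forms extend smoothly across it. A
strictly increasing function cannot have the same finite limit at both ends. -/

/-- A family of locally injective open maps from open subsets of `ℂⁿ` onto a space, related to each
other by analytic maps. -/
structure EtaleCover (n : ℕ) (B : Type*) [TopologicalSpace B] (ι : Type*) where
  /-- the domains of the maps -/
  dom : ι → Set (Cn n)
  /-- the maps -/
  map : ι → Cn n → B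
  isOpen_dom : ∀ i, IsOpen (dom i)
  surj : ∀ b, ∃ i, ∃ x ∈ dom i, map i x = b
  continuousOn : ∀ i, ContinuousOn (map i) (dom i)
  isOpen_image : ∀ i U, IsOpen U → U ⊆ dom i → IsOpen (map i '' U)
  locInj : ∀ i, ∀ x ∈ dom i, ∃ U, IsOpen U ∧ x ∈ U ∧ U ⊆ dom i ∧ Set.InjOn (map i) U
  transition : ∀ i j x y, x ∈ dom i → y ∈ dom j → map i x = map j y →
    ∃ h : Cn n → Cn n, ContDiffAt ℂ ω h x ∧ h x = y ∧ ∀ᶠ x' in 𝓝 x, map j (h x') = map i x'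

namespace EtaleCover

variable {n : ℕ} {B : Type*} [TopologicalSpace B] {ι : Type*} (C : EtaleCover n B ι)

/-- The chart inverse to the restriction of one of the maps to an open set. -/
def chart (i : ι) (U : Set (Cn n)) (hU : IsOpen U) (hUd : U ⊆ C.dom i)
    (hinj : Set.InjOn (C.map i) U) : OpenPartialHomeomorph B (Cn n) :=
  letI : Nonempty (Cn n) := ⟨0⟩
  OpenPartialHomeomorph.symm
    { toFun := C.map i
      invFun := Function.invFunOn (C.map i) U
      source := U
      target := C.map i '' U
      map_source' := fun x hx => ⟨x, hx, rfl⟩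
      map_target' := fun _ hy => Function.invFunOn_mem hy
      left_inv' := fun _ hx => hinj.leftInvOn_invFunOn hx
      right_inv' := fun _ hy => Function.invFunOn_eq hy
      open_source := hU
      open_target := C.isOpen_image i U hU hUd
      continuousOn_toFun := (C.continuousOn i).mono hUd
      continuousOn_invFun := by
        intro y hy
        obtain ⟨x, hx, rfl⟩ := hy
        refine ContinuousAt.continuousWithinAt ?_
        rw [ContinuousAt, hinj.leftInvOn_invFunOn hx]
        intro W hW
        obtain ⟨W', hW'W, hW', hxW'⟩ := mem_nhds_iff.1 hW
        -- Continuity of the inverse is openness of the map on open subsets of its domain.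
        have hopen := C.isOpen_image i (W' ∩ U) (hW'.inter hU)
          (Set.inter_subset_right.trans hUd)
        rw [Filter.mem_map]
        refine Filter.mem_of_superset (hopen.mem_nhds ⟨x, ⟨hxW', hx⟩, rfl⟩) ?_
        rintro _ ⟨x', hx', rfl⟩
        show Function.invFunOn (C.map i) U (C.map i x') ∈ W
        rw [hinj.leftInvOn_invFunOn hx'.2]
        exact hW'W hx'.1 }

variable {i : ι} {U : Set (Cn n)} {hU : IsOpen U} {hUd : U ⊆ C.dom i}
  {hinj : Set.InjOn (C.map i) U}

theorem chart_symm_coe : ⇑(C.chart i U hU hUd hinj).symm = C.map i := rfl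

theorem chart_target : (C.chart i U hU hUd hinj).target = U := rfl

theorem chart_source : (C.chart i U hU hUd hinj).source = C.map i '' U := rfl

theorem chart_map {x : Cn n} (hx : x ∈ U) : C.chart i U hU hUd hinj (C.map i x) = x :=
  (C.chart i U hU hUd hinj).right_inv hx

/-- The charts of an étale cover. -/
def charts : Set (OpenPartialHomeomorph B (Cn n)) :=
  {e | ∃ i U hU hUd hinj, e = C.chart i U hU hUd hinj}

theorem exists_chart (b : B) : ∃ e ∈ C.charts, b ∈ e.source := by
  obtain ⟨i, x, hx, rfl⟩ := C.surj b
  obtain ⟨U, hU, hxU, hUd, hinj⟩ := C.locInj i x hx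
  exact ⟨C.chart i U hU hUd hinj, ⟨i, U, hU, hUd, hinj, rfl⟩, x, hxU, rfl⟩

/-- The charted space structure given by an étale cover. -/
@[reducible] def chartedSpace : ChartedSpace (Cn n) B where
  atlas := C.charts
  chartAt b := (C.exists_chart b).choose
  mem_chart_source b := (C.exists_chart b).choose_spec.2
  chart_mem_atlas b := (C.exists_chart b).choose_spec.1

/-- A chart is a local inverse of a covering map, so near each point a change of charts agrees with
the analytic `h` supplied by `transition`, once `h` lands in the injectivity set `V`. -/
theorem isManifold : @IsManifold ℂ _ _ _ _ _ _ 𝓘(ℂ, Cn n) ω B _ C.chartedSpace := by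
  let := C.chartedSpace
  refine isManifold_of_contDiffOn _ _ _ ?_
  rintro _ _ ⟨i, U, hU, hUd, hi, rfl⟩ ⟨j, V, hV, hVd, hj, rfl⟩
  intro x hx
  simp only [modelWithCornersSelf_coe, modelWithCornersSelf_coe_symm, Set.preimage_id,
    Set.range_id, Set.inter_univ, OpenPartialHomeomorph.trans_source,
    OpenPartialHomeomorph.symm_source, chart_target, chart_source, chart_symm_coe] at hx
  obtain ⟨hxU, y, hyV, hxy⟩ := hx
  obtain ⟨h, hh, hhx, heq⟩ := C.transition i j x y (hUd hxU) (hVd hyV) hxy.symm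
  refine ContDiffAt.contDiffWithinAt ?_
  refine hh.congr_of_eventuallyEq ?_
  have hmem : ∀ᶠ x' in 𝓝 x, h x' ∈ V :=
    hh.continuousAt.eventually (hV.mem_nhds (hhx ▸ hyV))
  filter_upwards [heq, hmem] with x' hx' hx'V
  simp only [modelWithCornersSelf_coe, modelWithCornersSelf_coe_symm, Function.comp_def, id,
    OpenPartialHomeomorph.coe_trans, chart_symm_coe]
  rw [← hx', C.chart_map hx'V]

theorem mem_maximalAtlas (i : ι) (U : Set (Cn n)) (hU : IsOpen U) (hUd : U ⊆ C.dom i)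
    (hinj : Set.InjOn (C.map i) U) :
    letI := C.chartedSpace
    C.chart i U hU hUd hinj ∈ IsManifold.maximalAtlas 𝓘(ℂ, Cn n) ω B := by
  let := C.chartedSpace
  have := C.isManifold
  exact IsManifold.subset_maximalAtlas ⟨i, U, hU, hUd, hinj, rfl⟩

theorem isLocalDiffeomorphAt {i : ι} {x : Cn n} (hx : x ∈ C.dom i) :
    letI := C.chartedSpace
    IsLocalDiffeomorphAt 𝓘(ℂ, Cn n) 𝓘(ℂ, Cn n) ω (C.map i) x := by
  let := C.chartedSpace
  have := C.isManifold
  obtain ⟨U, hU, hxU, hUd, hinj⟩ := C.locInj i x hx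
  have hm := C.mem_maximalAtlas i U hU hUd hinj
  exact ⟨{ (C.chart i U hU hUd hinj).symm.toPartialEquiv with
    open_source := hU
    open_target := C.isOpen_image i U hU hUd
    contMDiffOn_toFun := contMDiffOn_symm_of_mem_maximalAtlas hm
    contMDiffOn_invFun := contMDiffOn_of_mem_maximalAtlas hm }, hxU, fun _ _ => rfl⟩

theorem mdifferentiableAt {i : ι} {x : Cn n} (hx : x ∈ C.dom i) :
    letI := C.chartedSpace
    MDifferentiableAt 𝓘(ℂ, Cn n) 𝓘(ℂ, Cn n) (C.map i) x := by
  let := C.chartedSpace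
  exact (C.isLocalDiffeomorphAt hx).mdifferentiableAt (by simp)

/-- A map is analytic if its composition with a map of the cover is. -/
theorem contMDiffAt_of_comp {m : ℕ} {N : Type*} [TopologicalSpace N] [ChartedSpace (Cn m) N]
    (f : B → N) {i : ι} {x : Cn n} (hx : x ∈ C.dom i)
    (hf : ContMDiffAt 𝓘(ℂ, Cn n) 𝓘(ℂ, Cn m) ω (f ∘ C.map i) x) :
    letI := C.chartedSpace
    ContMDiffAt 𝓘(ℂ, Cn n) 𝓘(ℂ, Cn m) ω f (C.map i x) := by
  let := C.chartedSpace
  have := C.isManifold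
  have hl := C.isLocalDiffeomorphAt hx
  have h1 := hl.localInverse_contMDiffAt
  have h2 : hl.localInverse (C.map i x) = x := hl.localInverse_left_inv hl.localInverse_mem_target
  have h3 := ContMDiffAt.comp (C.map i x) (by rw [h2]; exact hf) h1
  refine h3.congr_of_eventuallyEq ?_
  filter_upwards [hl.localInverse_eventuallyEq_right] with y hy
  simpa [Function.comp_def] using congrArg f hy.symm

theorem contMDiffAt_map {i : ι} {x : Cn n} (hx : x ∈ C.dom i) :
    letI := C.chartedSpace
    ContMDiffAt 𝓘(ℂ, Cn n) 𝓘(ℂ, Cn n) ω (C.map i) x := by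
  let := C.chartedSpace
  exact (C.isLocalDiffeomorphAt hx).contMDiffAt

end EtaleCover

/-! ### Pull-back of forms from a manifold to `ℂᵐ` -/

section Mpull

variable {m n : ℕ} {M : Type*} [TopologicalSpace M] [ChartedSpace (Cn n) M]

/-- The pull-back to `ℂᵐ` of a form on a manifold. -/
def mpull {k : ℕ} (f : Cn m → M) (α : ∀ x : M, Tan n M x [⋀^Fin k]→L[ℝ] ℝ) :
    Cn m → Cn m [⋀^Fin k]→L[ℝ] ℝ :=
  fun u => (α (f u)).compContinuousLinearMap
    ((mfderiv 𝓘(ℂ, Cn m) 𝓘(ℂ, Cn n) f u : Cn m →L[ℂ] Tan n M (f u)).restrictScalars ℝ)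

/-- The pull-back of a form by a map between open subsets of complex coordinate spaces. -/
def pullForm {k : ℕ} (f : Cn m → Cn n) (α : Cn n → Cn n [⋀^Fin k]→L[ℝ] ℝ) :
    Cn m → Cn m [⋀^Fin k]→L[ℝ] ℝ :=
  fun u => (α (f u)).compContinuousLinearMap (fderiv ℝ f u)

/-- Chain rule; holomorphy of `φ` identifies its real derivative, used in `pullForm`, with the
complex one used in `mpull`. -/
theorem mpull_comp {k l : ℕ} {P : Cn m → M} {φ : Cn l → Cn m}
    (α : ∀ x : M, Tan n M x [⋀^Fin k]→L[ℝ] ℝ) {u : Cn l}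
    (hφ : DifferentiableAt ℂ φ u) (hP : MDifferentiableAt 𝓘(ℂ, Cn m) 𝓘(ℂ, Cn n) P (φ u)) :
    mpull (P ∘ φ) α u = pullForm φ (mpull P α) u := by
  have h := mfderiv_comp u hP hφ.mdifferentiableAt
  ext v
  simp only [mpull, pullForm, ContinuousAlternatingMap.compContinuousLinearMap_apply]
  rw [h, hφ.fderiv_restrictScalars ℝ, mfderiv_eq_fderiv]
  rfl

end Mpull
end

noncomputable section

/-! ### Smoothness of forms -/

section SmoothForms

variable {X E : Type*} [NormedAddCommGroup X] [NormedSpace ℝ X] [NormedAddCommGroup E]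
  [NormedSpace ℝ E] {k : ℕ} {r : WithTop ℕ∞} {x : X}

theorem ContDiffAt.extDeriv {α : E → E [⋀^Fin k]→L[ℝ] ℝ} {x : E} (hα : ContDiffAt ℝ ∞ α x) :
    ContDiffAt ℝ ∞ (extDeriv α) x :=
  (ContinuousAlternatingMap.alternatizeUncurryFinCLM ℝ E ℝ).contDiff.contDiffAt.comp x
    (hα.fderiv_right (by simp))

variable [FiniteDimensional ℝ E]

theorem finiteDimensional_continuousAlternatingMap :
    FiniteDimensional ℝ (E [⋀^Fin k]→L[ℝ] ℝ) := by
  let T : (E [⋀^Fin k]→L[ℝ] ℝ) →ₗ[ℝ] MultilinearMap ℝ (fun _ : Fin k => E) ℝ :=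
    { toFun := fun A => A.toMultilinearMap
      map_add' := fun _ _ => rfl
      map_smul' := fun _ _ => rfl }
  refine FiniteDimensional.of_injective T fun A B h => ?_
  ext v
  exact congrArg (fun f : MultilinearMap ℝ (fun _ : Fin k => E) ℝ => f v) h

/-- An alternating form is determined by its values on tuples of basis vectors, so evaluation on
them has a linear left inverse. Smoothness can therefore be tested coefficientwise. -/
theorem contDiffAt_form {α : X → E [⋀^Fin k]→L[ℝ] ℝ}
    (h : ∀ v, ContDiffAt ℝ r (fun y => α y v) x) : ContDiffAt ℝ r α x := by
  have := finiteDimensional_continuousAlternatingMap (E := E) (k := k)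
  let b := Module.finBasis ℝ E
  let J := Fin k → Fin (Module.finrank ℝ E)
  let ev : (E [⋀^Fin k]→L[ℝ] ℝ) →ₗ[ℝ] (J → ℝ) :=
    { toFun := fun A s => A (fun i => b (s i))
      map_add' := fun _ _ => rfl
      map_smul' := fun _ _ => rfl }
  have hinj : LinearMap.ker ev = ⊥ := by
    rw [LinearMap.ker_eq_bot]
    intro A B hAB
    have : A.toMultilinearMap = B.toMultilinearMap :=
      Module.Basis.ext_multilinear (fun _ => b) fun s => congrFun hAB s
    ext v
    exact congrArg (fun f : MultilinearMap ℝ (fun _ : Fin k => E) ℝ => f v) this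
  obtain ⟨L, hL⟩ := ev.exists_leftInverse_of_injective hinj
  have hα : α = fun y => L.toContinuousLinearMap (ev (α y)) := by
    ext1 y
    exact (LinearMap.congr_fun hL (α y)).symm
  rw [hα]
  exact L.toContinuousLinearMap.contDiff.contDiffAt.comp x (contDiffAt_pi.2 fun s => h _)

theorem ContDiffAt.form_apply {α : X → E [⋀^Fin k]→L[ℝ] ℝ} {w : Fin k → X → E}
    (hα : ContDiffAt ℝ r α x) (hw : ∀ i, ContDiffAt ℝ r (w i) x) :
    ContDiffAt ℝ r (fun y => α y (fun i => w i y)) x := by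
  let b := Module.finBasis ℝ E
  have key : ∀ y, α y (fun i => w i y) = ∑ s : Fin k → Fin (Module.finrank ℝ E),
      (∏ i, b.repr (w i y) (s i)) * α y (fun i => b (s i)) := by
    intro y
    have h1 : (fun i => w i y) = fun i => ∑ j, b.repr (w i y) j • b j := by
      ext1 i
      exact (b.sum_repr _).symm
    rw [h1]
    have h2 := (α y).toMultilinearMap.map_sum (fun i j => b.repr (w i y) j • b j)
    refine h2.trans (Finset.sum_congr rfl fun s _ => ?_)
    exact (α y).toMultilinearMap.map_smul_univ _ _
  simp_rw [key]
  refine ContDiffAt.sum fun s _ => ContDiffAt.mul (contDiffAt_prod fun i _ => ?_) ?_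
  · exact (b.coord (s i)).toContinuousLinearMap.contDiff.contDiffAt.comp x (hw i)
  · exact (ContinuousAlternatingMap.apply ℝ E ℝ _).contDiff.contDiffAt.comp x hα

end SmoothForms

/-! ### Naturality of `d dᶜ` -/

section Naturality

variable {m n k : ℕ}

@[simp] theorem multI_apply {V : Type*} [AddCommGroup V] [Module ℂ V] [TopologicalSpace V]
    [ContinuousConstSMul ℂ V] (v : V) : multI V v = Complex.I • v := by
  simp [multI]

theorem Jform_apply (α : Cn n → Cn n [⋀^Fin k]→L[ℝ] ℝ) (u : Cn n) (v : Fin k → Cn n) :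
    Jform α u v = α u fun i => Complex.I • v i := by
  simp only [Jform, ContinuousAlternatingMap.compContinuousLinearMap_apply]
  rfl

theorem JinvForm_apply (α : Cn n → Cn n [⋀^Fin k]→L[ℝ] ℝ) (u : Cn n) (v : Fin k → Cn n) :
    JinvForm α u v = α u fun i => -(Complex.I • v i) := by
  simp only [JinvForm, ContinuousAlternatingMap.compContinuousLinearMap_apply]
  rfl

theorem ContDiffAt.jform {r : WithTop ℕ∞} {α : Cn n → Cn n [⋀^Fin k]→L[ℝ] ℝ} {x : Cn n}
    (hα : ContDiffAt ℝ r α x) : ContDiffAt ℝ r (Jform α) x :=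
  ContDiffAt.comp (g := ContinuousAlternatingMap.compContinuousLinearMapCLM (F := ℝ) (ι := Fin k)
    (multI (Cn n))) x (ContinuousLinearMap.contDiff _).contDiffAt hα

theorem ContDiffAt.jinvForm {r : WithTop ℕ∞} {α : Cn n → Cn n [⋀^Fin k]→L[ℝ] ℝ} {x : Cn n}
    (hα : ContDiffAt ℝ r α x) : ContDiffAt ℝ r (JinvForm α) x :=
  ContDiffAt.comp (g := ContinuousAlternatingMap.compContinuousLinearMapCLM (F := ℝ) (ι := Fin k)
    (-multI (Cn n))) x (ContinuousLinearMap.contDiff _).contDiffAt hα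

theorem DifferentiableAt.jform {α : Cn n → Cn n [⋀^Fin k]→L[ℝ] ℝ} {x : Cn n}
    (hα : DifferentiableAt ℝ α x) : DifferentiableAt ℝ (Jform α) x :=
  DifferentiableAt.comp (g := ContinuousAlternatingMap.compContinuousLinearMapCLM (F := ℝ)
    (ι := Fin k) (multI (Cn n))) x (ContinuousLinearMap.differentiableAt _) hα

theorem ContDiffAt.dcForm {α : Cn n → Cn n [⋀^Fin k]→L[ℝ] ℝ} {x : Cn n}
    (hα : ContDiffAt ℝ ∞ α x) : ContDiffAt ℝ ∞ (dcForm α) x :=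
  hα.jform.extDeriv.jinvForm

theorem fderiv_real_smul_I {f : Cn m → Cn n} {x : Cn m} (hf : DifferentiableAt ℂ f x)
    (v : Cn m) : fderiv ℝ f x (Complex.I • v) = Complex.I • fderiv ℝ f x v := by
  rw [hf.fderiv_restrictScalars ℝ]
  simp

theorem ContDiffAt.eventually_differentiableAt {f : Cn m → Cn n} {x : Cn m}
    (hf : ContDiffAt ℂ ω f x) : ∀ᶠ y in 𝓝 x, DifferentiableAt ℂ f y := by
  have := (hf.of_le (m := 1) le_top).eventually (by simp)
  filter_upwards [this] with y hy
  exact hy.differentiableAt (by simp)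

theorem Jform_pullForm {f : Cn m → Cn n} {x : Cn m} (hf : DifferentiableAt ℂ f x)
    (α : Cn n → Cn n [⋀^Fin k]→L[ℝ] ℝ) :
    Jform (pullForm f α) x = pullForm f (Jform α) x := by
  ext v
  simp only [Jform_apply, pullForm, ContinuousAlternatingMap.compContinuousLinearMap_apply]
  congr 1
  ext1 i
  simp [fderiv_real_smul_I hf]

theorem JinvForm_pullForm {f : Cn m → Cn n} {x : Cn m} (hf : DifferentiableAt ℂ f x)
    (α : Cn n → Cn n [⋀^Fin k]→L[ℝ] ℝ) :
    JinvForm (pullForm f α) x = pullForm f (JinvForm α) x := by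
  ext v
  simp only [JinvForm_apply, pullForm, ContinuousAlternatingMap.compContinuousLinearMap_apply]
  congr 1
  ext1 i
  simp [fderiv_real_smul_I hf]

theorem ContDiffAt.real {f : Cn m → Cn n} {x : Cn m} (hf : ContDiffAt ℂ ω f x) :
    ContDiffAt ℝ ω f x := hf.restrict_scalars ℝ

theorem dcForm_pullForm {f : Cn m → Cn n} {x : Cn m} (hf : ContDiffAt ℂ ω f x)
    {α : Cn n → Cn n [⋀^Fin k]→L[ℝ] ℝ} (hα : DifferentiableAt ℝ α (f x)) :
    dcForm (pullForm f α) x = pullForm f (dcForm α) x := by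
  have h1 : Jform (pullForm f α) =ᶠ[𝓝 x] pullForm f (Jform α) := by
    filter_upwards [hf.eventually_differentiableAt] with y hy
    exact Jform_pullForm hy α
  have h2 : extDeriv (Jform (pullForm f α)) x = pullForm f (extDeriv (Jform α)) x := by
    rw [h1.extDeriv_eq]
    exact extDeriv_pullback (hα.jform) hf.real (by simp)
  have h3 := JinvForm_pullForm (hf.differentiableAt (by simp)) (extDeriv (Jform α))
  rw [dcForm, show dcForm α = JinvForm (extDeriv (Jform α)) from rfl, ← h3, JinvForm, JinvForm, h2]

/-- The exterior derivative commutes with smooth pull-back and J with holomorphic pull-back. The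
identity for `dcForm` has to hold on a neighbourhood before it can be differentiated again. -/
theorem ddcForm_pullForm {f : Cn m → Cn n} {x : Cn m} (hf : ContDiffAt ℂ ω f x)
    {α : Cn n → Cn n [⋀^Fin k]→L[ℝ] ℝ} (hα : ContDiffAt ℝ ∞ α (f x)) :
    ddcForm (pullForm f α) x = pullForm f (ddcForm α) x := by
  have h1 : dcForm (pullForm f α) =ᶠ[𝓝 x] pullForm f (dcForm α) := by
    have hα' := hf.continuousAt.eventually ((hα.of_le (m := 1) (by simp)).eventually (by simp))
    filter_upwards [hf.eventually (by simp), hα'] with y hy hy'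
    exact dcForm_pullForm hy (hy'.differentiableAt (by simp))
  rw [ddcForm, h1.extDeriv_eq]
  exact extDeriv_pullback (hα.dcForm.differentiableAt (by simp)) hf.real (by simp)

theorem ContDiffAt.pullForm {f : Cn m → Cn n} {x : Cn m} (hf : ContDiffAt ℂ ω f x)
    {α : Cn n → Cn n [⋀^Fin k]→L[ℝ] ℝ} (hα : ContDiffAt ℝ ∞ α (f x)) :
    ContDiffAt ℝ ∞ (pullForm f α) x := by
  refine contDiffAt_form fun v => ?_
  have hr : ContDiffAt ℝ ∞ f x := hf.real.of_le le_top
  exact ContDiffAt.form_apply (α := fun y => α (f y)) (w := fun i y => fderiv ℝ f y (v i))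
    (hα.comp x hr) fun i => (hr.fderiv_right (m := ∞) (by simp)).clm_apply contDiffAt_const

end Naturality
end

noncomputable section

/-! ### Alternating sums -/

section AltSum

variable {V : Type*} {N : ℕ}

/-- The alternating sum of a function of `N` vectors over the permutations of its arguments. -/
def altSum (f : (Fin N → V) → ℝ) (v : Fin N → V) : ℝ :=
  ∑ σ : Equiv.Perm (Fin N), (Equiv.Perm.sign σ : ℝ) * f (v ∘ σ)

theorem altSum_comp_perm (f : (Fin N → V) → ℝ) (ρ : Equiv.Perm (Fin N)) (v : Fin N → V) :
    altSum (fun w => f (w ∘ ρ)) v = (Equiv.Perm.sign ρ : ℝ) * altSum f v := by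
  unfold altSum
  rw [Finset.mul_sum]
  conv_rhs => rw [← Equiv.sum_comp (Equiv.mulRight ρ)]
  refine Finset.sum_congr rfl fun σ _ => ?_
  have h : ((Equiv.Perm.sign ρ : ℤ) : ℝ) * (Equiv.Perm.sign ρ : ℤ) = 1 := by
    rcases Int.units_eq_one_or (Equiv.Perm.sign ρ) with h | h <;> simp [h]
  simp only [Equiv.coe_mulRight, Equiv.Perm.sign_mul, Units.val_mul, Int.cast_mul,
    Function.comp_assoc, Equiv.Perm.coe_mul]
  linear_combination (-(Equiv.Perm.sign σ : ℝ) * f (v ∘ σ ∘ ρ)) * h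

theorem altSum_add (f g : (Fin N → V) → ℝ) (v : Fin N → V) :
    altSum (fun w => f w + g w) v = altSum f v + altSum g v := by
  simp [altSum, mul_add, Finset.sum_add_distrib]

theorem altSum_sub (f g : (Fin N → V) → ℝ) (v : Fin N → V) :
    altSum (fun w => f w - g w) v = altSum f v - altSum g v := by
  simp [altSum, mul_sub, Finset.sum_sub_distrib]

theorem altSum_const_mul (c : ℝ) (f : (Fin N → V) → ℝ) (v : Fin N → V) :
    altSum (fun w => c * f w) v = c * altSum f v := by
  simp [altSum, Finset.mul_sum, mul_left_comm]

theorem altSum_sum {ι : Type*} (s : Finset ι) (f : ι → (Fin N → V) → ℝ) (v : Fin N → V) :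
    altSum (fun w => ∑ i ∈ s, f i w) v = ∑ i ∈ s, altSum (f i) v := by
  simp only [altSum, Finset.mul_sum]
  exact Finset.sum_comm

/-- A transposition has sign -1, so the sum equals its own negative. -/
theorem altSum_eq_zero_of_swap {f : (Fin N → V) → ℝ} {i j : Fin N} (hij : i ≠ j)
    (h : ∀ w, f (w ∘ Equiv.swap i j) = f w) (v : Fin N → V) : altSum f v = 0 := by
  have := altSum_comp_perm f (Equiv.swap i j) v
  simp only [h, Equiv.Perm.sign_swap hij] at this
  push_cast at this
  change altSum f v = _ at this
  linarith

theorem altSum_swap {f : (Fin N → V) → ℝ} {i j : Fin N} (hij : i ≠ j) (v : Fin N → V) :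
    altSum (fun w => f (w ∘ Equiv.swap i j)) v = -altSum f v := by
  rw [altSum_comp_perm, Equiv.Perm.sign_swap hij]
  simp

theorem altSum_congr {f g : (Fin N → V) → ℝ} (h : ∀ w, f w = g w) (v : Fin N → V) :
    altSum f v = altSum g v := by rw [funext h]

/-- Each permutation of the first block extends by the identity on the second, and the outer sum
absorbs it together with its sign. The `p!` terms of the inner sum thus contribute equally; this is
the mechanism behind associativity of the wedge product. -/
theorem altSum_altSum_mul {p q : ℕ} (f : (Fin p → V) → ℝ) (g : (Fin q → V) → ℝ)
    (v : Fin (p + q) → V) :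
    altSum (fun w => altSum f (fun i => w (Fin.castAdd q i)) * g (fun i => w (Fin.natAdd p i))) v =
      p.factorial *
        altSum (fun w => f (fun i => w (Fin.castAdd q i)) * g (fun i => w (Fin.natAdd p i))) v := by
  let h : (Fin (p + q) → V) → ℝ :=
    fun w => f (fun i => w (Fin.castAdd q i)) * g (fun i => w (Fin.natAdd p i))
  let ext : Equiv.Perm (Fin p) → Equiv.Perm (Fin (p + q)) := fun τ =>
    finSumFinEquiv.permCongr (Equiv.Perm.sumCongr τ 1)
  have hs : ∀ τ, Equiv.Perm.sign (ext τ) = Equiv.Perm.sign τ := by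
    intro τ
    simp [ext, Equiv.Perm.sign_permCongr]
  have h1 : ∀ w : Fin (p + q) → V,
      altSum f (fun i => w (Fin.castAdd q i)) * g (fun i => w (Fin.natAdd p i)) =
        ∑ τ : Equiv.Perm (Fin p), (Equiv.Perm.sign τ : ℝ) * h (w ∘ ext τ) := by
    intro w
    rw [altSum, Finset.sum_mul]
    refine Finset.sum_congr rfl fun τ _ => ?_
    simp only [h, ext, Function.comp_def, Equiv.permCongr_apply, finSumFinEquiv_symm_apply_castAdd,
      finSumFinEquiv_symm_apply_natAdd, Equiv.Perm.sumCongr_apply, Sum.map_inl, Sum.map_inr,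
      finSumFinEquiv_apply_left, finSumFinEquiv_apply_right, Equiv.Perm.coe_one, id, mul_assoc]
  rw [altSum_congr h1, altSum_sum]
  have h2 : ∀ τ : Equiv.Perm (Fin p),
      altSum (fun w => (Equiv.Perm.sign τ : ℝ) * h (w ∘ ext τ)) v = altSum h v := by
    intro τ
    rw [altSum_const_mul, altSum_comp_perm, hs]
    rcases Int.units_eq_one_or (Equiv.Perm.sign τ) with h | h <;> simp [h]
  rw [Finset.sum_congr rfl fun τ _ => h2 τ]
  simp [Fintype.card_perm, h]

variable [AddCommGroup V] [Module ℝ V] [TopologicalSpace V]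

theorem altSum_alternating (A : V [⋀^Fin N]→L[ℝ] ℝ) (v : Fin N → V) :
    altSum A v = N.factorial * A v := by
  have h : ∀ σ : Equiv.Perm (Fin N), (Equiv.Perm.sign σ : ℝ) * A (v ∘ σ) = A v := by
    intro σ
    have h1 := A.toAlternatingMap.map_perm v σ
    have h2 : A (v ∘ σ) = Equiv.Perm.sign σ • A v := h1
    rw [h2]
    rcases Int.units_eq_one_or (Equiv.Perm.sign σ) with h | h <;> simp [h]
  simp [altSum, h, Fintype.card_perm]

theorem wedge_apply {p q : ℕ} (α : V [⋀^Fin p]→L[ℝ] ℝ) (β : V [⋀^Fin q]→L[ℝ] ℝ)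
    (v : Fin (p + q) → V) :
    wedge α β v = (p.factorial * q.factorial : ℝ)⁻¹ *
      altSum (fun w => α (fun i => w (Fin.castAdd q i)) * β (fun i => w (Fin.natAdd p i))) v := by
  simp only [wedge, ContinuousAlternatingMap.smul_apply, smul_eq_mul,
    ContinuousMultilinearMap.alternatization_apply_apply, altSum]
  congr 1
  refine Finset.sum_congr rfl fun σ _ => ?_
  rw [Units.smul_def, zsmul_eq_mul]
  rfl

/-- The tensor power of a `2`-form. -/
def tensorPow (F : V [⋀^Fin 2]→L[ℝ] ℝ) : (k : ℕ) → (Fin (2 * k) → V) → ℝ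
  | 0 => fun _ => 1
  | k + 1 => fun w => tensorPow F k (fun i => w (Fin.castAdd 2 i)) *
      F (fun i => w (Fin.natAdd (2 * k) i))

/-- The normalising factorials of the iterated wedge products telescope, leaving one factor 1/2! per
copy of `F`. -/
theorem wedgePow_apply (F : V [⋀^Fin 2]→L[ℝ] ℝ) (k : ℕ) (v : Fin (2 * k) → V) :
    wedgePow F k v = ((2 : ℝ) ^ k)⁻¹ * altSum (tensorPow F k) v := by
  induction k with
  | zero =>
    have : altSum (tensorPow F 0) v = 1 := by
      rw [altSum, Finset.sum_eq_single 1]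
      · simp [tensorPow]
      · exact fun σ _ h => absurd (Equiv.ext fun i => Fin.elim0 i) h
      · simp
    simp [wedgePow, this]
  | succ k ih =>
    refine (wedge_apply (wedgePow F k) F v).trans ?_
    have h : ∀ w : Fin (2 * k + 2) → V,
        wedgePow F k (fun i => w (Fin.castAdd 2 i)) * F (fun i => w (Fin.natAdd (2 * k) i)) =
        ((2 : ℝ) ^ k)⁻¹ * (altSum (tensorPow F k) (fun i => w (Fin.castAdd 2 i)) *
          F (fun i => w (Fin.natAdd (2 * k) i))) := by
      intro w
      rw [ih, mul_assoc]
    rw [altSum_congr h, altSum_const_mul, altSum_altSum_mul (tensorPow F k) F]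
    have hf : ((2 * k).factorial : ℝ) ≠ 0 := by positivity
    change _ = _ * altSum (fun w : Fin (2 * k + 2) → V => tensorPow F k (fun i => w (Fin.castAdd 2 i)) *
      F (fun i => w (Fin.natAdd (2 * k) i))) v
    rw [pow_succ]
    simp only [Nat.factorial_two]
    field_simp
    push_cast
    ring

end AltSum
end

noncomputable section

/-! ### A criterion for `d dᶜ α = 0` -/

section Criterion

variable {n m : ℕ}

/-- On the arguments that are not differentiated, J and J⁻¹ cancel. All that remains of the complex
structure is the direction of differentiation, -i times the omitted vector. -/
theorem dcForm_apply {α : Cn n → Cn n [⋀^Fin m]→L[ℝ] ℝ} {u : Cn n} (hα : DifferentiableAt ℝ α u)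
    (w : Fin (m + 1) → Cn n) :
    dcForm α u w = ∑ j, (-1) ^ j.val *
      fderiv ℝ (fun z => α z (j.removeNth w)) u (-(Complex.I • w j)) := by
  rw [dcForm, JinvForm_apply, extDeriv_apply hα.jform]
  refine Finset.sum_congr rfl fun j _ => ?_
  have : (fun z => Jform α z (j.removeNth fun i => -(Complex.I • w i))) =
      fun z => α z (j.removeNth w) := by
    ext z
    rw [Jform_apply]
    congr 1
    ext1 i
    simp [Fin.removeNth, smul_smul]
  rw [this, zsmul_eq_mul]
  push_cast
  rfl

theorem ddcForm_apply {α : Cn n → Cn n [⋀^Fin m]→L[ℝ] ℝ} (hα : ContDiff ℝ ∞ α) (u : Cn n)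
    (v : Fin (m + 2) → Cn n) :
    ddcForm α u v = ∑ i, (-1) ^ i.val * ∑ j, (-1) ^ j.val *
      fderiv ℝ (fun y => fderiv ℝ (fun z => α z (j.removeNth (i.removeNth v))) y
        (-(Complex.I • i.removeNth v j))) u (v i) := by
  have hd : ∀ y, DifferentiableAt ℝ α y := fun y => hα.contDiffAt.differentiableAt (by simp)
  rw [ddcForm, extDeriv_apply (hα.contDiffAt.dcForm.differentiableAt (by simp))]
  refine Finset.sum_congr rfl fun i _ => ?_
  rw [zsmul_eq_mul]
  push_cast
  congr 1
  have : (fun y => dcForm α y (i.removeNth v)) = fun y => ∑ j : Fin (m + 1), (-1 : ℝ) ^ j.val *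
      fderiv ℝ (fun z => α z (j.removeNth (i.removeNth v))) y
        (-(Complex.I • i.removeNth v j)) := by
    ext y
    exact dcForm_apply (hd y) _
  have hdiff : ∀ j : Fin (m + 1), DifferentiableAt ℝ
      (fun y => fderiv ℝ (fun z => α z (j.removeNth (i.removeNth v))) y
        (-(Complex.I • i.removeNth v j))) u := by
    intro j
    have h1 : ContDiff ℝ ∞ fun z => α z (j.removeNth (i.removeNth v)) :=
      ContDiff.comp (g := ContinuousAlternatingMap.apply ℝ (Cn n) ℝ (j.removeNth (i.removeNth v)))
        (ContinuousLinearMap.contDiff _) hα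
    exact ((h1.contDiffAt.fderiv_right (m := ∞) (by simp)).clm_apply
      contDiffAt_const).differentiableAt (by simp)
  rw [this, fderiv_fun_sum fun j _ => (hdiff j).const_mul _, _root_.sum_apply]
  refine Finset.sum_congr rfl fun j _ => ?_
  rw [fderiv_const_mul (hdiff j)]
  rfl

/-- The permutation that moves the indices `i` and `i.succAbove j` to the front. -/
def frontPerm (i : Fin (m + 2)) (j : Fin (m + 1)) (τ : Equiv.Perm (Fin m)) :
    Equiv.Perm (Fin (m + 2)) :=
  Equiv.ofBijective
    (Fin.cons i (Fin.cons (i.succAbove j) fun l => i.succAbove (j.succAbove (τ l))))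
    (Finite.injective_iff_bijective.1 (by
      rw [Fin.cons_injective_iff, Fin.cons_injective_iff]
      refine ⟨?_, ?_, ?_⟩
      · rintro ⟨l, hl⟩
        refine Fin.cases (fun hl => ?_) (fun l hl => ?_) l hl
        · exact Fin.succAbove_ne _ _ hl
        · exact Fin.succAbove_ne _ _ hl
      · rintro ⟨l, hl⟩
        exact Fin.succAbove_ne _ _ (Fin.succAbove_right_injective hl)
      · exact Fin.succAbove_right_injective.comp
          (Fin.succAbove_right_injective.comp τ.injective)))

theorem comp_frontPerm (i : Fin (m + 2)) (j : Fin (m + 1)) (τ : Equiv.Perm (Fin m))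
    (w : Fin (m + 2) → Cn n) :
    w ∘ frontPerm i j τ =
      Fin.cons (w i) (Fin.cons (i.removeNth w j) (j.removeNth (i.removeNth w) ∘ τ)) := by
  ext1 l
  refine Fin.cases ?_ (fun l => Fin.cases ?_ (fun l => ?_) l) l <;> rfl

/-- Being alternating, `ddcForm α u` vanishes once its alternating sum does. In that sum every term
of the double exterior derivative of `altSum (S z)` is, up to sign, a permutation of one expression:
the second derivative of `S` in the directions of the first two arguments, the second of them
rotated by -i. The constant part `c` is killed by differentiation. -/
theorem ddcForm_eq_zero_of_altSum {α : Cn n → Cn n [⋀^Fin m]→L[ℝ] ℝ} (hα : ContDiff ℝ ∞ α)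
    (c : (Fin m → Cn n) → ℝ) (a : ℝ) (S : Cn n → (Fin m → Cn n) → ℝ)
    (hS : ∀ w, ContDiff ℝ ∞ fun z => S z w)
    (hαS : ∀ z w, α z w = c w + a * altSum (S z) w) (u : Cn n)
    (h0 : ∀ v, altSum (fun w : Fin (m + 2) → Cn n =>
      fderiv ℝ (fun y => fderiv ℝ (fun z => S z (fun l => w l.succ.succ)) y
        (-(Complex.I • w 1))) u (w 0)) v = 0) :
    ddcForm α u = 0 := by
  let S2 : Cn n → Cn n → (Fin m → Cn n) → ℝ := fun x y w =>
    fderiv ℝ (fun y' => fderiv ℝ (fun z => S z w) y' (-(Complex.I • y))) u x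
  have hd1 : ∀ w y, DifferentiableAt ℝ (fun z => S z w) y := fun w y =>
    (hS w).contDiffAt.differentiableAt (by simp)
  have hd2 : ∀ w y, DifferentiableAt ℝ (fun y' => fderiv ℝ (fun z => S z w) y' y) u := fun w y =>
    (((hS w).contDiffAt.fderiv_right (m := ∞) (by simp)).clm_apply
      contDiffAt_const).differentiableAt (by simp)
  have key : ∀ (w : Fin m → Cn n) (x y : Cn n),
      fderiv ℝ (fun y' => fderiv ℝ (fun z => α z w) y' (-(Complex.I • y))) u x =
        a * ∑ τ : Equiv.Perm (Fin m), (Equiv.Perm.sign τ : ℝ) * S2 x y (w ∘ τ) := by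
    intro w x y
    have h1 : ∀ y', fderiv ℝ (fun z => α z w) y' (-(Complex.I • y)) =
        a * ∑ τ : Equiv.Perm (Fin m), (Equiv.Perm.sign τ : ℝ) *
          fderiv ℝ (fun z => S z (w ∘ τ)) y' (-(Complex.I • y)) := by
      intro y'
      have : (fun z => α z w) = fun z => c w + a * ∑ τ : Equiv.Perm (Fin m),
          (Equiv.Perm.sign τ : ℝ) * S z (w ∘ τ) := by
        ext z
        exact hαS z w
      rw [this, fderiv_const_add, fderiv_const_mul
        (DifferentiableAt.fun_sum fun τ _ => (hd1 _ _).const_mul _),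
        fderiv_fun_sum fun τ _ => (hd1 _ _).const_mul _]
      simp only [_root_.smul_apply, _root_.sum_apply, smul_eq_mul]
      congr 1
      refine Finset.sum_congr rfl fun τ _ => ?_
      rw [fderiv_const_mul (hd1 _ _)]
      rfl
    rw [funext h1, fderiv_const_mul
        (DifferentiableAt.fun_sum fun τ _ => (hd2 _ _).const_mul _),
        fderiv_fun_sum fun τ _ => (hd2 _ _).const_mul _]
    simp only [_root_.smul_apply, _root_.sum_apply, smul_eq_mul]
    congr 1
    refine Finset.sum_congr rfl fun τ _ => ?_
    rw [fderiv_const_mul (hd2 _ _)]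
    rfl
  ext v
  have hv := altSum_alternating (ddcForm α u) v
  -- Every triple (first omitted index, second omitted index, permutation of the rest) is recorded
  -- as one permutation of all arguments, so that `altSum_comp_perm` applies term by term.
  have hexp : ∀ w : Fin (m + 2) → Cn n, ddcForm α u w =
      ∑ i, ∑ j, ∑ τ, ((-1) ^ i.val * (-1) ^ j.val * a * (Equiv.Perm.sign τ : ℝ)) *
        S2 ((w ∘ frontPerm i j τ) 0) ((w ∘ frontPerm i j τ) 1)
          (fun l => (w ∘ frontPerm i j τ) l.succ.succ) := by
    intro w
    rw [ddcForm_apply hα]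
    refine Finset.sum_congr rfl fun i _ => ?_
    rw [Finset.mul_sum]
    refine Finset.sum_congr rfl fun j _ => ?_
    rw [key, Finset.mul_sum, Finset.mul_sum, Finset.mul_sum]
    refine Finset.sum_congr rfl fun τ _ => ?_
    rw [comp_frontPerm, show (1 : Fin (m + 2)) = Fin.succ 0 from rfl]
    simp only [Fin.cons_zero, Fin.cons_succ]
    ring_nf
  have hzero : altSum (ddcForm α u) v = 0 := by
    rw [altSum_congr hexp, altSum_sum]
    refine Finset.sum_eq_zero fun i _ => ?_
    rw [altSum_sum]
    refine Finset.sum_eq_zero fun j _ => ?_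
    rw [altSum_sum]
    refine Finset.sum_eq_zero fun τ _ => ?_
    rw [altSum_const_mul, altSum_comp_perm (fun w : Fin (m + 2) → Cn n =>
      S2 (w 0) (w 1) fun l => w l.succ.succ), h0 v, mul_zero, mul_zero]
  rw [hzero] at hv
  have hf : ((m + 2).factorial : ℝ) ≠ 0 := by positivity
  simpa [hf] using hv.symm

end Criterion
end

noncomputable section

/-! ### An identity for alternating sums of Hermitian expressions -/

section CoordForms

variable {n N : ℕ}

/-- The form `dx_j ∧ dy_j` on `ℂⁿ`. -/
def coordForm (j : Fin n) (a b : Cn n) : ℝ := (a j).re * (b j).im - (a j).im * (b j).re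

/-- dx ∧ dy ∧ dx = 0: each of the two monomials of `coordForm` times the extra factor is symmetric
in the two slots carrying dx. The hypotheses on `h` are the invariance under the two exchanges that
occur. -/
theorem altSum_coordForm_mul_re (j : Fin n) {s t r : Fin N} (hst : s ≠ t) (hsr : s ≠ r)
    (htr : t ≠ r) {h : (Fin N → Cn n) → ℝ} (h1 : ∀ w, h (w ∘ Equiv.swap s r) = h w)
    (h2 : ∀ w, h (w ∘ Equiv.swap t r) = h w) (v : Fin N → Cn n) :
    altSum (fun w => coordForm j (w s) (w t) * (w r j).re * h w) v = 0 := by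
  have e : ∀ w : Fin N → Cn n, coordForm j (w s) (w t) * (w r j).re * h w =
      (w s j).re * (w t j).im * (w r j).re * h w - (w s j).im * (w t j).re * (w r j).re * h w := by
    intro w
    rw [coordForm]
    ring
  rw [altSum_congr e, altSum_sub, altSum_eq_zero_of_swap hsr, altSum_eq_zero_of_swap htr, sub_zero]
  · intro w
    simp only [h2, Function.comp_apply, Equiv.swap_apply_left, Equiv.swap_apply_right,
      Equiv.swap_apply_of_ne_of_ne hst hsr]
    ring
  · intro w
    simp only [h1, Function.comp_apply, Equiv.swap_apply_left, Equiv.swap_apply_right,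
      Equiv.swap_apply_of_ne_of_ne hst.symm htr]
    ring

theorem altSum_coordForm_mul_im (j : Fin n) {s t r : Fin N} (hst : s ≠ t) (hsr : s ≠ r)
    (htr : t ≠ r) {h : (Fin N → Cn n) → ℝ} (h1 : ∀ w, h (w ∘ Equiv.swap s r) = h w)
    (h2 : ∀ w, h (w ∘ Equiv.swap t r) = h w) (v : Fin N → Cn n) :
    altSum (fun w => coordForm j (w s) (w t) * (w r j).im * h w) v = 0 := by
  have e : ∀ w : Fin N → Cn n, coordForm j (w s) (w t) * (w r j).im * h w =
      (w s j).re * (w t j).im * (w r j).im * h w - (w s j).im * (w t j).re * (w r j).im * h w := by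
    intro w
    rw [coordForm]
    ring
  rw [altSum_congr e, altSum_sub, altSum_eq_zero_of_swap htr, altSum_eq_zero_of_swap hsr, sub_zero]
  · intro w
    simp only [h1, Function.comp_apply, Equiv.swap_apply_left, Equiv.swap_apply_right,
      Equiv.swap_apply_of_ne_of_ne hst.symm htr]
    ring
  · intro w
    simp only [h2, Function.comp_apply, Equiv.swap_apply_left, Equiv.swap_apply_right,
      Equiv.swap_apply_of_ne_of_ne hst hsr]
    ring

/-- (dx ∧ dy)² = 0: expanding one factor leaves a triple product with a repeated dx or dy. Only
exchanges between the two pairs of slots are needed, so `h` has to be invariant under these alone.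
-/
theorem altSum_coordForm_sq (j : Fin n) {s t r q : Fin N} (hst : s ≠ t) (hsr : s ≠ r)
    (htr : t ≠ r) (hsq : s ≠ q) (htq : t ≠ q) (hrq : r ≠ q) {h : (Fin N → Cn n) → ℝ}
    (hh : ∀ w, ∀ i ∈ ({s, t} : Set (Fin N)), ∀ k ∈ ({r, q} : Set (Fin N)),
      h (w ∘ Equiv.swap i k) = h w) (v : Fin N → Cn n) :
    altSum (fun w => coordForm j (w s) (w t) * coordForm j (w r) (w q) * h w) v = 0 := by
  have e : ∀ w : Fin N → Cn n, coordForm j (w s) (w t) * coordForm j (w r) (w q) * h w =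
      coordForm j (w s) (w t) * (w r j).re * ((w q j).im * h w) -
      coordForm j (w s) (w t) * (w r j).im * ((w q j).re * h w) := by
    intro w
    simp only [coordForm]
    ring
  rw [altSum_congr e, altSum_sub, altSum_coordForm_mul_re j hst hsr htr,
    altSum_coordForm_mul_im j hst hsr htr, sub_zero]
  all_goals
    intro w
    rw [hh _ _ (by simp) _ (by simp)]
    simp only [Function.comp_apply, Equiv.swap_apply_of_ne_of_ne hsq.symm hrq.symm,
      Equiv.swap_apply_of_ne_of_ne htq.symm hrq.symm]

end CoordForms

/-! ### The quadratic identity behind the choice of constants in B -/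

section NilIdentity

/-- The alternating sum of a product of three coordinate forms. -/
def coordTriple (v : Fin 6 → Cn 5) (j k l : Fin 5) : ℝ :=
  altSum (fun w => coordForm j (w 0) (w 1) * coordForm k (w 2) (w 3) * coordForm l (w 4) (w 5)) v

theorem coordTriple_swap_left (v : Fin 6 → Cn 5) (j k l : Fin 5) :
    coordTriple v j k l = coordTriple v k j l := by
  have h := altSum_comp_perm (fun w : Fin 6 → Cn 5 =>
    coordForm k (w 0) (w 1) * coordForm j (w 2) (w 3) * coordForm l (w 4) (w 5))
    (Equiv.swap 0 2 * Equiv.swap 1 3) v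
  have hs : Equiv.Perm.sign (Equiv.swap (0 : Fin 6) 2 * Equiv.swap 1 3) = 1 := by decide
  rw [hs] at h
  simp only [Units.val_one, Int.cast_one, one_mul] at h
  rw [coordTriple, coordTriple, ← h]
  refine altSum_congr (fun w => ?_) v
  change _ = coordForm k (w 2) (w 3) * coordForm j (w 0) (w 1) * coordForm l (w 4) (w 5)
  ring

theorem coordTriple_swap_right (v : Fin 6 → Cn 5) (j k l : Fin 5) :
    coordTriple v j k l = coordTriple v j l k := by
  have h := altSum_comp_perm (fun w : Fin 6 → Cn 5 =>
    coordForm j (w 0) (w 1) * coordForm l (w 2) (w 3) * coordForm k (w 4) (w 5))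
    (Equiv.swap 2 4 * Equiv.swap 3 5) v
  have hs : Equiv.Perm.sign (Equiv.swap (2 : Fin 6) 4 * Equiv.swap 3 5) = 1 := by decide
  rw [hs] at h
  simp only [Units.val_one, Int.cast_one, one_mul] at h
  rw [coordTriple, coordTriple, ← h]
  refine altSum_congr (fun w => ?_) v
  change _ = coordForm j (w 0) (w 1) * coordForm l (w 4) (w 5) * coordForm k (w 2) (w 3)
  ring

theorem coordTriple_self (v : Fin 6 → Cn 5) (j l : Fin 5) : coordTriple v j j l = 0 := by
  refine altSum_coordForm_sq j (by decide) (by decide) (by decide) (by decide) (by decide)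
    (by decide) (fun w i hi k hk => ?_) v
  have h4 : Equiv.swap i k 4 = 4 := Equiv.swap_apply_of_ne_of_ne
    (by rintro rfl; simp at hi) (by rintro rfl; simp at hk)
  have h5 : Equiv.swap i k 5 = 5 := Equiv.swap_apply_of_ne_of_ne
    (by rintro rfl; simp at hi) (by rintro rfl; simp at hk)
  simp only [Function.comp_apply, h4, h5]

theorem coordTriple_self_left (v : Fin 6 → Cn 5) (j l : Fin 5) : coordTriple v j l j = 0 := by
  rw [coordTriple_swap_right, coordTriple_self]

theorem coordTriple_self_right (v : Fin 6 → Cn 5) (j l : Fin 5) : coordTriple v l j j = 0 := by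
  rw [coordTriple_swap_left, coordTriple_self_left]

/-- The standard fundamental form of `ℂ⁴ ⊆ ℂ⁵`. -/
def baseForm (a b : Cn 5) : ℝ :=
  coordForm 0 a b + coordForm 1 a b + coordForm 2 a b + coordForm 3 a b

/-- The part of `nilForm` that is antilinear in the first variable. -/
def nilAnti (w z : Cn 5) : ℂ :=
  conj (w 0) * z 0 + conj (w 1) * z 1 + 2 * conj (w 2) * z 2 + 2 * conj (w 3) * z 3

/-- The part of `nilForm` that is linear in the first variable. -/
def nilLin (w z : Cn 5) : ℂ :=
  (-1 - 3 * Complex.I) * w 0 * z 1 + (-4) * w 2 * z 3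

theorem nilForm_eq (w z : Cn 5) : nilForm w z = nilLin w z + nilAnti w z := by
  simp only [nilForm, nilLin, nilAnti]
  ring

/-- A monomial involving the same coordinate three times has vanishing alternating sum. -/
theorem altSum_coordForm_mul_monomial (c : ℂ) (i j k l m : Fin 5)
    (hm : m = i ∨ m = j ∨ m = k ∨ m = l) (v : Fin 6 → Cn 5) :
    altSum (fun w => coordForm m (w 4) (w 5) *
      (c * w 0 i * w 1 j * conj (w 2 k) * conj (w 3 l)).re) v = 0 := by
  have gen : ∀ (r : Fin 6) (A : (Fin 6 → Cn 5) → ℂ), 4 ≠ r → 5 ≠ r →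
      (∀ w, A (w ∘ Equiv.swap 4 r) = A w) → (∀ w, A (w ∘ Equiv.swap 5 r) = A w) →
      altSum (fun w => coordForm m (w 4) (w 5) * (w r m * A w).re) v = 0 := by
    intro r A h4 h5 hA4 hA5
    have e : ∀ w : Fin 6 → Cn 5, coordForm m (w 4) (w 5) * (w r m * A w).re =
        coordForm m (w 4) (w 5) * (w r m).re * (A w).re -
        coordForm m (w 4) (w 5) * (w r m).im * (A w).im := by
      intro w
      rw [Complex.mul_re]
      ring
    rw [altSum_congr e, altSum_sub, altSum_coordForm_mul_re m (by decide) h4 h5,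
      altSum_coordForm_mul_im m (by decide) h4 h5, sub_zero]
    all_goals
      intro w
      simp only [hA4, hA5]
  rcases hm with rfl | rfl | rfl | rfl
  · rw [altSum_congr (g := fun w => coordForm m (w 4) (w 5) *
      (w 0 m * (c * w 1 j * conj (w 2 k) * conj (w 3 l))).re)
      (fun w => by congr 2; ring)]
    exact gen 0 (fun w => c * w 1 j * conj (w 2 k) * conj (w 3 l)) (by decide) (by decide)
      (fun w => rfl) (fun w => rfl)
  · rw [altSum_congr (g := fun w => coordForm m (w 4) (w 5) *
      (w 1 m * (c * w 0 i * conj (w 2 k) * conj (w 3 l))).re)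
      (fun w => by congr 2; ring)]
    exact gen 1 (fun w => c * w 0 i * conj (w 2 k) * conj (w 3 l)) (by decide) (by decide)
      (fun w => rfl) (fun w => rfl)
  · rw [altSum_congr (g := fun w => coordForm m (w 4) (w 5) *
      (w 2 m * conj (c * w 0 i * w 1 j * conj (w 3 l))).re)
      (fun w => by rw [← Complex.conj_re]; congr 2; simp; ring)]
    exact gen 2 (fun w => conj (c * w 0 i * w 1 j * conj (w 3 l))) (by decide) (by decide)
      (fun w => rfl) (fun w => rfl)
  · rw [altSum_congr (g := fun w => coordForm m (w 4) (w 5) *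
      (w 3 m * conj (c * w 0 i * w 1 j * conj (w 2 k))).re)
      (fun w => by rw [← Complex.conj_re]; congr 2; simp; ring)]
    exact gen 3 (fun w => conj (c * w 0 i * w 1 j * conj (w 2 k))) (by decide) (by decide)
      (fun w => rfl) (fun w => rfl)

/-- This disposes of the cross terms of `nilLin` times its conjugate: they already involve all four
base coordinates, so each summand of `baseForm` repeats one of them. -/
theorem altSum_baseForm_mul_monomial (c : ℂ) (i j k l : Fin 5)
    (h : ∀ m : Fin 5, m ≠ 4 → (m = i ∨ m = j ∨ m = k ∨ m = l)) (v : Fin 6 → Cn 5) :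
    altSum (fun w => baseForm (w 4) (w 5) *
      (c * w 0 i * w 1 j * conj (w 2 k) * conj (w 3 l)).re) v = 0 := by
  simp only [baseForm, add_mul, altSum_add]
  rw [altSum_coordForm_mul_monomial c i j k l 0 (h 0 (by decide)),
    altSum_coordForm_mul_monomial c i j k l 1 (h 1 (by decide)),
    altSum_coordForm_mul_monomial c i j k l 2 (h 2 (by decide)),
    altSum_coordForm_mul_monomial c i j k l 3 (h 3 (by decide))]
  simp

/-- The real part of a product is the product of real parts minus that of imaginary parts. The real
part of `w 0 i * conj (w 2 i)` is symmetric in slots 0 and 2 and drops out; the imaginary parts are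
coordinate forms up to sign. Moving the slots (0,2), (1,3) into the order (0,1), (2,3) is a
transposition, whose sign cancels the minus. -/
theorem altSum_diagonal_monomial (i j m : Fin 5) (v : Fin 6 → Cn 5) :
    altSum (fun w => coordForm m (w 4) (w 5) *
      (w 0 i * w 1 j * conj (w 2 i) * conj (w 3 j)).re) v = coordTriple v i j m := by
  have e : ∀ w : Fin 6 → Cn 5, coordForm m (w 4) (w 5) *
      (w 0 i * w 1 j * conj (w 2 i) * conj (w 3 j)).re =
      coordForm m (w 4) (w 5) * (w 0 i * conj (w 2 i)).re * (w 1 j * conj (w 3 j)).re -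
      coordForm i (w 0) (w 2) * coordForm j (w 1) (w 3) * coordForm m (w 4) (w 5) := by
    intro w
    simp only [coordForm, Complex.mul_re, Complex.mul_im, Complex.conj_re, Complex.conj_im]
    ring
  rw [altSum_congr e, altSum_sub]
  have h1 : altSum (fun w : Fin 6 → Cn 5 => coordForm m (w 4) (w 5) *
      (w 0 i * conj (w 2 i)).re * (w 1 j * conj (w 3 j)).re) v = 0 := by
    refine altSum_eq_zero_of_swap (i := 0) (j := 2) (by decide) (fun w => ?_) v
    change coordForm m (w 4) (w 5) * (w 2 i * conj (w 0 i)).re * (w 1 j * conj (w 3 j)).re = _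
    simp only [Complex.mul_re, Complex.conj_re, Complex.conj_im]
    ring
  have h2 := altSum_swap (f := fun w : Fin 6 → Cn 5 =>
    coordForm i (w 0) (w 1) * coordForm j (w 2) (w 3) * coordForm m (w 4) (w 5))
    (i := 1) (j := 2) (by decide) v
  change altSum (fun w : Fin 6 → Cn 5 =>
    coordForm i (w 0) (w 2) * coordForm j (w 1) (w 3) * coordForm m (w 4) (w 5)) v = _ at h2
  rw [h1, h2, coordTriple]
  ring

/-- The coefficients are 10 = |-1-3i|² and 16 = |-4|². The square terms give 10 ω₀ω₁ and 16 ω₂ω₃,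
each wedged with the two coordinate forms of ω that do not repeat; the cross terms vanish. -/
theorem altSum_baseForm_mul_nilLin (v : Fin 6 → Cn 5) :
    altSum (fun w => baseForm (w 4) (w 5) *
      (nilLin (w 0) (w 1) * conj (nilLin (w 2) (w 3))).re) v =
    10 * (coordTriple v 0 1 2 + coordTriple v 0 1 3) +
      16 * (coordTriple v 0 2 3 + coordTriple v 1 2 3) := by
  have e : ∀ w : Fin 6 → Cn 5, baseForm (w 4) (w 5) *
      (nilLin (w 0) (w 1) * conj (nilLin (w 2) (w 3))).re =
      (10 * (baseForm (w 4) (w 5) * (w 0 0 * w 1 1 * conj (w 2 0) * conj (w 3 1)).re) +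
      16 * (baseForm (w 4) (w 5) * (w 0 2 * w 1 3 * conj (w 2 2) * conj (w 3 3)).re)) +
      (baseForm (w 4) (w 5) *
        ((4 + 12 * Complex.I) * w 0 0 * w 1 1 * conj (w 2 2) * conj (w 3 3)).re +
      baseForm (w 4) (w 5) *
        ((4 - 12 * Complex.I) * w 0 2 * w 1 3 * conj (w 2 0) * conj (w 3 1)).re) := by
    intro w
    rw [show (10 : ℝ) * (baseForm (w 4) (w 5) * (w 0 0 * w 1 1 * conj (w 2 0) * conj (w 3 1)).re) =
        baseForm (w 4) (w 5) * (10 * (w 0 0 * w 1 1 * conj (w 2 0) * conj (w 3 1))).re by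
          simp [Complex.mul_re]; ring,
      show (16 : ℝ) * (baseForm (w 4) (w 5) * (w 0 2 * w 1 3 * conj (w 2 2) * conj (w 3 3)).re) =
        baseForm (w 4) (w 5) * (16 * (w 0 2 * w 1 3 * conj (w 2 2) * conj (w 3 3))).re by
          simp [Complex.mul_re]; ring, ← mul_add, ← mul_add, ← mul_add, ← Complex.add_re,
      ← Complex.add_re, ← Complex.add_re]
    congr 2
    simp only [nilLin, map_add, map_mul, map_sub, map_neg, map_one, Complex.conj_I, map_ofNat]
    linear_combination (-9 * w 0 0 * w 1 1 * conj (w 2 0) * conj (w 3 1)) * Complex.I_sq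
  rw [altSum_congr e, altSum_add, altSum_add, altSum_add, altSum_const_mul, altSum_const_mul,
    altSum_baseForm_mul_monomial _ 0 1 2 3 (by decide),
    altSum_baseForm_mul_monomial _ 2 3 0 1 (by decide)]
  simp only [baseForm, add_mul, altSum_add, altSum_diagonal_monomial, coordTriple_self_left,
    coordTriple_self_right]
  rw [coordTriple_swap_right v 2 3 0, coordTriple_swap_left v 2 0 3,
    coordTriple_swap_right v 2 3 1, coordTriple_swap_left v 2 1 3]
  ring

/-- The real part of `nilAnti` is symmetric and its imaginary part is the form ∑ κ_j ω_j with κ =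
(1, 1, 2, 2), so what remains is ω ∧ (∑ κ_j ω_j)². The coefficient of ω_jω_kω_l is 2(κ_jκ_k + κ_jκ_l
+ κ_kκ_l), which is 10 when one of the indices is 2 or 3 and 16 when both occur: the same values as
for `nilLin`. -/
theorem altSum_baseForm_mul_nilAnti (v : Fin 6 → Cn 5) :
    altSum (fun w => baseForm (w 4) (w 5) *
      (nilAnti (w 0) (w 1) * conj (nilAnti (w 2) (w 3))).re) v =
    10 * (coordTriple v 0 1 2 + coordTriple v 0 1 3) +
      16 * (coordTriple v 0 2 3 + coordTriple v 1 2 3) := by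
  let G : Cn 5 → Cn 5 → ℝ := fun a b =>
    coordForm 0 a b + coordForm 1 a b + 2 * coordForm 2 a b + 2 * coordForm 3 a b
  have hG : ∀ a b, (nilAnti a b).im = G a b := by
    intro a b
    simp [nilAnti, G, coordForm]
    ring
  have hsym : ∀ a b, (nilAnti a b).re = (nilAnti b a).re := by
    intro a b
    simp [nilAnti]
    ring
  have e : ∀ w : Fin 6 → Cn 5, baseForm (w 4) (w 5) *
      (nilAnti (w 0) (w 1) * conj (nilAnti (w 2) (w 3))).re =
      baseForm (w 4) (w 5) * ((nilAnti (w 0) (w 1)).re * (nilAnti (w 2) (w 3)).re) +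
      G (w 0) (w 1) * G (w 2) (w 3) * baseForm (w 4) (w 5) := by
    intro w
    rw [← hG, ← hG]
    simp only [Complex.mul_re, Complex.conj_re, Complex.conj_im]
    ring
  rw [altSum_congr e, altSum_add]
  have h1 : altSum (fun w : Fin 6 → Cn 5 => baseForm (w 4) (w 5) *
      ((nilAnti (w 0) (w 1)).re * (nilAnti (w 2) (w 3)).re)) v = 0 := by
    refine altSum_eq_zero_of_swap (i := 0) (j := 1) (by decide) (fun w => ?_) v
    change baseForm (w 4) (w 5) * ((nilAnti (w 1) (w 0)).re * (nilAnti (w 2) (w 3)).re) = _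
    rw [hsym]
  rw [h1, zero_add]
  have hk : ∀ (c : ℝ) (j k l : Fin 5), altSum (fun w : Fin 6 → Cn 5 =>
      c * (coordForm j (w 0) (w 1) * coordForm k (w 2) (w 3) * coordForm l (w 4) (w 5))) v =
      c * coordTriple v j k l := fun c j k l => altSum_const_mul _ _ _
  let κ : Fin 5 → ℝ := ![1, 1, 2, 2, 0]
  let μ : Fin 5 → ℝ := ![1, 1, 1, 1, 0]
  have e2 : ∀ w : Fin 6 → Cn 5, G (w 0) (w 1) * G (w 2) (w 3) * baseForm (w 4) (w 5) =
      ∑ j, ∑ k, ∑ l, (κ j * κ k * μ l) *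
        (coordForm j (w 0) (w 1) * coordForm k (w 2) (w 3) * coordForm l (w 4) (w 5)) := by
    intro w
    have hGs : ∀ a b, G a b = ∑ j, κ j * coordForm j a b := by
      intro a b
      simp [Fin.sum_univ_five, κ, G]
    have hbs : ∀ a b, baseForm a b = ∑ j, μ j * coordForm j a b := by
      intro a b
      simp [Fin.sum_univ_five, μ, baseForm]
    rw [hGs, hGs, hbs, Finset.sum_mul_sum, Finset.sum_mul]
    refine Finset.sum_congr rfl fun j _ => ?_
    rw [Finset.sum_mul]
    refine Finset.sum_congr rfl fun k _ => ?_
    rw [Finset.mul_sum]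
    refine Finset.sum_congr rfl fun l _ => ?_
    ring
  rw [altSum_congr e2]
  simp only [altSum_sum, hk]
  have h102 := coordTriple_swap_left v 1 0 2
  have h103 := coordTriple_swap_left v 1 0 3
  have h021 := coordTriple_swap_right v 0 2 1
  have h031 := coordTriple_swap_right v 0 3 1
  have h201 := (coordTriple_swap_left v 2 0 1).trans h021
  have h301 := (coordTriple_swap_left v 3 0 1).trans h031
  have h120 := (coordTriple_swap_right v 1 2 0).trans h102
  have h130 := (coordTriple_swap_right v 1 3 0).trans h103
  have h210 := (coordTriple_swap_left v 2 1 0).trans h120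
  have h310 := (coordTriple_swap_left v 3 1 0).trans h130
  have h032 := coordTriple_swap_right v 0 3 2
  have h203 := coordTriple_swap_left v 2 0 3
  have h302 := (coordTriple_swap_left v 3 0 2).trans h032
  have h230 := (coordTriple_swap_right v 2 3 0).trans h203
  have h320 := (coordTriple_swap_left v 3 2 0).trans h230
  have h132 := coordTriple_swap_right v 1 3 2
  have h213 := coordTriple_swap_left v 2 1 3
  have h312 := (coordTriple_swap_left v 3 1 2).trans h132
  have h231 := (coordTriple_swap_right v 2 3 1).trans h213
  have h321 := (coordTriple_swap_left v 3 2 1).trans h231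
  simp only [Fin.sum_univ_five, κ, μ, coordTriple_self, coordTriple_self_left,
    coordTriple_self_right, h102, h103, h021, h031, h201, h301, h120, h130, h210, h310, h032, h203,
    h302, h230, h320, h132, h213, h312, h231, h321, Matrix.cons_val]
  ring

end NilIdentity
end

noncomputable section

/-! ### The powers of the left-invariant fundamental form -/

section WedgePowSmooth

variable {X E : Type*} [NormedAddCommGroup X] [NormedSpace ℝ X] [NormedAddCommGroup E]
  [NormedSpace ℝ E] {r : WithTop ℕ∞} {x : X}

theorem ContDiffAt.tensorPow {F : X → E [⋀^Fin 2]→L[ℝ] ℝ}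
    (hF : ∀ v, ContDiffAt ℝ r (fun y => F y v) x) (k : ℕ) (v : Fin (2 * k) → E) :
    ContDiffAt ℝ r (fun y => tensorPow (F y) k v) x := by
  induction k with
  | zero => exact contDiffAt_const
  | succ k ih => exact (ih _).mul (hF _)

theorem ContDiffAt.wedgePow [FiniteDimensional ℝ E] {F : X → E [⋀^Fin 2]→L[ℝ] ℝ}
    (hF : ∀ v, ContDiffAt ℝ r (fun y => F y v) x) (k : ℕ) :
    ContDiffAt ℝ r (fun y => wedgePow (F y) k) x := by
  refine contDiffAt_form fun v => ?_
  simp only [wedgePow_apply, altSum]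
  exact contDiffAt_const.mul (ContDiffAt.sum fun σ _ =>
    contDiffAt_const.mul (ContDiffAt.tensorPow hF k _))

theorem compContinuousLinearMap_wedgePow {V W : Type*} [AddCommGroup V] [Module ℝ V]
    [TopologicalSpace V] [AddCommGroup W] [Module ℝ W] [TopologicalSpace W]
    (F : V [⋀^Fin 2]→L[ℝ] ℝ) (A : W →L[ℝ] V) (k : ℕ) :
    (wedgePow F k).compContinuousLinearMap A = wedgePow (F.compContinuousLinearMap A) k := by
  have h : ∀ k (w : Fin (2 * k) → W),
      tensorPow F k (A ∘ w) = tensorPow (F.compContinuousLinearMap A) k w := by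
    intro k
    induction k with
    | zero => exact fun _ => rfl
    | succ k ih =>
      intro w
      simp only [tensorPow, ← ih]
      rfl
  ext v
  rw [ContinuousAlternatingMap.compContinuousLinearMap_apply, wedgePow_apply, wedgePow_apply]
  simp only [altSum, ← h]
  rfl

end WedgePowSmooth

/-! ### The vertical form V and its Hessian -/

/-- `nilForm` as a real linear map of its first variable. -/
def nilFormLeft (a : Cn 5) : Cn 5 →L[ℝ] ℂ :=
  LinearMap.toContinuousLinearMap
    { toFun := fun u => nilForm u a
      map_add' := fun x y => by simp [nilForm]; ring
      map_smul' := fun c x => by simp [nilForm]; ring }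

@[simp] theorem nilFormLeft_apply (a u : Cn 5) : nilFormLeft a u = nilForm u a := rfl

theorem contDiff_nilForm_left (a : Cn 5) : ContDiff ℝ ∞ fun u => nilForm u a :=
  (nilFormLeft a).contDiff

/-- The form `(i/2) η⁵ ∧ conj η⁵`. -/
def vertForm (u a b : Cn 5) : ℝ := coordForm 4 (nilCoframe u a) (nilCoframe u b)

theorem vertForm_eq (u a b : Cn 5) : vertForm u a b =
    ((a 4).re - (nilForm u a).re) * ((b 4).im - (nilForm u b).im) -
      ((a 4).im - (nilForm u a).im) * ((b 4).re - (nilForm u b).re) := by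
  simp [vertForm, coordForm, nilCoframe]

theorem baseForm_nilCoframe (u a b : Cn 5) :
    baseForm (nilCoframe u a) (nilCoframe u b) = baseForm a b := by
  simp [baseForm, coordForm, nilCoframe]

theorem contDiff_vertForm (a b : Cn 5) : ContDiff ℝ ∞ fun u => vertForm u a b := by
  have hre : ∀ a, ContDiff ℝ ∞ fun u => (nilForm u a).re := fun a =>
    Complex.reCLM.contDiff.comp (contDiff_nilForm_left a)
  have him : ∀ a, ContDiff ℝ ∞ fun u => (nilForm u a).im := fun a =>
    Complex.imCLM.contDiff.comp (contDiff_nilForm_left a)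
  simp only [vertForm_eq]
  exact ((contDiff_const.sub (hre a)).mul (contDiff_const.sub (him b))).sub
    ((contDiff_const.sub (him a)).mul (contDiff_const.sub (hre b)))

/-- The second derivative of `vertForm` in the base point. -/
def vertHess (x y a b : Cn 5) : ℝ :=
  (conj (nilForm y a) * nilForm x b).im + (conj (nilForm x a) * nilForm y b).im

/-- `nilForm` is real linear in the base point, so V is a quadratic polynomial in it and its second
derivative does not depend on `u`. -/
theorem fderiv_fderiv_vertForm (u x y a b : Cn 5) :
    fderiv ℝ (fun y' => fderiv ℝ (fun z => vertForm z a b) y' y) u x = vertHess x y a b := by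
  have hre : ∀ a z, HasFDerivAt (fun u => (a 4).re - (nilForm u a).re)
      (-(Complex.reCLM ∘L nilFormLeft a)) z := fun a z =>
    (Complex.reCLM ∘L nilFormLeft a).hasFDerivAt.const_sub _
  have him : ∀ a z, HasFDerivAt (fun u => (a 4).im - (nilForm u a).im)
      (-(Complex.imCLM ∘L nilFormLeft a)) z := fun a z =>
    (Complex.imCLM ∘L nilFormLeft a).hasFDerivAt.const_sub _
  have h1 : ∀ y', fderiv ℝ (fun z => vertForm z a b) y' y =
      -(((a 4).re - (nilForm y' a).re) * (nilForm y b).im) -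
        ((b 4).im - (nilForm y' b).im) * (nilForm y a).re +
        (((a 4).im - (nilForm y' a).im) * (nilForm y b).re +
        ((b 4).re - (nilForm y' b).re) * (nilForm y a).im) := by
    intro y'
    simp only [vertForm_eq]
    rw [(((hre a y').fun_mul (him b y')).fun_sub ((him a y').fun_mul (hre b y'))).fderiv]
    simp
    ring
  rw [funext h1]
  have h2 := ((((hre a u).mul_const (nilForm y b).im).fun_neg.fun_sub
    ((him b u).mul_const (nilForm y a).re)).fun_add
    (((him a u).mul_const (nilForm y b).re).fun_add ((hre b u).mul_const (nilForm y a).im)))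
  rw [HasFDerivAt.fderiv h2]
  simp [vertHess, Complex.mul_im]
  ring

/-- Type decomposition: replacing `y` by -iy multiplies the linear part by -i and the antilinear
part by i. -/
theorem nilForm_neg_I_smul (y a : Cn 5) :
    nilForm (-(Complex.I • y)) a = Complex.I * (nilAnti y a - nilLin y a) := by
  simp [nilForm, nilLin, nilAnti]
  ring

/-- This is ω ∧ dd^c V = 0. After a rearrangement of the arguments the Hessian becomes a product of
two values of `nilForm`, one of them rotated by -i. By type, the pure terms are the difference of
the `nilAnti` and `nilLin` sums, which are equal. -/
theorem altSum_baseForm_mul_vertHess (v : Fin 6 → Cn 5) :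
    altSum (fun w => baseForm (w 2) (w 3) *
      vertHess (w 0) (-(Complex.I • w 1)) (w 4) (w 5)) v = 0 := by
  let H : (Fin 6 → Cn 5) → ℝ := fun w => baseForm (w 4) (w 5) *
    (conj (nilForm (w 0) (w 1)) * nilForm (-(Complex.I • w 2)) (w 3)).im
  have hH : altSum H v = 0 := by
    have e : ∀ w, H w = (baseForm (w 4) (w 5) *
        (nilAnti (w 0) (w 1) * conj (nilAnti (w 2) (w 3))).re -
        baseForm (w 4) (w 5) * (nilLin (w 0) (w 1) * conj (nilLin (w 2) (w 3))).re) +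
        (baseForm (w 4) (w 5) * (nilLin (w 0) (w 1) * conj (nilAnti (w 2) (w 3))).re -
        baseForm (w 4) (w 5) * (nilLin (w 2) (w 3) * conj (nilAnti (w 0) (w 1))).re) := by
      intro w
      simp only [H, nilForm_neg_I_smul]
      simp only [nilForm_eq]
      simp only [map_add, Complex.mul_re, Complex.mul_im, Complex.add_re, Complex.add_im,
        Complex.sub_re, Complex.sub_im, Complex.conj_re, Complex.conj_im, Complex.I_re,
        Complex.I_im]
      ring
    -- The two mixed terms are exchanged by an even permutation of the slots, so their difference
    -- has zero alternating sum.
    have hx := altSum_comp_perm (fun w : Fin 6 → Cn 5 =>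
      baseForm (w 4) (w 5) * (nilLin (w 0) (w 1) * conj (nilAnti (w 2) (w 3))).re)
      (Equiv.swap 0 2 * Equiv.swap 1 3) v
    have hs : Equiv.Perm.sign (Equiv.swap (0 : Fin 6) 2 * Equiv.swap 1 3) = 1 := by decide
    rw [hs] at hx
    change altSum (fun w : Fin 6 → Cn 5 =>
      baseForm (w 4) (w 5) * (nilLin (w 2) (w 3) * conj (nilAnti (w 0) (w 1))).re) v = _ at hx
    rw [altSum_congr e, altSum_add, altSum_sub, altSum_sub, altSum_baseForm_mul_nilLin,
      altSum_baseForm_mul_nilAnti, hx]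
    simp
  -- The two products in the Hessian differ by exchanging slots 4 and 5; each is a slot permutation
  -- of `H`.
  have h1 := altSum_comp_perm H
    ⟨![0, 4, 1, 5, 2, 3], ![0, 2, 4, 5, 1, 3], by decide, by decide⟩ v
  have h2 := altSum_comp_perm H
    ⟨![0, 5, 1, 4, 2, 3], ![0, 2, 4, 5, 3, 1], by decide, by decide⟩ v
  rw [hH, mul_zero] at h1 h2
  have e : ∀ w : Fin 6 → Cn 5, baseForm (w 2) (w 3) *
      vertHess (w 0) (-(Complex.I • w 1)) (w 4) (w 5) =
      baseForm (w 2) (w 3) *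
        (conj (nilForm (w 0) (w 4)) * nilForm (-(Complex.I • w 1)) (w 5)).im -
      baseForm (w 2) (w 3) *
        (conj (nilForm (w 0) (w 5)) * nilForm (-(Complex.I • w 1)) (w 4)).im := by
    intro w
    simp only [vertHess, Complex.mul_im, Complex.conj_re, Complex.conj_im]
    ring
  rw [altSum_congr e, altSum_sub]
  change altSum (fun w : Fin 6 → Cn 5 => baseForm (w 2) (w 3) *
    (conj (nilForm (w 0) (w 4)) * nilForm (-(Complex.I • w 1)) (w 5)).im) v = 0 at h1
  change altSum (fun w : Fin 6 → Cn 5 => baseForm (w 2) (w 3) *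
    (conj (nilForm (w 0) (w 5)) * nilForm (-(Complex.I • w 1)) (w 4)).im) v = 0 at h2
  rw [h1, h2, sub_zero]

/-- Wedging the degree-six identity with one more ω gives ω² ∧ dd^c V = 0. -/
theorem altSum_baseForm_sq_mul_vertHess (v : Fin 8 → Cn 5) :
    altSum (fun w => baseForm (w 2) (w 3) * baseForm (w 4) (w 5) *
      vertHess (w 0) (-(Complex.I • w 1)) (w 6) (w 7)) v = 0 := by
  let f : (Fin 6 → Cn 5) → ℝ := fun w => baseForm (w 2) (w 3) *
      vertHess (w 0) (-(Complex.I • w 1)) (w 4) (w 5)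
  let g : (Fin 2 → Cn 5) → ℝ := fun w => baseForm (w 0) (w 1)
  have h1 := altSum_altSum_mul f g v
  have h2 : ∀ w, altSum f w = 0 := altSum_baseForm_mul_vertHess
  simp only [h2, zero_mul] at h1
  have h3 : altSum (fun _ : Fin (6 + 2) → Cn 5 => (0 : ℝ)) v = 0 := by simp [altSum]
  rw [h3] at h1
  have h4 := (mul_eq_zero.1 h1.symm).resolve_left (by positivity)
  have h5 := altSum_comp_perm (fun w : Fin (6 + 2) → Cn 5 => f (fun i => w (Fin.castAdd 2 i)) *
    g (fun i => w (Fin.natAdd 6 i)))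
    ⟨![0, 1, 2, 3, 6, 7, 4, 5], ![0, 1, 2, 3, 6, 7, 4, 5], by decide, by decide⟩ v
  rw [h4, mul_zero] at h5
  rw [← h5]
  refine altSum_congr (fun w => ?_) v
  change _ = baseForm (w 2) (w 3) *
      vertHess (w 0) (-(Complex.I • w 1)) (w 6) (w 7) * baseForm (w 4) (w 5)
  ring

/-! ### dd^c of the second and third powers of the invariant fundamental form -/

section NilPowers

variable {F : Cn 5 → Cn 5 [⋀^Fin 2]→L[ℝ] ℝ}

theorem contDiff_wedgePow_nil
    (hF : ∀ u w, F u w = baseForm (w 0) (w 1) + vertForm u (w 0) (w 1)) (k : ℕ) :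
    ContDiff ℝ ∞ fun u => wedgePow (F u) k := by
  refine contDiff_iff_contDiffAt.2 fun u => ContDiffAt.wedgePow (fun v => ?_) k
  simp only [hF]
  exact (contDiff_const.add (contDiff_vertForm _ _)).contDiffAt

/-- F² = ω² + 2 ω ∧ V, and ω² is constant. The factor 1/2 counts the two equal mixed terms against
the normalisation 1/2² of `wedgePow_apply`. -/
theorem ddcForm_wedgePow_two_nil
    (hF : ∀ u w, F u w = baseForm (w 0) (w 1) + vertForm u (w 0) (w 1)) (u : Cn 5) :
    ddcForm (fun u => wedgePow (F u) 2) u = 0 := by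
  refine ddcForm_eq_zero_of_altSum (contDiff_wedgePow_nil hF 2)
    (fun w => 4⁻¹ * altSum (fun w : Fin 4 → Cn 5 =>
      baseForm (w 0) (w 1) * baseForm (w 2) (w 3)) w) (2⁻¹)
    (fun z w => baseForm (w 0) (w 1) * vertForm z (w 2) (w 3))
    (fun w => contDiff_const.mul (contDiff_vertForm _ _)) (fun z w => ?_) u (fun v => ?_)
  · have e : ∀ w : Fin 4 → Cn 5, tensorPow (F z) 2 w =
        (baseForm (w 0) (w 1) * baseForm (w 2) (w 3) +
          baseForm (w 0) (w 1) * vertForm z (w 2) (w 3)) +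
        (baseForm (w 2) (w 3) * vertForm z (w 0) (w 1) +
          vertForm z (w 0) (w 1) * vertForm z (w 2) (w 3) * 1) := by
      intro w
      simp only [tensorPow, hF]
      change 1 * (baseForm (w 0) (w 1) + vertForm z (w 0) (w 1)) *
        (baseForm (w 2) (w 3) + vertForm z (w 2) (w 3)) = _
      ring
    have h1 := altSum_comp_perm (fun w : Fin 4 → Cn 5 =>
      baseForm (w 0) (w 1) * vertForm z (w 2) (w 3)) (Equiv.swap 0 2 * Equiv.swap 1 3) w
    have hs : Equiv.Perm.sign (Equiv.swap (0 : Fin 4) 2 * Equiv.swap 1 3) = 1 := by decide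
    rw [hs] at h1
    change altSum (fun w : Fin 4 → Cn 5 => baseForm (w 2) (w 3) * vertForm z (w 0) (w 1)) w = _
      at h1
    -- V ∧ V = 0: in the coframe, V is the fifth coordinate form. The trailing factor 1 is the `h`
    -- of `altSum_coordForm_sq`.
    have h2 : altSum (fun w : Fin 4 → Cn 5 =>
        vertForm z (w 0) (w 1) * vertForm z (w 2) (w 3) * 1) w = 0 :=
      altSum_coordForm_sq 4 (s := 0) (t := 1) (r := 2) (q := 3) (h := fun _ => 1)
        (by decide) (by decide) (by decide) (by decide) (by decide) (by decide)
        (fun _ _ _ _ _ => rfl) fun i => nilCoframe z (w i)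
    rw [wedgePow_apply]
    change _ * altSum (N := 4) (tensorPow (F z) 2) w = _
    rw [altSum_congr e, altSum_add, altSum_add, altSum_add, h1, h2]
    push_cast
    ring
  · rw [← altSum_baseForm_mul_vertHess v]
    refine altSum_congr (fun w => ?_) v
    have hd : ∀ a b y, DifferentiableAt ℝ (fun z => vertForm z a b) y := fun a b y =>
      (contDiff_vertForm a b).contDiffAt.differentiableAt (by simp)
    have hd2 : ∀ a b x, DifferentiableAt ℝ (fun y => fderiv ℝ (fun z => vertForm z a b) y x) u :=
      fun a b x => (((contDiff_vertForm a b).contDiffAt.fderiv_right (m := ∞) (by simp)).clm_apply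
        contDiffAt_const).differentiableAt (by simp)
    rw [← fderiv_fderiv_vertForm u]
    simp only [fderiv_const_mul (hd _ _ _), _root_.smul_apply, smul_eq_mul,
      fderiv_const_mul (hd2 _ _ _)]
    rfl

theorem ddcForm_wedgePow_three_nil
    (hF : ∀ u w, F u w = baseForm (w 0) (w 1) + vertForm u (w 0) (w 1)) (u : Cn 5) :
    ddcForm (fun u => wedgePow (F u) 3) u = 0 := by
  -- F³ = ω³ + 3 ω² ∧ V: three equal mixed terms against the normalisation 1/2³ give 3/8. The
  -- remaining terms contain V twice.
  refine ddcForm_eq_zero_of_altSum (contDiff_wedgePow_nil hF 3)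
    (fun w => 8⁻¹ * altSum (fun w : Fin 6 → Cn 5 =>
      baseForm (w 0) (w 1) * baseForm (w 2) (w 3) * baseForm (w 4) (w 5)) w) (3 / 8)
    (fun z w => baseForm (w 0) (w 1) * baseForm (w 2) (w 3) * vertForm z (w 4) (w 5))
    (fun w => contDiff_const.mul (contDiff_vertForm _ _)) (fun z w => ?_) u (fun v => ?_)
  · have e : ∀ w : Fin 6 → Cn 5, tensorPow (F z) 3 w =
        (((baseForm (w 0) (w 1) * baseForm (w 2) (w 3) * baseForm (w 4) (w 5) +
          baseForm (w 0) (w 1) * baseForm (w 2) (w 3) * vertForm z (w 4) (w 5)) +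
        (baseForm (w 0) (w 1) * baseForm (w 4) (w 5) * vertForm z (w 2) (w 3) +
          baseForm (w 4) (w 5) * baseForm (w 2) (w 3) * vertForm z (w 0) (w 1))) +
        (vertForm z (w 0) (w 1) * vertForm z (w 2) (w 3) *
            (baseForm (w 4) (w 5) + vertForm z (w 4) (w 5)) +
          vertForm z (w 0) (w 1) * vertForm z (w 4) (w 5) * baseForm (w 2) (w 3))) +
          vertForm z (w 2) (w 3) * vertForm z (w 4) (w 5) * baseForm (w 0) (w 1) := by
      intro w
      simp only [tensorPow, hF]
      change 1 * (baseForm (w 0) (w 1) + vertForm z (w 0) (w 1)) *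
        (baseForm (w 2) (w 3) + vertForm z (w 2) (w 3)) *
        (baseForm (w 4) (w 5) + vertForm z (w 4) (w 5)) = _
      ring
    have h1 := altSum_comp_perm (fun w : Fin 6 → Cn 5 =>
      baseForm (w 0) (w 1) * baseForm (w 2) (w 3) * vertForm z (w 4) (w 5))
      (Equiv.swap 2 4 * Equiv.swap 3 5) w
    have hs : Equiv.Perm.sign (Equiv.swap (2 : Fin 6) 4 * Equiv.swap 3 5) = 1 := by decide
    rw [hs] at h1
    change altSum (fun w : Fin 6 → Cn 5 =>
      baseForm (w 0) (w 1) * baseForm (w 4) (w 5) * vertForm z (w 2) (w 3)) w = _ at h1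
    have h2 := altSum_comp_perm (fun w : Fin 6 → Cn 5 =>
      baseForm (w 0) (w 1) * baseForm (w 2) (w 3) * vertForm z (w 4) (w 5))
      (Equiv.swap 0 4 * Equiv.swap 1 5) w
    have hs2 : Equiv.Perm.sign (Equiv.swap (0 : Fin 6) 4 * Equiv.swap 1 5) = 1 := by decide
    rw [hs2] at h2
    change altSum (fun w : Fin 6 → Cn 5 =>
      baseForm (w 4) (w 5) * baseForm (w 2) (w 3) * vertForm z (w 0) (w 1)) w = _ at h2
    have inv : ∀ (h : Cn 5 → Cn 5 → ℝ) (p q : Fin 6) (A : Set (Fin 6)), p ∉ A → q ∉ A →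
        ∀ w : Fin 6 → Cn 5, ∀ i ∈ A, ∀ k ∈ A,
          h ((w ∘ Equiv.swap i k) p) ((w ∘ Equiv.swap i k) q) = h (w p) (w q) := by
      intro h p q A hp hq w i hi k hk
      have e1 : Equiv.swap i k p = p := Equiv.swap_apply_of_ne_of_ne
        (by rintro rfl; exact hp hi) (by rintro rfl; exact hp hk)
      have e2 : Equiv.swap i k q = q := Equiv.swap_apply_of_ne_of_ne
        (by rintro rfl; exact hq hi) (by rintro rfl; exact hq hk)
      simp only [Function.comp_apply, e1, e2]
    have h3 : altSum (fun w : Fin 6 → Cn 5 => vertForm z (w 0) (w 1) * vertForm z (w 2) (w 3) *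
        (baseForm (w 4) (w 5) + vertForm z (w 4) (w 5))) w = 0 := by
      let G : (Fin 6 → Cn 5) → ℝ := fun w => coordForm 4 (w 0) (w 1) * coordForm 4 (w 2) (w 3) *
        (baseForm (w 4) (w 5) + coordForm 4 (w 4) (w 5))
      refine (altSum_congr (g := fun w => G fun i => nilCoframe z (w i)) (fun w => ?_) w).trans
        (altSum_coordForm_sq 4 (s := 0) (t := 1) (r := 2) (q := 3)
        (h := fun w => baseForm (w 4) (w 5) + coordForm 4 (w 4) (w 5))
        (by decide) (by decide) (by decide) (by decide) (by decide) (by decide)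
        (fun w i hi k hk => inv (fun a b => baseForm a b + coordForm 4 a b) 4 5 {0, 1, 2, 3}
          (by decide) (by decide) w i (by simp at hi ⊢; tauto) k (by simp at hk ⊢; tauto))
        fun i => nilCoframe z (w i))
      simp only [G, baseForm_nilCoframe]
      rfl
    have h4 : altSum (fun w : Fin 6 → Cn 5 => vertForm z (w 0) (w 1) * vertForm z (w 4) (w 5) *
        baseForm (w 2) (w 3)) w = 0 := by
      let G : (Fin 6 → Cn 5) → ℝ := fun w => coordForm 4 (w 0) (w 1) * coordForm 4 (w 4) (w 5) *
        baseForm (w 2) (w 3)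
      refine (altSum_congr (g := fun w => G fun i => nilCoframe z (w i)) (fun w => ?_) w).trans
        (altSum_coordForm_sq 4 (s := 0) (t := 1) (r := 4) (q := 5)
        (h := fun w => baseForm (w 2) (w 3))
        (by decide) (by decide) (by decide) (by decide) (by decide) (by decide)
        (fun w i hi k hk => inv baseForm 2 3 {0, 1, 4, 5}
          (by decide) (by decide) w i (by simp at hi ⊢; tauto) k (by simp at hk ⊢; tauto))
        fun i => nilCoframe z (w i))
      simp only [G, baseForm_nilCoframe]
      rfl
    have h5 : altSum (fun w : Fin 6 → Cn 5 => vertForm z (w 2) (w 3) * vertForm z (w 4) (w 5) *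
        baseForm (w 0) (w 1)) w = 0 := by
      let G : (Fin 6 → Cn 5) → ℝ := fun w => coordForm 4 (w 2) (w 3) * coordForm 4 (w 4) (w 5) *
        baseForm (w 0) (w 1)
      refine (altSum_congr (g := fun w => G fun i => nilCoframe z (w i)) (fun w => ?_) w).trans
        (altSum_coordForm_sq 4 (s := 2) (t := 3) (r := 4) (q := 5)
        (h := fun w => baseForm (w 0) (w 1))
        (by decide) (by decide) (by decide) (by decide) (by decide) (by decide)
        (fun w i hi k hk => inv baseForm 0 1 {2, 3, 4, 5}
          (by decide) (by decide) w i (by simp at hi ⊢; tauto) k (by simp at hk ⊢; tauto))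
        fun i => nilCoframe z (w i))
      simp only [G, baseForm_nilCoframe]
      rfl
    rw [wedgePow_apply]
    change _ * altSum (N := 6) (tensorPow (F z) 3) w = _
    rw [altSum_congr e, altSum_add, altSum_add, altSum_add, altSum_add, altSum_add, altSum_add,
      h1, h2, h3, h4, h5]
    push_cast
    ring
  · rw [← altSum_baseForm_sq_mul_vertHess v]
    refine altSum_congr (fun w => ?_) v
    have hd : ∀ a b y, DifferentiableAt ℝ (fun z => vertForm z a b) y := fun a b y =>
      (contDiff_vertForm a b).contDiffAt.differentiableAt (by simp)
    have hd2 : ∀ a b x, DifferentiableAt ℝ (fun y => fderiv ℝ (fun z => vertForm z a b) y x) u :=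
      fun a b x => (((contDiff_vertForm a b).contDiffAt.fderiv_right (m := ∞) (by simp)).clm_apply
        contDiffAt_const).differentiableAt (by simp)
    rw [← fderiv_fderiv_vertForm u]
    simp only [fderiv_const_mul (hd _ _ _), _root_.smul_apply, smul_eq_mul,
      fderiv_const_mul (hd2 _ _ _)]
    rfl

end NilPowers
end

noncomputable section

/-! ### The lattice of Gaussian integers and the nilmanifold -/

/-- The Gaussian integers, as a subring of `ℂ`. -/
def gaussZ : Subring ℂ := GaussianInt.toComplex.range

theorem mem_gaussZ {z : ℂ} : z ∈ gaussZ ↔ ∃ a b : ℤ, z = a + b * Complex.I := by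
  constructor
  · rintro ⟨g, rfl⟩
    exact ⟨g.re, g.im, GaussianInt.toComplex_def g⟩
  · rintro ⟨a, b, rfl⟩
    exact ⟨⟨a, b⟩, GaussianInt.toComplex_def' a b⟩

theorem I_mem_gaussZ : Complex.I ∈ gaussZ := mem_gaussZ.2 ⟨0, 1, by simp⟩

theorem conj_mem_gaussZ {z : ℂ} (hz : z ∈ gaussZ) : conj z ∈ gaussZ := by
  obtain ⟨a, b, rfl⟩ := mem_gaussZ.1 hz
  exact mem_gaussZ.2 ⟨a, -b, by simp⟩

theorem eq_zero_of_mem_gaussZ {z : ℂ} (hz : z ∈ gaussZ) (h : ‖z‖ < 1) : z = 0 := by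
  obtain ⟨a, b, rfl⟩ := mem_gaussZ.1 hz
  have h1 := (Complex.abs_re_le_norm _).trans_lt h
  have h2 := (Complex.abs_im_le_norm _).trans_lt h
  simp only [Complex.add_re, Complex.mul_re, Complex.intCast_re, Complex.intCast_im, Complex.I_re,
    Complex.I_im, Complex.add_im, Complex.mul_im] at h1 h2
  ring_nf at h1 h2
  have ha : a = 0 := by
    rw [← Int.abs_lt_one_iff]
    exact_mod_cast h1
  have hb : b = 0 := by
    rw [← Int.abs_lt_one_iff]
    exact_mod_cast h2
  simp [ha, hb]

/-- Rounding both parts leaves an error of at most 1/√2. The value 3/4 is a convenient rational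
below 1, so that a Gaussian integer coordinate of this size has to vanish. -/
theorem exists_gaussZ_norm_sub_le (z : ℂ) : ∃ g ∈ gaussZ, ‖z - g‖ ≤ 3 / 4 := by
  refine ⟨round z.re + round z.im * Complex.I, mem_gaussZ.2 ⟨_, _, rfl⟩, ?_⟩
  have h1 := abs_le.1 (abs_sub_round z.re)
  have h2 := abs_le.1 (abs_sub_round z.im)
  rw [← abs_of_nonneg (norm_nonneg (z - _)), ← abs_of_pos (show (0 : ℝ) < 3 / 4 by norm_num),
    ← sq_le_sq, Complex.sq_norm, Complex.normSq_apply]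
  simp
  nlinarith

theorem nilForm_mem_gaussZ {w z : Cn 5} (hw : ∀ i, w i ∈ gaussZ) (hz : ∀ i, z i ∈ gaussZ) :
    nilForm w z ∈ gaussZ := by
  have h2 : (2 : ℂ) ∈ gaussZ := ofNat_mem gaussZ 2
  have h3 : (3 : ℂ) ∈ gaussZ := ofNat_mem gaussZ 3
  have h4 : (4 : ℂ) ∈ gaussZ := ofNat_mem gaussZ 4
  have hI := I_mem_gaussZ
  have hc : ∀ i, conj (w i) ∈ gaussZ := fun i => conj_mem_gaussZ (hw i)
  have h1 := gaussZ.one_mem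
  unfold nilForm
  refine add_mem (add_mem (add_mem (add_mem (add_mem ?_ ?_) ?_) ?_) ?_) ?_
  · exact mul_mem (mul_mem (sub_mem (neg_mem h1) (mul_mem h3 hI)) (hw _)) (hz _)
  · exact mul_mem (mul_mem h1 (hc _)) (hz _)
  · exact mul_mem (mul_mem h1 (hc _)) (hz _)
  · exact mul_mem (mul_mem (neg_mem h4) (hw _)) (hz _)
  · exact mul_mem (mul_mem h2 (hc _)) (hz _)
  · exact mul_mem (mul_mem h2 (hc _)) (hz _)

/-- The lattice of points with Gaussian integer coordinates. -/
def nilLattice : Subgroup NilG where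
  carrier := {z : Cn 5 | ∀ i, z i ∈ gaussZ}
  mul_mem' := by
    intro w z hw hz i
    have hB := nilForm_mem_gaussZ hw hz
    have := fun i => add_mem (hw i) (hz i)
    fin_cases i
    · exact this 0
    · exact this 1
    · exact this 2
    · exact this 3
    · exact add_mem (this 4) hB
  one_mem' := fun i => gaussZ.zero_mem
  inv_mem' := by
    intro w hw i
    have hB := nilForm_mem_gaussZ hw hw
    have := fun i => neg_mem (hw i)
    fin_cases i
    · exact this 0
    · exact this 1
    · exact this 2
    · exact this 3
    · exact add_mem (this 4) hB

theorem continuous_nilForm : Continuous fun q : Cn 5 × Cn 5 => nilForm q.1 q.2 := by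
  unfold nilForm
  fun_prop

theorem nilMul_apply_of_ne (w z : Cn 5) {i : Fin 5} (hi : i ≠ 4) : nilMul w z i = w i + z i := by
  fin_cases i <;> first | rfl | exact absurd rfl hi

theorem nilMul_apply_four (w z : Cn 5) : nilMul w z 4 = w 4 + z 4 + nilForm w z := rfl

theorem continuous_nilMul : Continuous fun q : Cn 5 × Cn 5 => nilMul q.1 q.2 := by
  refine continuous_pi fun i => ?_
  by_cases hi : i = 4
  · subst hi
    simp only [nilMul_apply_four]
    exact Continuous.add (by fun_prop) continuous_nilForm
  · simp only [nilMul_apply_of_ne _ _ hi]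
    fun_prop

theorem nilInv_apply_of_ne (w : Cn 5) {i : Fin 5} (hi : i ≠ 4) : nilInv w i = -w i := by
  fin_cases i <;> first | rfl | exact absurd rfl hi

theorem nilInv_apply_four (w : Cn 5) : nilInv w 4 = -w 4 + nilForm w w := rfl

theorem continuous_nilInv : Continuous nilInv := by
  refine continuous_pi fun i => ?_
  by_cases hi : i = 4
  · subst hi
    simp only [nilInv_apply_four]
    have hB : Continuous fun q : Cn 5 => nilForm q q := by
      unfold nilForm
      fun_prop
    exact Continuous.add (by fun_prop) hB
  · simp only [nilInv_apply_of_ne _ hi]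
    fun_prop

instance : IsTopologicalGroup NilG where
  continuous_mul := continuous_nilMul
  continuous_inv := continuous_nilInv

instance : T2Space NilG := inferInstanceAs (T2Space (Cn 5))

instance : LocallyCompactSpace NilG := inferInstanceAs (LocallyCompactSpace (Cn 5))

instance : DiscreteTopology nilLattice := by
  refine discreteTopology_of_isOpen_singleton_one ?_
  let S : Set (Cn 5) := Metric.ball 0 1
  have h : ({1} : Set nilLattice) = Subtype.val ⁻¹' (show Set NilG from S) := by
    ext γ
    simp only [Set.mem_singleton_iff]
    constructor
    · rintro rfl
      exact Metric.mem_ball_self (x := (0 : Cn 5)) one_pos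
    · intro hγ
      apply Subtype.ext
      funext i
      refine eq_zero_of_mem_gaussZ (γ.2 i) ?_
      let g : Cn 5 := γ.1
      have : ‖g‖ < 1 := mem_ball_zero_iff.1 hγ
      exact (norm_le_pi_norm g i).trans_lt this
  rw [h]
  exact (Metric.isOpen_ball (x := (0 : Cn 5))).preimage continuous_subtype_val

instance : T2Space (Nilmanifold nilLattice) := by
  have : ProperlyDiscontinuousSMul nilLattice NilG :=
    Subgroup.properlyDiscontinuousSMul_of_tendsto_cofinite nilLattice
      (Subgroup.tendsto_coe_cofinite_of_discrete nilLattice ⟨inferInstanceAs (DiscreteTopology nilLattice)⟩)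
  exact t2Space_of_properlyDiscontinuousSMul_of_t2Space (Γ := nilLattice) (T := NilG)

/-- The projection `ℂ⁵ → Γ \ G`. -/
def nilPr (x : Cn 5) : Nilmanifold nilLattice := nilProj nilLattice x

theorem nilPr_surjective : Function.Surjective nilPr := Quotient.exists_rep

theorem nilPr_eq_iff {x y : Cn 5} : nilPr x = nilPr y ↔
    ∃ γ : Cn 5, (∀ i, γ i ∈ gaussZ) ∧ y = nilMul γ x := by
  refine Quotient.eq.trans (QuotientGroup.rightRel_apply.trans ?_)
  constructor
  · intro h
    exact ⟨_, h, (inv_mul_cancel_right (G := NilG) y x).symm⟩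
  · rintro ⟨γ, hγ, rfl⟩
    have h : nilMul (nilMul γ x) (nilInv x) = γ := mul_inv_cancel_right (G := NilG) γ x
    change ∀ i, nilMul (nilMul γ x) (nilInv x) i ∈ gaussZ
    rwa [h]

theorem nilPr_nilMul {γ : Cn 5} (hγ : ∀ i, γ i ∈ gaussZ) (x : Cn 5) :
    nilPr (nilMul γ x) = nilPr x :=
  (nilPr_eq_iff.2 ⟨γ, hγ, rfl⟩).symm

/-- Translates by a lattice element that are close to each other coincide. -/
theorem eq_zero_of_nilMul_close {γ x : Cn 5} (hγ : ∀ i, γ i ∈ gaussZ)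
    (h : ∀ i, ‖nilMul γ x i - x i‖ < 1) : γ = 0 := by
  have h1 : ∀ i, i ≠ 4 → γ i = 0 := by
    intro i hi
    refine eq_zero_of_mem_gaussZ (hγ i) ?_
    have := h i
    rwa [nilMul_apply_of_ne _ _ hi, add_sub_cancel_right] at this
  have h2 : nilForm γ x = 0 := by
    simp [nilForm, h1 0 (by decide), h1 1 (by decide), h1 2 (by decide), h1 3 (by decide)]
  have h3 : γ 4 = 0 := by
    refine eq_zero_of_mem_gaussZ (hγ 4) ?_
    have := h 4
    rwa [nilMul_apply_four, h2, add_zero, add_sub_cancel_right] at this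
  funext i
  by_cases hi : i = 4
  · rw [hi, h3]; rfl
  · rw [h1 i hi]; rfl

theorem contDiff_nilForm_right (γ : Cn 5) : ContDiff ℂ ω fun z : Cn 5 => nilForm γ z := by
  unfold nilForm
  fun_prop

theorem contDiff_nilMul (γ : Cn 5) : ContDiff ℂ ω fun z : Cn 5 => nilMul γ z := by
  refine contDiff_pi.2 fun i => ?_
  by_cases hi : i = 4
  · subst hi
    simp only [nilMul_apply_four]
    exact (ContDiff.add contDiff_const (contDiff_apply ℂ ℂ 4)).add (contDiff_nilForm_right γ)
  · simp only [nilMul_apply_of_ne _ _ hi]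
    exact ContDiff.add contDiff_const (contDiff_apply ℂ ℂ i)

theorem nilPr_injOn_of_close {U : Set (Cn 5)} (h : ∀ x ∈ U, ∀ y ∈ U, ∀ i, ‖y i - x i‖ < 1) :
    Set.InjOn (nilPr) U := by
  intro x hx y hy hxy
  obtain ⟨γ, hγ, rfl⟩ := nilPr_eq_iff.1 hxy
  have := eq_zero_of_nilMul_close hγ (h x hx _ hy)
  rw [this, nilMul_zero_left]

theorem ball_close {n : ℕ} (a : Cn n) : ∀ x ∈ Metric.ball a (1 / 2), ∀ y ∈ Metric.ball a (1 / 2),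
    ∀ i, ‖y i - x i‖ < 1 := by
  intro x hx y hy i
  have h1 : dist (y i) (x i) ≤ dist y x := dist_le_pi_dist y x i
  rw [← dist_eq_norm]
  have h2 := dist_triangle_right y x a
  rw [Metric.mem_ball] at hx hy
  linarith

/-- The universal cover `G → Γ \ G` as an étale cover. -/
def nilCover : EtaleCover 5 (Nilmanifold nilLattice) Unit where
  dom _ := Set.univ
  map _ := nilPr
  isOpen_dom _ := isOpen_univ
  surj b := by
    obtain ⟨x, rfl⟩ := nilPr_surjective b
    exact ⟨(), x, trivial, rfl⟩
  continuousOn _ := Continuous.continuousOn continuous_quot_mk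
  isOpen_image _ U hU _ :=
    isOpenMap_quotient_mk'_mul (Γ := nilLattice) (T := NilG) U hU
  locInj _ x _ := ⟨Metric.ball x (1 / 2), Metric.isOpen_ball, Metric.mem_ball_self (by norm_num),
    Set.subset_univ _, nilPr_injOn_of_close (ball_close x)⟩
  transition _ _ x y _ _ hxy := by
    obtain ⟨γ, hγ, rfl⟩ := nilPr_eq_iff.1 hxy
    exact ⟨nilMul γ, (contDiff_nilMul γ).contDiffAt, rfl,
      Filter.Eventually.of_forall fun x' => nilPr_nilMul hγ x'⟩

instance : ChartedSpace (Cn 5) (Nilmanifold nilLattice) := nilCover.chartedSpace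

instance : IsManifold 𝓘(ℂ, Cn 5) ω (Nilmanifold nilLattice) := nilCover.isManifold

theorem isLocalDiffeomorph_nilProj :
    IsLocalDiffeomorph 𝓘(ℂ, Cn 5) 𝓘(ℂ, Cn 5) ω (nilProj nilLattice) := fun x =>
  nilCover.isLocalDiffeomorphAt (i := ()) (Set.mem_univ x)

theorem continuous_nilPr : Continuous fun x : Cn 5 => nilPr x :=
  continuous_quot_mk

/-- Every point can be moved by the lattice into the polydisc of radius `3 / 4`; the coordinates that are
small already need not be changed. -/
theorem exists_nilMul_norm_le (x : Cn 5) : ∃ γ : Cn 5, (∀ i, γ i ∈ gaussZ) ∧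
    (∀ i, ‖nilMul γ x i‖ ≤ 3 / 4) ∧ ∀ i, i ≠ 4 → x i = 0 → γ i = 0 := by
  have hex : ∀ z : ℂ, ∃ g ∈ gaussZ, ‖g + z‖ ≤ 3 / 4 ∧ (z = 0 → g = 0) := by
    intro z
    by_cases hz : z = 0
    · exact ⟨0, zero_mem _, by norm_num [hz], fun _ => rfl⟩
    · obtain ⟨g, hg, h⟩ := exists_gaussZ_norm_sub_le z
      exact ⟨-g, neg_mem hg, by rwa [neg_add_eq_sub], fun h0 => absurd h0 hz⟩
  choose f hf hf1 hf0 using hex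
  -- `nilForm` ignores the last coordinate, so the shift of x₅ is already determined by the first
  -- four coordinates of the lattice element; only then is the last one chosen.
  let γ' : Cn 5 := ![f (x 0), f (x 1), f (x 2), f (x 3), 0]
  let γ : Cn 5 := ![f (x 0), f (x 1), f (x 2), f (x 3), f (x 4 + nilForm γ' x)]
  have hform : nilForm γ x = nilForm γ' x := rfl
  refine ⟨γ, ?_, ?_, ?_⟩
  · intro i
    fin_cases i <;> exact hf _
  · intro i
    fin_cases i
    · exact hf1 _
    · exact hf1 _
    · exact hf1 _
    · exact hf1 _
    · change ‖f (x 4 + nilForm γ' x) + x 4 + nilForm γ' x‖ ≤ 3 / 4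
      rw [add_assoc]
      exact hf1 _
  · intro i hi h0
    fin_cases i
    · exact hf0 _ h0
    · exact hf0 _ h0
    · exact hf0 _ h0
    · exact hf0 _ h0
    · exact absurd rfl hi

instance : CompactSpace (Nilmanifold nilLattice) := by
  have hK : IsCompact (nilPr '' Metric.closedBall (0 : Cn 5) (3 / 4)) :=
    (isCompact_closedBall (0 : Cn 5) (3 / 4)).image continuous_nilPr
  refine ⟨hK.of_isClosed_subset isClosed_univ fun b _ => ?_⟩
  obtain ⟨x, rfl⟩ := nilPr_surjective b
  obtain ⟨γ, hγ, h, -⟩ := exists_nilMul_norm_le x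
  exact ⟨nilMul γ x, mem_closedBall_zero_iff.2 ((pi_norm_le_iff_of_nonneg (by norm_num)).2 h),
    nilPr_nilMul hγ x⟩

/-! ### The submanifold Y: compactness and preimage in G -/

theorem nilY_eq : nilY nilLattice = nilPr '' {z : Cn 5 | z 1 = 0 ∧ z 3 = 0} := rfl

theorem isCompact_nilY : IsCompact (nilY nilLattice) := by
  have hK : IsCompact (nilPr ''
      (Metric.closedBall (0 : Cn 5) (3 / 4) ∩ {z : Cn 5 | z 1 = 0 ∧ z 3 = 0})) := by
    refine ((isCompact_closedBall (0 : Cn 5) (3 / 4)).inter_right ?_).image continuous_nilPr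
    exact (isClosed_eq (continuous_apply 1) continuous_const).inter
      (isClosed_eq (continuous_apply 3) continuous_const)
  rw [nilY_eq]
  convert hK using 1
  refine Set.Subset.antisymm ?_ (Set.image_mono Set.inter_subset_right)
  rintro _ ⟨x, ⟨h1, h3⟩, rfl⟩
  -- Coordinates that vanish are left alone by the reduction, so the reduced point still satisfies
  -- the equations of Y.
  obtain ⟨γ, hγ, h, h0⟩ := exists_nilMul_norm_le x
  refine ⟨nilMul γ x, ⟨mem_closedBall_zero_iff.2 ((pi_norm_le_iff_of_nonneg (by norm_num)).2 h), ?_,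
    ?_⟩, nilPr_nilMul hγ x⟩
  · rw [nilMul_apply_of_ne _ _ (by decide), h0 1 (by decide) h1, h1, add_zero]
  · rw [nilMul_apply_of_ne _ _ (by decide), h0 3 (by decide) h3, h3, add_zero]

/-- A point of `G` lies over `Y` if and only if its second and fourth coordinates are Gaussian
integers. -/
theorem nilPr_mem_nilY {x : Cn 5} :
    nilPr x ∈ nilY nilLattice ↔ x 1 ∈ gaussZ ∧ x 3 ∈ gaussZ := by
  rw [nilY_eq]
  constructor
  · rintro ⟨y, ⟨h1, h3⟩, hy⟩
    obtain ⟨γ, hγ, rfl⟩ := nilPr_eq_iff.1 hy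
    rw [nilMul_apply_of_ne _ _ (by decide), nilMul_apply_of_ne _ _ (by decide), h1, h3, add_zero,
      add_zero]
    exact ⟨hγ 1, hγ 3⟩
  · rintro ⟨h1, h3⟩
    have hγ : ∀ i, (![0, -x 1, 0, -x 3, 0] : Cn 5) i ∈ gaussZ := by
      intro i
      fin_cases i
      · exact zero_mem _
      · exact neg_mem h1
      · exact zero_mem _
      · exact neg_mem h3
      · exact zero_mem _
    refine ⟨nilMul ![0, -x 1, 0, -x 3, 0] x, ⟨?_, ?_⟩, nilPr_nilMul hγ x⟩
    · rw [nilMul_apply_of_ne _ _ (by decide)]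
      simp
    · rw [nilMul_apply_of_ne _ _ (by decide)]
      simp

end

noncomputable section

/-! ### The invariant metric of the nilmanifold -/

theorem nilForm_add_right (w a b : Cn 5) : nilForm w (a + b) = nilForm w a + nilForm w b := by
  simp only [nilForm, Pi.add_apply]
  ring

theorem nilForm_smul_right (w a : Cn 5) (c : ℂ) : nilForm w (c • a) = c * nilForm w a := by
  simp only [nilForm, Pi.smul_apply, smul_eq_mul]
  ring

/-- The coframe at a point, as a linear map. -/
def nilCoframeL (z : Cn 5) : Cn 5 →ₗ[ℂ] Cn 5 where
  toFun := nilCoframe z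
  map_add' a b := by
    ext i
    fin_cases i <;> simp [nilCoframe, nilForm_add_right]
    ring
  map_smul' c a := by
    ext i
    fin_cases i <;> simp [nilCoframe, nilForm_smul_right]
    ring

theorem nilCoframeL_apply (z v : Cn 5) : nilCoframeL z v = nilCoframe z v := rfl

theorem nilCoframe_eq_zero {z v : Cn 5} (h : nilCoframe z v = 0) : v = 0 := by
  have h' : ∀ i, nilCoframe z v i = 0 := fun i => congrFun h i
  have h0 : v 0 = 0 := h' 0
  have h1 : v 1 = 0 := h' 1
  have h2 : v 2 = 0 := h' 2
  have h3 : v 3 = 0 := h' 3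
  have h4 : v 4 - nilForm z v = 0 := h' 4
  simp only [nilForm, h0, h1, h2, h3, mul_zero, add_zero, sub_zero] at h4
  ext i
  fin_cases i <;> assumption

/-- The scalar product `Re ∑ η^j ⊗ conj η^j` at a point. -/
def nilHerm (z : Cn 5) : Cn 5 →ₗ[ℝ] Cn 5 →ₗ[ℝ] ℝ :=
  LinearMap.mk₂ ℝ (fun v w => (∑ j, nilCoframe z v j * conj (nilCoframe z w j)).re)
    (fun a b c => by
      simp [← nilCoframeL_apply, add_mul, Finset.sum_add_distrib])
    (fun r a b => by
      have h : nilCoframeL z (r • a) = r • nilCoframeL z a :=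
        ((nilCoframeL z).restrictScalars ℝ).map_smul r a
      simp only [← nilCoframeL_apply, h, Pi.smul_apply, smul_mul_assoc, ← Finset.smul_sum]
      simp)
    (fun a b c => by
      simp [← nilCoframeL_apply, mul_add, Finset.sum_add_distrib])
    (fun r a b => by
      have h : nilCoframeL z (r • b) = r • nilCoframeL z b :=
        ((nilCoframeL z).restrictScalars ℝ).map_smul r b
      simp only [← nilCoframeL_apply, h, Pi.smul_apply, Complex.real_smul, map_mul,
        Complex.conj_ofReal, mul_left_comm, ← Finset.mul_sum]
      simp)

theorem nilHerm_apply (z v w : Cn 5) :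
    nilHerm z v w = (∑ j, nilCoframe z v j * conj (nilCoframe z w j)).re := rfl

theorem nilHerm_symm (z v w : Cn 5) : nilHerm z v w = nilHerm z w v := by
  simp only [nilHerm_apply, Complex.re_sum]
  refine Finset.sum_congr rfl fun j _ => ?_
  simp
  ring

theorem nilHerm_pos (z v : Cn 5) (hv : v ≠ 0) : 0 < nilHerm z v v := by
  simp only [nilHerm_apply, Complex.re_sum, Complex.mul_conj, Complex.ofReal_re]
  have h : ∃ j, nilCoframe z v j ≠ 0 := by
    by_contra! h
    exact hv (nilCoframe_eq_zero (funext h))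
  obtain ⟨j, hj⟩ := h
  exact Finset.sum_pos' (fun i _ => Complex.normSq_nonneg _)
    ⟨j, Finset.mem_univ j, Complex.normSq_pos.2 hj⟩

theorem nilHerm_I (z v w : Cn 5) :
    nilHerm z (Complex.I • v) (Complex.I • w) = nilHerm z v w := by
  simp only [nilHerm_apply, ← nilCoframeL_apply, map_smul, Pi.smul_apply, smul_eq_mul, map_mul,
    Complex.conj_I]
  congr 1
  refine Finset.sum_congr rfl fun j _ => ?_
  linear_combination (-nilCoframeL z v j * conj (nilCoframeL z w j)) * Complex.I_sq

theorem nilHerm_I_left (z v w : Cn 5) :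
    nilHerm z (Complex.I • v) w = baseForm v w + vertForm z v w := by
  simp only [nilHerm_apply, ← nilCoframeL_apply, map_smul, Pi.smul_apply, smul_eq_mul,
    Fin.sum_univ_five]
  rw [← baseForm_nilCoframe z v w]
  simp only [baseForm, vertForm, coordForm, nilCoframeL_apply]
  simp
  ring

/-- The differential of a left translation. -/
def nilShear (γ : Cn 5) : Cn 5 →L[ℂ] Cn 5 :=
  LinearMap.toContinuousLinearMap
    { toFun := fun v => nilMul γ v - γ
      map_add' := fun a b => by
        ext i
        simp only [Pi.sub_apply, Pi.add_apply]
        by_cases hi : i = 4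
        · simp only [hi, nilMul_apply_four, nilForm_add_right, Pi.add_apply]
          ring
        · simp only [nilMul_apply_of_ne _ _ hi, Pi.add_apply]
          ring
      map_smul' := fun c a => by
        ext i
        simp only [Pi.sub_apply, Pi.smul_apply, RingHom.id_apply]
        by_cases hi : i = 4
        · simp only [hi, nilMul_apply_four, nilForm_smul_right, Pi.smul_apply, smul_eq_mul]
          ring
        · simp only [nilMul_apply_of_ne _ _ hi, Pi.smul_apply, smul_eq_mul]
          ring }

theorem nilShear_apply (γ v : Cn 5) : nilShear γ v = nilMul γ v - γ := rfl

theorem hasFDerivAt_nilMul (γ z : Cn 5) : HasFDerivAt (nilMul γ) (nilShear γ) z := by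
  have h : nilMul γ = fun z => nilShear γ z + γ := by
    ext1 z
    rw [nilShear_apply, sub_add_cancel]
  rw [h]
  exact (nilShear γ).hasFDerivAt.add_const γ

/-- Left invariance: translation adds B(γ, v) to the last component, and the change of base point
subtracts it again because B is additive in its first variable. -/
theorem nilCoframe_nilShear (γ z v : Cn 5) :
    nilCoframe (nilMul γ z) (nilShear γ v) = nilCoframe z v := by
  rw [nilShear_apply]
  ext i
  fin_cases i <;> simp [nilCoframe, nilMul, nilForm]
  ring

theorem nilHerm_nilShear (γ z v w : Cn 5) :
    nilHerm (nilMul γ z) (nilShear γ v) (nilShear γ w) = nilHerm z v w := by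
  simp only [nilHerm_apply, nilCoframe_nilShear]

theorem isLocalDiffeomorphAt_nilPr (z : Cn 5) :
    IsLocalDiffeomorphAt 𝓘(ℂ, Cn 5) 𝓘(ℂ, Cn 5) ω nilPr z :=
  nilCover.isLocalDiffeomorphAt (i := ()) (Set.mem_univ z)

theorem mdifferentiableAt_nilPr (z : Cn 5) :
    MDifferentiableAt 𝓘(ℂ, Cn 5) 𝓘(ℂ, Cn 5) nilPr z :=
  (isLocalDiffeomorphAt_nilPr z).mdifferentiableAt (by simp)

/-- The differential of the projection. -/
def nilD (z : Cn 5) : Cn 5 ≃L[ℂ] Cn 5 :=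
  (isLocalDiffeomorphAt_nilPr z).mfderivToContinuousLinearEquiv (by simp)

theorem nilD_nilMul {γ : Cn 5} (hγ : ∀ i, γ i ∈ gaussZ) (z v : Cn 5) :
    nilD (nilMul γ z) (nilShear γ v) = nilD z v := by
  have h : nilPr ∘ nilMul γ = nilPr := funext fun x => nilPr_nilMul hγ x
  have h1 := mfderiv_comp (I := 𝓘(ℂ, Cn 5)) (I' := 𝓘(ℂ, Cn 5)) (I'' := 𝓘(ℂ, Cn 5)) z
    (mdifferentiableAt_nilPr (nilMul γ z))
    (hasFDerivAt_nilMul γ z).differentiableAt.mdifferentiableAt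
  rw [mfderiv_eq_fderiv, (hasFDerivAt_nilMul γ z).fderiv] at h1
  have h2 := congrArg (fun A : Cn 5 →L[ℂ] Cn 5 => A v) h1
  refine h2.symm.trans ?_
  -- The tangent space at the image depends on the map, so the equality of maps is eliminated as a
  -- variable instead of being rewritten.
  have key : ∀ f : Cn 5 → Nilmanifold nilLattice, f = nilPr →
      (mfderiv 𝓘(ℂ, Cn 5) 𝓘(ℂ, Cn 5) f z : Cn 5 →L[ℂ] Cn 5) v = nilD z v := by
    rintro _ rfl
    rfl
  exact key _ h

/-- The product is transported from one preimage of `m`. Any other preimage differs by a lattice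
translation, which preserves `nilHerm` and commutes with the projection. -/
theorem exists_nilHerm (m : Nilmanifold nilLattice) : ∃ b : Cn 5 →ₗ[ℝ] Cn 5 →ₗ[ℝ] ℝ,
    ∀ z, nilPr z = m → ∀ v w, b (nilD z v) (nilD z w) = nilHerm z v w := by
  obtain ⟨z, rfl⟩ := nilPr_surjective m
  let S : Cn 5 →ₗ[ℝ] Cn 5 := ((nilD z).symm.toLinearMap).restrictScalars ℝ
  refine ⟨(nilHerm z).compl₁₂ S S, fun y hy v w => ?_⟩
  obtain ⟨γ, hγ, rfl⟩ := nilPr_eq_iff.1 hy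
  rw [← nilD_nilMul hγ y v, ← nilD_nilMul hγ y w]
  change nilHerm _ ((nilD _).symm _) ((nilD _).symm _) = _
  rw [ContinuousLinearEquiv.symm_apply_apply, ContinuousLinearEquiv.symm_apply_apply,
    nilHerm_nilShear]

/-- The scalar products on the tangent spaces of the nilmanifold. -/
def nilVal (m : Nilmanifold nilLattice) : Cn 5 →ₗ[ℝ] Cn 5 →ₗ[ℝ] ℝ := (exists_nilHerm m).choose

theorem nilVal_nilD (z v w : Cn 5) : nilVal (nilPr z) (nilD z v) (nilD z w) = nilHerm z v w :=
  (exists_nilHerm (nilPr z)).choose_spec z rfl v w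

theorem exists_nilD (m : Nilmanifold nilLattice) (v w : Cn 5) :
    ∃ z a b, nilPr z = m ∧ nilD z a = v ∧ nilD z b = w := by
  obtain ⟨z, rfl⟩ := nilPr_surjective m
  exact ⟨z, (nilD z).symm v, (nilD z).symm w, rfl, (nilD z).apply_symm_apply v,
    (nilD z).apply_symm_apply w⟩

/-- The metric of the nilmanifold induced by the coframe. -/
def nilMetric : HermitianMetric 5 (Nilmanifold nilLattice) where
  val := nilVal
  symm m v w := by
    obtain ⟨z, a, b, rfl, rfl, rfl⟩ := exists_nilD m v w
    exact (nilVal_nilD z a b).trans ((nilHerm_symm z a b).trans (nilVal_nilD z b a).symm)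
  pos m v hv := by
    obtain ⟨z, a, b, rfl, rfl, -⟩ := exists_nilD m v v
    refine (nilHerm_pos z a fun h => hv ?_).trans_eq (nilVal_nilD z a a).symm
    rw [h]
    exact map_zero (nilD z)
  isometry_J m v w := by
    obtain ⟨z, a, b, rfl, rfl, rfl⟩ := exists_nilD m v w
    have h : ∀ a, multI (Tan 5 _ (nilPr z)) (nilD z a) = nilD z (Complex.I • a) := fun a =>
      ((nilD z).map_smul Complex.I a).symm
    rw [h, h]
    exact (nilVal_nilD z _ _).trans ((nilHerm_I z a b).trans (nilVal_nilD z a b).symm)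
  smooth := by
    rintro _ ⟨i, U, hU, hUd, hinj, rfl⟩ a b
    have h : (fun u => nilHerm u a b) = fun u => nilVal (nilPr u) (nilD u a) (nilD u b) :=
      funext fun u => (nilVal_nilD u a b).symm
    refine ContDiff.contDiffOn ?_
    change ContDiff ℝ ∞ fun u => nilVal (nilPr u) (nilD u a) (nilD u b)
    rw [← h]
    -- g(a, b) = -F(ia, b), so smoothness of the metric reduces to that of V.
    have h2 : ∀ u, nilHerm u a b =
        -(baseForm (Complex.I • a) b + vertForm u (Complex.I • a) b) := by
      intro u
      rw [← nilHerm_I_left, smul_smul, Complex.I_mul_I, neg_one_smul, map_neg]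
      simp
    simp only [h2]
    exact (contDiff_const.add (contDiff_vertForm _ _)).neg

theorem isNilDiagonal_nilMetric : IsNilDiagonal nilLattice nilMetric := fun z v w =>
  nilVal_nilD z v w

theorem formInChart_nilMetric (k : ℕ) {U : Set (Cn 5)} {hU : IsOpen U} {hUd} {hinj} :
    formInChart (fun x => wedgePow (nilMetric.fundamentalForm x) k)
      (nilCover.chart () U hU hUd hinj) =
    fun u => wedgePow (mpull nilPr nilMetric.fundamentalForm u) k := by
  ext1 u
  exact compContinuousLinearMap_wedgePow _ _ k

theorem mpull_nilMetric_apply (u : Cn 5) (w : Fin 2 → Cn 5) :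
    mpull nilPr nilMetric.fundamentalForm u w =
      baseForm (w 0) (w 1) + vertForm u (w 0) (w 1) := by
  rw [← nilHerm_I_left, ← nilVal_nilD, map_smul]
  rfl

theorem isDdcSpecial_nilMetric : nilMetric.IsDdcSpecial := by
  constructor
  · rintro _ ⟨i, U, hU, hUd, hinj, rfl⟩ u -
    rw [formInChart_nilMetric]
    exact ddcForm_wedgePow_three_nil mpull_nilMetric_apply u
  · rintro _ ⟨i, U, hU, hUd, hinj, rfl⟩ u -
    rw [formInChart_nilMetric]
    exact ddcForm_wedgePow_two_nil mpull_nilMetric_apply u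

end

noncomputable section

/-! ### Coordinates of the nilmanifold adapted to the submanifold -/

/-- The permutation of the coordinates that puts `z₂` and `z₄` last. -/
def nilSigma : Equiv.Perm (Fin 5) where
  toFun := ![0, 3, 1, 4, 2]
  invFun := ![0, 2, 4, 1, 3]
  left_inv := by decide
  right_inv := by decide

/-- The permutation of the coordinates that puts `z₂` and `z₄` last, as a linear map. -/
def nilPerm : Cn 5 ≃L[ℂ] Cn 5 :=
  (LinearEquiv.funCongrLeft ℂ ℂ nilSigma).toContinuousLinearEquiv

theorem nilPerm_apply (x : Cn 5) (i : Fin 5) : nilPerm x i = x (nilSigma i) := rfl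

theorem nilPerm_symm_apply (x : Cn 5) (i : Fin 5) : nilPerm.symm x i = x (nilSigma.symm i) := rfl

/-- The projection to the nilmanifold, in the permuted coordinates. -/
def nilQ (x : Cn 5) : Nilmanifold nilLattice := nilPr (nilPerm x)

/-- The translations of the nilpotent group in the permuted coordinates. -/
def nilT (γ x : Cn 5) : Cn 5 := nilPerm.symm (nilMul (nilPerm γ) (nilPerm x))

theorem nilT_apply_of_ne (γ x : Cn 5) {i : Fin 5} (hi : i ≠ 2) : nilT γ x i = γ i + x i := by
  fin_cases i <;> first | rfl | exact absurd rfl hi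

theorem nilT_apply_normal (γ x : Cn 5) {i : Fin 5} (hi : 3 ≤ (i : ℕ)) :
    nilT γ x i = γ i + x i :=
  nilT_apply_of_ne γ x (by rintro rfl; simp at hi)

theorem contDiff_nilT (γ : Cn 5) : ContDiff ℂ ω (nilT γ) :=
  nilPerm.symm.contDiff.comp ((contDiff_nilMul _).comp nilPerm.contDiff)

theorem nilQ_nilT {γ : Cn 5} (hγ : ∀ i, γ i ∈ gaussZ) (x : Cn 5) : nilQ (nilT γ x) = nilQ x := by
  rw [nilQ, nilT, ContinuousLinearEquiv.apply_symm_apply]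
  exact nilPr_nilMul (fun i => hγ _) _

theorem nilQ_eq_iff {x y : Cn 5} : nilQ x = nilQ y ↔
    ∃ γ : Cn 5, (∀ i, γ i ∈ gaussZ) ∧ y = nilT γ x := by
  constructor
  · intro h
    obtain ⟨γ, hγ, h⟩ := nilPr_eq_iff.1 h
    refine ⟨nilPerm.symm γ, fun i => hγ _, ?_⟩
    rw [nilT, ContinuousLinearEquiv.apply_symm_apply, ← h,
      ContinuousLinearEquiv.symm_apply_apply]
  · rintro ⟨γ, hγ, rfl⟩
    exact (nilQ_nilT hγ x).symm

theorem nilQ_injOn_of_close {U : Set (Cn 5)} (h : ∀ x ∈ U, ∀ y ∈ U, ∀ i, ‖y i - x i‖ < 1) :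
    Set.InjOn nilQ U := by
  have h1 : Set.InjOn nilPr (nilPerm '' U) := by
    refine nilPr_injOn_of_close ?_
    rintro _ ⟨x, hx, rfl⟩ _ ⟨y, hy, rfl⟩ i
    exact h x hx y hy _
  exact h1.comp nilPerm.injective.injOn (Set.mapsTo_image _ _)

theorem nilQ_mem_nilY {x : Cn 5} :
    nilQ x ∈ nilY nilLattice ↔ ∀ i : Fin 5, 3 ≤ (i : ℕ) → x i ∈ gaussZ := by
  rw [nilQ, nilPr_mem_nilY]
  constructor
  · rintro ⟨h1, h2⟩ i hi
    fin_cases i <;> simp at hi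
    · exact h1
    · exact h2
  · intro h
    exact ⟨h 3 le_rfl, h 4 (by norm_num)⟩

theorem exists_nilQ_norm_le (m : Nilmanifold nilLattice) :
    ∃ x, nilQ x = m ∧ ∀ i, ‖x i‖ ≤ 3 / 4 := by
  obtain ⟨x, rfl⟩ := nilPr_surjective m
  obtain ⟨γ, hγ, h, -⟩ := exists_nilMul_norm_le x
  refine ⟨nilPerm.symm (nilMul γ x), ?_, fun i => h _⟩
  rw [nilQ, ContinuousLinearEquiv.apply_symm_apply, nilPr_nilMul hγ]

theorem contMDiffAt_nilPr (z : Cn 5) : ContMDiffAt 𝓘(ℂ, Cn 5) 𝓘(ℂ, Cn 5) ω nilPr z :=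
  nilCover.contMDiffAt_map (i := ()) (Set.mem_univ z)

theorem contMDiff_nilQ : ContMDiff 𝓘(ℂ, Cn 5) 𝓘(ℂ, Cn 5) ω nilQ := fun x =>
  (contMDiffAt_nilPr (nilPerm x)).comp x nilPerm.contDiff.contMDiff.contMDiffAt

/-- A map out of the nilmanifold is analytic if it is so in the permuted coordinates. -/
theorem contMDiffAt_of_comp_nilQ {m : ℕ} {N : Type*} [TopologicalSpace N] [ChartedSpace (Cn m) N]
    {f : Nilmanifold nilLattice → N} {x : Cn 5}
    (hf : ContMDiffAt 𝓘(ℂ, Cn 5) 𝓘(ℂ, Cn m) ω (f ∘ nilQ) x) :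
    ContMDiffAt 𝓘(ℂ, Cn 5) 𝓘(ℂ, Cn m) ω f (nilQ x) := by
  refine nilCover.contMDiffAt_of_comp (i := ()) f (x := nilPerm x) (Set.mem_univ _) ?_
  have h : f ∘ nilCover.map () = (f ∘ nilQ) ∘ nilPerm.symm := by
    ext1 y
    simp only [Function.comp_def, nilQ, ContinuousLinearEquiv.apply_symm_apply]
    rfl
  rw [h]
  refine ContMDiffAt.comp _ ?_ nilPerm.symm.contDiff.contMDiff.contMDiffAt
  rwa [ContinuousLinearEquiv.symm_apply_apply]

/-- The chart inverse to `nilQ` on the ball of radius `1 / 2`. -/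
def nilChart (b : Cn 5) : OpenPartialHomeomorph (Nilmanifold nilLattice) (Cn 5) :=
  (nilCover.chart () (nilPerm.symm ⁻¹' Metric.ball b (1 / 2))
    (Metric.isOpen_ball.preimage nilPerm.symm.continuous) (Set.subset_univ _)
    (nilPr_injOn_of_close fun x hx y hy i => by
      have := ball_close b _ hx _ hy (nilSigma i)
      simpa only [nilPerm_symm_apply, Equiv.symm_apply_apply] using this)).transHomeomorph
    nilPerm.symm.toHomeomorph

theorem nilChart_target (b : Cn 5) : (nilChart b).target = Metric.ball b (1 / 2) := by
  ext x
  change nilPerm.symm (nilPerm x) ∈ Metric.ball b (1 / 2) ↔ _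
  rw [ContinuousLinearEquiv.symm_apply_apply]

theorem mem_nilChart_source {b : Cn 5} {m : Nilmanifold nilLattice} :
    m ∈ (nilChart b).source ↔ ∃ x ∈ Metric.ball b (1 / 2), nilQ x = m := by
  constructor
  · intro h
    exact ⟨nilChart b m, nilChart_target b ▸ (nilChart b).map_source h, (nilChart b).left_inv h⟩
  · rintro ⟨x, hx, rfl⟩
    exact (nilChart b).map_target (nilChart_target b ▸ hx)

theorem nilChart_nilQ {b x : Cn 5} (hx : x ∈ Metric.ball b (1 / 2)) : nilChart b (nilQ x) = x :=
  (nilChart b).right_inv (nilChart_target b ▸ hx)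

theorem nilChart_mem_maximalAtlas (b : Cn 5) :
    nilChart b ∈ IsManifold.maximalAtlas 𝓘(ℂ, Cn 5) ω (Nilmanifold nilLattice) := by
  refine OpenPartialHomeomorph.mem_maximalAtlas_of_contMDiffOn _ ?_ ?_
  · have h := contMDiffOn_of_mem_maximalAtlas (nilCover.mem_maximalAtlas ()
      (nilPerm.symm ⁻¹' Metric.ball b (1 / 2))
      (Metric.isOpen_ball.preimage nilPerm.symm.continuous) (Set.subset_univ _)
      (nilPr_injOn_of_close fun x hx y hy i => by
        have := ball_close b _ hx _ hy (nilSigma i)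
        simpa only [nilPerm_symm_apply, Equiv.symm_apply_apply] using this))
    exact nilPerm.symm.contDiff.contMDiff.comp_contMDiffOn h
  · exact contMDiff_nilQ.contMDiffOn

theorem exists_nilQ_of_mem_nilY {y : Nilmanifold nilLattice} (hy : y ∈ nilY nilLattice) :
    ∃ b, nilQ b = y ∧ ∀ i : Fin 5, 3 ≤ (i : ℕ) → b i = 0 := by
  obtain ⟨b, rfl, hb⟩ := exists_nilQ_norm_le y
  exact ⟨b, rfl, fun i hi => eq_zero_of_mem_gaussZ (nilQ_mem_nilY.1 hy i hi)
    ((hb i).trans_lt (by norm_num))⟩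

theorem norm_apply_lt_of_mem_ball {b x : Cn 5} {i : Fin 5} (hb : b i = 0)
    (hx : x ∈ Metric.ball b (1 / 2)) : ‖x i‖ < 1 / 2 := by
  have h := (dist_le_pi_dist x b i).trans_lt hx
  rwa [hb, dist_zero_right] at h

/-- Over Y the normal coordinates are Gaussian integers. In the chart they are smaller than 1/2,
hence zero, so only one sheet of the preimage of Y is visible. -/
theorem isAdaptedChart_nilChart {b : Cn 5} (hb : ∀ i : Fin 5, 3 ≤ (i : ℕ) → b i = 0) :
    IsAdaptedChart 3 (nilY nilLattice) (nilChart b) := by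
  refine ⟨nilChart_mem_maximalAtlas b, fun m hm => ?_⟩
  obtain ⟨x, hx, rfl⟩ := mem_nilChart_source.1 hm
  rw [nilChart_nilQ hx, nilQ_mem_nilY]
  refine forall₂_congr fun i hi => ⟨fun h => eq_zero_of_mem_gaussZ h ?_, fun h => h ▸ zero_mem _⟩
  exact (norm_apply_lt_of_mem_ball (hb i hi) hx).trans (by norm_num)

theorem isComplexSubmanifold_nilY : IsComplexSubmanifold 5 3 (nilY nilLattice) := by
  intro y hy
  obtain ⟨b, rfl, hb⟩ := exists_nilQ_of_mem_nilY hy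
  exact ⟨nilChart b, mem_nilChart_source.2 ⟨b, Metric.mem_ball_self (by norm_num), rfl⟩,
    isAdaptedChart_nilChart hb⟩

end

noncomputable section

/-! ### Affine coordinates of blow-ups -/

section BlowDown

variable {n d : ℕ}

/-- The normal direction of the point with the given affine coordinates. -/
def blowDir (j : NormalIdx n d) (x : Cn n) : NormalIdx n d → ℂ := fun i => if i = j then 1 else x i

/-- The blow-down map in affine coordinates. -/
def blowDown (j : NormalIdx n d) (x : Cn n) : Cn n := fun i =>
  if h : d ≤ (i : ℕ) then x j * blowDir j x ⟨i, h⟩ else x i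

/-- The affine coordinates of a point with given blow-down and normal direction. -/
def blowUp (j : NormalIdx n d) (z : Cn n) (v : NormalIdx n d → ℂ) : Cn n := fun i =>
  if h : d ≤ (i : ℕ) then if i = j then z i else v ⟨i, h⟩ / v j else z i

variable (j : NormalIdx n d)

@[simp] theorem blowDir_self (x : Cn n) : blowDir j x j = 1 := if_pos rfl

theorem blowDir_ne_zero (x : Cn n) : blowDir j x ≠ 0 := fun h =>
  one_ne_zero ((blowDir_self j x).symm.trans (congrFun h j))

theorem normalPart_blowDown (x : Cn n) : normalPart d (blowDown j x) = x j • blowDir j x := by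
  ext i
  simp [normalPart, blowDown, i.2]

theorem blowDown_normal (x : Cn n) (i : NormalIdx n d) :
    blowDown j x i = x j * blowDir j x i :=
  congrFun (normalPart_blowDown j x) i

@[simp] theorem blowDown_self (x : Cn n) : blowDown j x j = x j := by
  rw [blowDown_normal, blowDir_self, mul_one]

theorem blowDown_of_lt (x : Cn n) {i : Fin n} (hi : ¬ d ≤ (i : ℕ)) : blowDown j x i = x i :=
  dif_neg hi

theorem blowUp_self (z : Cn n) (v : NormalIdx n d → ℂ) : blowUp j z v j = z j := by
  simp [blowUp, j.2]

theorem blowUp_of_ne (z : Cn n) (v : NormalIdx n d → ℂ) {i : NormalIdx n d} (hi : i ≠ j) :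
    blowUp j z v i = v i / v j := by
  have : (i : Fin n) ≠ j := fun h => hi (Subtype.ext h)
  simp [blowUp, i.2, this]

theorem blowUp_of_lt (z : Cn n) (v : NormalIdx n d → ℂ) {i : Fin n} (hi : ¬ d ≤ (i : ℕ)) :
    blowUp j z v i = z i :=
  dif_neg hi

theorem blowDir_blowUp (z : Cn n) {v : NormalIdx n d → ℂ} (hv : v j ≠ 0) :
    blowDir j (blowUp j z v) = (v j)⁻¹ • v := by
  ext i
  by_cases hi : i = j
  · subst hi
    simp [hv]
  · simp [blowDir, hi, blowUp_of_ne, div_eq_inv_mul]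

theorem blowDown_blowUp {z : Cn n} {v : NormalIdx n d → ℂ} (hv : v j ≠ 0) {c : ℂ}
    (h : normalPart d z = c • v) : blowDown j (blowUp j z v) = z := by
  ext i
  by_cases hi : d ≤ (i : ℕ)
  · have h1 := congrFun h ⟨i, hi⟩
    have h2 := congrFun h j
    simp only [normalPart, Pi.smul_apply, smul_eq_mul] at h1 h2
    rw [show i = ((⟨i, hi⟩ : NormalIdx n d) : Fin n) from rfl, blowDown_normal, blowDir_blowUp _ _ hv,
      blowUp_self, h2, h1]
    simp only [Pi.smul_apply, smul_eq_mul]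
    field_simp
  · rw [blowDown_of_lt _ _ hi, blowUp_of_lt _ _ _ hi]

theorem blowUp_blowDown (x : Cn n) {c : ℂ} (hc : c ≠ 0) :
    blowUp j (blowDown j x) (c • blowDir j x) = x := by
  ext i
  by_cases hi : d ≤ (i : ℕ)
  · by_cases hij : (⟨i, hi⟩ : NormalIdx n d) = j
    · subst hij
      rw [blowUp_self, blowDown_self]
    · rw [show i = ((⟨i, hi⟩ : NormalIdx n d) : Fin n) from rfl, blowUp_of_ne _ _ _ hij]
      simp only [Pi.smul_apply, smul_eq_mul, blowDir_self, mul_one]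
      rw [mul_div_cancel_left₀ _ hc, blowDir, if_neg hij]
  · rw [blowUp_of_lt _ _ _ hi, blowDown_of_lt _ _ hi]

/-- Off the exceptional divisor the image determines the normal direction, by division by `x j`. On
it, the direction has to be supplied. -/
theorem blowDown_injective {x y : Cn n} (h : blowDown j x = blowDown j y)
    (h' : x j = 0 → blowDir j x = blowDir j y) : x = y := by
  have hj : x j = y j := by simpa using congrFun h j
  have hd : blowDir j x = blowDir j y := by
    by_cases h0 : x j = 0
    · exact h' h0
    · have := congrArg (normalPart d) h
      rw [normalPart_blowDown, normalPart_blowDown, ← hj] at this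
      exact smul_right_injective _ h0 this
  rw [← blowUp_blowDown j x one_ne_zero, ← blowUp_blowDown j y one_ne_zero, h, hd]

theorem contDiff_blowDir_apply (i : NormalIdx n d) : ContDiff ℂ ω fun x => blowDir j x i := by
  unfold blowDir
  split_ifs
  · exact contDiff_const
  · exact contDiff_apply ℂ ℂ _

theorem contDiff_blowDown : ContDiff ℂ ω (blowDown j : Cn n → Cn n) := by
  refine contDiff_pi.2 fun i => ?_
  unfold blowDown
  split_ifs with h
  · exact (contDiff_apply ℂ ℂ _).mul (contDiff_blowDir_apply j _)
  · exact contDiff_apply ℂ ℂ _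

theorem continuous_blowDown : Continuous (blowDown j : Cn n → Cn n) :=
  (contDiff_blowDown j).continuous

theorem ContDiffAt.blowUp {m : ℕ} {f : Cn m → Cn n} {g : Cn m → NormalIdx n d → ℂ} {x : Cn m}
    (hf : ContDiffAt ℂ ω f x) (hg : ContDiffAt ℂ ω g x) (h : g x j ≠ 0) :
    ContDiffAt ℂ ω (fun y => blowUp j (f y) (g y)) x := by
  refine contDiffAt_pi.2 fun i => ?_
  have hf' := fun i => contDiffAt_pi.1 hf i
  have hg' := fun i => contDiffAt_pi.1 hg i
  unfold _root_.blowUp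
  split_ifs
  · exact hf' i
  · exact (hg' _).div (hg' _) h
  · exact hf' i

theorem normalPart_smul_of_mem {z : Cn n} {ℓ : Projectivization ℂ (NormalIdx n d → ℂ)}
    (h : normalPart d z ∈ ℓ.submodule) : ∃ c : ℂ, normalPart d z = c • ℓ.rep := by
  rw [Projectivization.submodule_eq, Submodule.mem_span_singleton] at h
  obtain ⟨c, hc⟩ := h
  exact ⟨c, hc.symm⟩

theorem blowupCoord_eq (z : Cn n) (ℓ : Projectivization ℂ (NormalIdx n d → ℂ)) :
    blowupCoord d j (z, ℓ) = blowUp j z ℓ.rep := rfl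

theorem mk_smul_eq {v : NormalIdx n d → ℂ} {c : ℂ} (hv : v ≠ 0) (hcv : c • v ≠ 0) :
    Projectivization.mk ℂ (c • v) hcv = Projectivization.mk ℂ v hv :=
  (Projectivization.mk_eq_mk_iff' ℂ _ _ _ _).2 ⟨c, rfl⟩

theorem mk_eq_of_mem {v : NormalIdx n d → ℂ} (hv : v ≠ 0)
    {ℓ : Projectivization ℂ (NormalIdx n d → ℂ)} (h : v ∈ ℓ.submodule) :
    Projectivization.mk ℂ v hv = ℓ := by
  rw [Projectivization.submodule_eq, Submodule.mem_span_singleton] at h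
  obtain ⟨c, rfl⟩ := h
  conv_rhs => rw [← ℓ.mk_rep]
  exact (Projectivization.mk_eq_mk_iff' ℂ _ _ _ _).2 ⟨c, rfl⟩

theorem blowDir_eq_of_mk_eq {x y : Cn n}
    (h : Projectivization.mk ℂ (blowDir j x) (blowDir_ne_zero j x) =
      Projectivization.mk ℂ (blowDir j y) (blowDir_ne_zero j y)) : blowDir j x = blowDir j y := by
  obtain ⟨a, ha⟩ := (Projectivization.mk_eq_mk_iff' ℂ _ _ _ _).1 h
  have h1 := congrFun ha j
  simp only [Pi.smul_apply, blowDir_self, smul_eq_mul, mul_one] at h1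
  rw [← ha, h1, one_smul]

end BlowDown

end

noncomputable section

/-! ### The blow-up of the nilmanifold -/

/-- A point of the projectivised normal spaces. -/
def dirBase : Projectivization ℂ (NormalIdx 5 3 → ℂ) :=
  Projectivization.mk ℂ (blowDir ⟨3, le_rfl⟩ 0) (blowDir_ne_zero _ _)

/-- The blow-up of the nilmanifold along `Y`, as a set: the points of `Y` are replaced by the
projectivised normal spaces, which are trivialised by the coordinates `z₂`, `z₄`. -/
def NilBlowup : Type :=
  {p : Nilmanifold nilLattice × Projectivization ℂ (NormalIdx 5 3 → ℂ) //
    p.1 ∉ nilY nilLattice → p.2 = dirBase}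

/-- The blow-down map. -/
def nilBlowDown (q : NilBlowup) : Nilmanifold nilLattice := q.1.1

theorem nilQ_mem_nilY_of_normalPart {z : Cn 5} (h : normalPart 3 z = 0) :
    nilQ z ∈ nilY nilLattice :=
  nilQ_mem_nilY.2 fun i hi => by
    rw [show z i = 0 from congrFun h ⟨i, hi⟩]
    exact zero_mem _

theorem normalPart_eq_zero_of_mem_nilY {z : Cn 5} (h : nilQ z ∈ nilY nilLattice)
    (hz : ∀ i : Fin 5, 3 ≤ (i : ℕ) → ‖z i‖ < 1) : normalPart 3 z = 0 :=
  funext fun i => eq_zero_of_mem_gaussZ (nilQ_mem_nilY.1 h i i.2) (hz i i.2)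

theorem normalPart_blowDown_eq_zero_iff {j : NormalIdx 5 3} {x : Cn 5} :
    normalPart 3 (blowDown j x) = 0 ↔ x j = 0 := by
  rw [normalPart_blowDown, smul_eq_zero, or_iff_left (blowDir_ne_zero j x)]

theorem nilQ_blowDown_mem_nilY {j : NormalIdx 5 3} {x : Cn 5} (hx : x j = 0) :
    nilQ (blowDown j x) ∈ nilY nilLattice :=
  nilQ_mem_nilY_of_normalPart (normalPart_blowDown_eq_zero_iff.2 hx)

theorem eq_zero_of_nilQ_blowDown_mem {j : NormalIdx 5 3} {x : Cn 5}
    (h : nilQ (blowDown j x) ∈ nilY nilLattice) (hx : ‖x j‖ < 1) : x j = 0 := by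
  have := nilQ_mem_nilY.1 h j j.2
  rw [blowDown_self] at this
  exact eq_zero_of_mem_gaussZ this hx

open Classical in
/-- The affine coordinates of the blow-up, as maps onto it. -/
def nilBlow (j : NormalIdx 5 3) (x : Cn 5) : NilBlowup :=
  ⟨(nilQ (blowDown j x),
    if x j = 0 then Projectivization.mk ℂ (blowDir j x) (blowDir_ne_zero j x) else dirBase),
    fun h => if_neg fun hx => h (nilQ_blowDown_mem_nilY hx)⟩

theorem nilBlowDown_nilBlow (j : NormalIdx 5 3) (x : Cn 5) :
    nilBlowDown (nilBlow j x) = nilQ (blowDown j x) := rfl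

theorem nilBlow_snd_of_eq {j : NormalIdx 5 3} {x : Cn 5} (hx : x j = 0) :
    (nilBlow j x).1.2 = Projectivization.mk ℂ (blowDir j x) (blowDir_ne_zero j x) :=
  if_pos hx

theorem NilBlowup.ext_of_mem {q q' : NilBlowup} (h : nilBlowDown q = nilBlowDown q')
    (h' : nilBlowDown q ∈ nilY nilLattice → q.1.2 = q'.1.2) : q = q' := by
  refine Subtype.ext (Prod.ext h ?_)
  by_cases hq : nilBlowDown q ∈ nilY nilLattice
  · exact h' hq
  · exact (q.2 hq).trans (q'.2 (h ▸ hq : nilBlowDown q' ∉ _)).symm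

/-- A criterion for affine coordinates to represent a given point. -/
theorem nilBlow_blowUp {j : NormalIdx 5 3} {z : Cn 5} {v : NormalIdx 5 3 → ℂ} (hv : v j ≠ 0) {c : ℂ}
    (hc : normalPart 3 z = c • v) (hz : ‖z j‖ < 1) {q : NilBlowup} (hq : nilBlowDown q = nilQ z)
    (hq' : normalPart 3 z = 0 → q.1.2 = Projectivization.mk ℂ v fun h => hv (congrFun h j)) :
    nilBlow j (blowUp j z v) = q := by
  have h1 : nilBlowDown (nilBlow j (blowUp j z v)) = nilQ z := by
    rw [nilBlowDown_nilBlow, blowDown_blowUp j hv hc]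
  refine NilBlowup.ext_of_mem (h1.trans hq.symm) fun h => ?_
  rw [nilBlowDown_nilBlow] at h
  have h0 : blowUp j z v j = 0 := eq_zero_of_nilQ_blowDown_mem h (by rwa [blowUp_self])
  rw [nilBlow_snd_of_eq h0, hq']
  · simp only [blowDir_blowUp _ _ hv]
    exact mk_smul_eq _ _
  · rw [← blowDown_blowUp j hv hc]
    exact normalPart_blowDown_eq_zero_iff.2 h0

/-- Taking the largest component as denominator keeps the affine coordinates of a line bounded by 1.
This is what makes bounded pieces of the affine charts cover the blow-up. -/
theorem exists_norm_max (v : NormalIdx 5 3 → ℂ) (hv : v ≠ 0) :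
    ∃ j, v j ≠ 0 ∧ ∀ i, ‖v i‖ ≤ ‖v j‖ := by
  have : Nonempty (NormalIdx 5 3) := ⟨⟨3, le_rfl⟩⟩
  obtain ⟨j, hj⟩ := Finite.exists_max fun i => ‖v i‖
  refine ⟨j, fun h => hv (funext fun i => ?_), hj⟩
  have := hj i
  rw [h, norm_zero] at this
  exact norm_le_zero_iff.1 this

theorem norm_blowUp_le {j : NormalIdx 5 3} {z : Cn 5} {v : NormalIdx 5 3 → ℂ}
    (hz : ∀ i, ‖z i‖ ≤ 1) (hv : ∀ i, ‖v i‖ ≤ ‖v j‖) (i : Fin 5) : ‖blowUp j z v i‖ ≤ 1 := by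
  unfold blowUp
  split_ifs
  · exact hz i
  · rw [norm_div]
    exact div_le_one_of_le₀ (hv _) (norm_nonneg _)
  · exact hz i

theorem exists_nilBlow_eq (q : NilBlowup) : ∃ j x, nilBlow j x = q ∧ (∀ i, ‖x i‖ ≤ 1) ∧
    ‖x j‖ ≤ 3 / 4 := by
  obtain ⟨z, hz, hz1⟩ := exists_nilQ_norm_le (nilBlowDown q)
  have hz2 : ∀ i, ‖z i‖ ≤ 1 := fun i => (hz1 i).trans (by norm_num)
  have key : ∀ v : NormalIdx 5 3 → ℂ, ∀ hv : v ≠ 0, (∃ c : ℂ, normalPart 3 z = c • v) →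
      (normalPart 3 z = 0 → q.1.2 = Projectivization.mk ℂ v hv) →
      ∃ j x, nilBlow j x = q ∧ (∀ i, ‖x i‖ ≤ 1) ∧ ‖x j‖ ≤ 3 / 4 := by
    rintro v hv ⟨c, hc⟩ hq
    obtain ⟨j, hj, hmax⟩ := exists_norm_max v hv
    refine ⟨j, blowUp j z v, nilBlow_blowUp hj hc ((hz1 j).trans_lt (by norm_num)) hz.symm hq,
      norm_blowUp_le hz2 hmax, ?_⟩
    rw [blowUp_self]
    exact hz1 j
  -- Over Y the direction is the stored line; elsewhere the stored line is a dummy and the direction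
  -- is the normal part itself.
  by_cases h : normalPart 3 z = 0
  · exact key q.1.2.rep q.1.2.rep_nonzero ⟨0, by rw [h, zero_smul]⟩ fun _ => q.1.2.mk_rep.symm
  · exact key _ h ⟨1, (one_smul _ _).symm⟩ fun h' => absurd h' h

theorem nilBlow_injOn {j : NormalIdx 5 3} {V : Set (Cn 5)} (hV : Set.InjOn nilQ V) :
    Set.InjOn (nilBlow j) (blowDown j ⁻¹' V) := by
  intro x hx y hy h
  have h1 : blowDown j x = blowDown j y := hV hx hy (congrArg nilBlowDown h)
  refine blowDown_injective j h1 fun h0 => ?_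
  have h0' : y j = 0 := by
    rw [← blowDown_self j y, ← h1, blowDown_self, h0]
  have h2 := congrArg (fun q : NilBlowup => q.1.2) h
  simp only [nilBlow_snd_of_eq h0, nilBlow_snd_of_eq h0'] at h2
  exact blowDir_eq_of_mk_eq j h2

/-- Change of affine coordinates of the blow-up. -/
theorem nilBlow_transition {i j : NormalIdx 5 3} {x y : Cn 5} (hx : ‖x i‖ < 1) (hy : ‖y j‖ < 1)
    (h : nilBlow i x = nilBlow j y) : ∃ f : Cn 5 → Cn 5, ContDiffAt ℂ ω f x ∧ f x = y ∧
      ∀ᶠ x' in 𝓝 x, nilBlow j (f x') = nilBlow i x' := by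
  have h1 : nilQ (blowDown i x) = nilQ (blowDown j y) := congrArg nilBlowDown h
  obtain ⟨γ, hγ, hγ'⟩ := nilQ_eq_iff.1 h1
  let f : Cn 5 → Cn 5 := fun x' => nilT γ (blowDown i x')
  have hf : ContDiff ℂ ω f := (contDiff_nilT γ).comp (contDiff_blowDown i)
  have hfx : f x = blowDown j y := hγ'.symm
  have hf1 : ∀ᶠ x' in 𝓝 x, ‖f x' j‖ < 1 := by
    have : Continuous fun x' => ‖f x' j‖ := by
      have := hf.continuous
      fun_prop
    refine this.continuousAt.eventually (gt_mem_nhds ?_)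
    beta_reduce
    rwa [hfx, blowDown_self]
  by_cases h0 : x i = 0
  · have h0' : y j = 0 := eq_zero_of_nilQ_blowDown_mem (h1 ▸ nilQ_blowDown_mem_nilY h0) hy
    -- Both points lie over vanishing normal coordinates, so `γ` has no normal component and the
    -- translation preserves normal directions.
    have hγ0 : ∀ k : Fin 5, 3 ≤ (k : ℕ) → γ k = 0 := by
      intro k hk
      have h2 := congrFun hγ' k
      rw [nilT_apply_normal _ _ hk] at h2
      have h3 := congrFun (normalPart_blowDown_eq_zero_iff.2 h0) ⟨k, hk⟩
      have h4 := congrFun (normalPart_blowDown_eq_zero_iff.2 h0') ⟨k, hk⟩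
      simp only [normalPart, Pi.zero_apply] at h3 h4
      rw [h3, h4, add_zero] at h2
      exact h2.symm
    have hn : ∀ x', normalPart 3 (f x') = x' i • blowDir i x' := by
      intro x'
      rw [← normalPart_blowDown]
      funext k
      simp only [normalPart, f]
      rw [nilT_apply_normal _ _ k.2, hγ0 _ k.2, zero_add]
    have h2 := congrArg (fun q : NilBlowup => q.1.2) h
    simp only [nilBlow_snd_of_eq h0, nilBlow_snd_of_eq h0'] at h2
    obtain ⟨a, ha⟩ := (Projectivization.mk_eq_mk_iff' ℂ _ _ _ _).1 h2
    have ha0 : a ≠ 0 := by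
      rintro rfl
      rw [zero_smul] at ha
      exact blowDir_ne_zero i x ha.symm
    have hdj : blowDir i x j ≠ 0 := by
      rw [← ha]
      simpa using ha0
    have hg : ContDiff ℂ ω (fun x' => blowDir i x' : Cn 5 → NormalIdx 5 3 → ℂ) :=
      contDiff_pi.2 fun k => contDiff_blowDir_apply i k
    refine ⟨fun x' => blowUp j (f x') (blowDir i x'), hf.contDiffAt.blowUp j hg.contDiffAt hdj, ?_,
      ?_⟩
    · beta_reduce
      rw [hfx, ← ha, blowUp_blowDown j y ha0]
    · have hdj' : ∀ᶠ x' in 𝓝 x, blowDir i x' j ≠ 0 :=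
        (contDiff_blowDir_apply i j).continuous.continuousAt.eventually_ne hdj
      filter_upwards [hdj', hf1] with x' hx' hx1
      refine nilBlow_blowUp hx' (hn x') hx1 (nilQ_nilT hγ _).symm fun h3 => ?_
      rw [hn x', smul_eq_zero, or_iff_left (blowDir_ne_zero i x')] at h3
      exact nilBlow_snd_of_eq h3
  -- Off the divisor `γ` may have a normal component; the direction is then read off from the normal
  -- part of the translated point, which does not vanish.
  · have h0' : y j ≠ 0 := fun h2 => h0 (eq_zero_of_nilQ_blowDown_mem
      (h1.symm ▸ nilQ_blowDown_mem_nilY h2) hx)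
    have hg : ContDiff ℂ ω (fun x' => normalPart 3 (f x') : Cn 5 → NormalIdx 5 3 → ℂ) :=
      contDiff_pi.2 fun k => contDiff_pi.1 hf k
    have hfj : normalPart 3 (f x) j ≠ 0 := by
      rw [hfx, normalPart_blowDown]
      simpa using h0'
    refine ⟨fun x' => blowUp j (f x') (normalPart 3 (f x')),
      hf.contDiffAt.blowUp j hg.contDiffAt hfj, ?_, ?_⟩
    · beta_reduce
      rw [hfx, normalPart_blowDown, blowUp_blowDown j y h0']
    · have hfj' : ∀ᶠ x' in 𝓝 x, normalPart 3 (f x') j ≠ 0 :=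
        (contDiff_pi.1 hg j).continuous.continuousAt.eventually_ne hfj
      filter_upwards [hfj', hf1] with x' hx' hx1
      exact nilBlow_blowUp hx' (one_smul ℂ _).symm hx1 (nilQ_nilT hγ _).symm fun h3 =>
        absurd (congrFun h3 j) hx'

end

noncomputable section

/-! ### The complex structure of the blow-up -/

/-- The domain of the affine coordinates. -/
def nilBlowDom (j : NormalIdx 5 3) : Set (Cn 5) := {x | ‖x j‖ < 1}

theorem isOpen_nilBlowDom (j : NormalIdx 5 3) : IsOpen (nilBlowDom j) :=
  isOpen_lt (continuous_apply (j : Fin 5)).norm continuous_const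

/-- The topology is the final one for the affine coordinates. The topology induced from the product
would be wrong, since the second component is a dummy away from Y. -/
instance : TopologicalSpace NilBlowup where
  IsOpen U := ∀ j, IsOpen (nilBlowDom j ∩ nilBlow j ⁻¹' U)
  isOpen_univ j := by simpa using isOpen_nilBlowDom j
  isOpen_inter U V hU hV j := by
    have h := (hU j).inter (hV j)
    rwa [← Set.inter_inter_distrib_left] at h
  isOpen_sUnion S hS j := by
    rw [Set.preimage_sUnion, Set.inter_iUnion₂]
    exact isOpen_biUnion fun U hU => hS U hU j

theorem NilBlowup.isOpen_iff {U : Set NilBlowup} :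
    IsOpen U ↔ ∀ j, IsOpen (nilBlowDom j ∩ nilBlow j ⁻¹' U) := Iff.rfl

/-- The étale cover of the blow-up by the affine coordinates. -/
def nilBlowCover : EtaleCover 5 NilBlowup (NormalIdx 5 3) where
  dom := nilBlowDom
  map := nilBlow
  isOpen_dom := isOpen_nilBlowDom
  surj q := by
    obtain ⟨j, x, h, -, hx⟩ := exists_nilBlow_eq q
    exact ⟨j, x, hx.trans_lt (by norm_num), h⟩
  continuousOn j := (continuousOn_open_iff (isOpen_nilBlowDom j)).2 fun U hU => hU j
  isOpen_image i U hU hUd := by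
    refine NilBlowup.isOpen_iff.2 fun j => isOpen_iff_mem_nhds.2 ?_
    rintro y ⟨hy, x, hx, hxy⟩
    obtain ⟨f, hf, rfl, hf2⟩ := nilBlow_transition (i := j) (j := i) hy (hUd hx) hxy.symm
    filter_upwards [hf2, hf.continuousAt.eventually (hU.mem_nhds hx),
      (isOpen_nilBlowDom j).mem_nhds hy] with y' h1 h2 h3
    exact ⟨h3, _, h2, h1⟩
  locInj j x hx := by
    refine ⟨nilBlowDom j ∩ blowDown j ⁻¹' Metric.ball (blowDown j x) (1 / 2),
      (isOpen_nilBlowDom j).inter (Metric.isOpen_ball.preimage (continuous_blowDown j)),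
      ⟨hx, Metric.mem_ball_self (by norm_num)⟩, Set.inter_subset_left, ?_⟩
    exact (nilBlow_injOn (nilQ_injOn_of_close (ball_close _))).mono Set.inter_subset_right
  transition i j x y hx hy h := nilBlow_transition hx hy h

instance : ChartedSpace (Cn 5) NilBlowup := nilBlowCover.chartedSpace

instance : IsManifold 𝓘(ℂ, Cn 5) ω NilBlowup := nilBlowCover.isManifold

theorem contMDiff_nilBlowDown : ContMDiff 𝓘(ℂ, Cn 5) 𝓘(ℂ, Cn 5) ω nilBlowDown := by
  intro q
  obtain ⟨j, x, hx, rfl⟩ := nilBlowCover.surj q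
  refine nilBlowCover.contMDiffAt_of_comp _ hx ?_
  exact (contMDiff_nilQ.comp (contDiff_blowDown j).contMDiff).contMDiffAt

instance : CompactSpace NilBlowup := by
  -- The bound 3/4 on the j-th coordinate keeps these compact sets inside the domain `‖x j‖ < 1`.
  let K : NormalIdx 5 3 → Set (Cn 5) := fun j => Metric.closedBall 0 1 ∩ {x | ‖x j‖ ≤ 3 / 4}
  have hK : ∀ j, IsCompact (nilBlow j '' K j) := by
    intro j
    refine ((isCompact_closedBall (0 : Cn 5) 1).inter_right ?_).image_of_continuousOn
      ((nilBlowCover.continuousOn j).mono ?_)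
    · exact isClosed_le (continuous_apply (j : Fin 5)).norm continuous_const
    · rintro x ⟨-, hx⟩
      have hx' : ‖x j‖ ≤ 3 / 4 := hx
      exact hx'.trans_lt (by norm_num)
  have h : ⋃ j, nilBlow j '' K j = Set.univ := by
    refine Set.eq_univ_of_forall fun q => Set.mem_iUnion.2 ?_
    obtain ⟨j, x, hq, h1, h2⟩ := exists_nilBlow_eq q
    exact ⟨j, x, ⟨mem_closedBall_zero_iff.2 ((pi_norm_le_iff_of_nonneg zero_le_one).2 h1), h2⟩, hq⟩
  exact ⟨h ▸ isCompact_iUnion hK⟩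

/-- Affine coordinates of a point over `Y` can be chosen over a given representative of its
image. -/
theorem exists_nilBlow_eq_of_mem {q : NilBlowup} {z : Cn 5} (hz : normalPart 3 z = 0)
    (hq : nilBlowDown q = nilQ z) : ∃ j x, nilBlow j x = q ∧ blowDown j x = z ∧ x j = 0 := by
  obtain ⟨j, hj, -⟩ := exists_norm_max _ q.1.2.rep_nonzero
  have hc : normalPart 3 z = (0 : ℂ) • q.1.2.rep := by rw [hz, zero_smul]
  have hzj : z j = 0 := congrFun hz j
  refine ⟨j, blowUp j z q.1.2.rep, nilBlow_blowUp hj hc (by rw [hzj]; simp) hq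
    fun _ => q.1.2.mk_rep.symm, blowDown_blowUp j hj hc, ?_⟩
  rw [blowUp_self, hzj]

instance : T2Space NilBlowup := by
  refine ⟨fun q q' hne => ?_⟩
  by_cases hπ : nilBlowDown q = nilBlowDown q'
  · have hY : nilBlowDown q ∈ nilY nilLattice := by
      by_contra h
      exact hne (NilBlowup.ext_of_mem hπ fun h' => absurd h' h)
    obtain ⟨z, hz, hz0⟩ := exists_nilQ_of_mem_nilY hY
    have hz1 : normalPart 3 z = 0 := funext fun i => hz0 i i.2
    obtain ⟨i, x, rfl, hx, hxi⟩ := exists_nilBlow_eq_of_mem hz1 hz.symm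
    obtain ⟨j, y, rfl, hy, hyj⟩ := exists_nilBlow_eq_of_mem hz1 (hz.trans hπ).symm
    let V := Metric.ball z (1 / 2)
    have hVi : Set.InjOn nilQ V := nilQ_injOn_of_close (ball_close z)
    have hV : ∀ k, blowDown k ⁻¹' V ⊆ nilBlowDom k := by
      intro k x hx
      have := norm_apply_lt_of_mem_ball (hz0 k k.2) hx
      rw [blowDown_self] at this
      exact this.trans (by norm_num)
    have hVo : ∀ k : NormalIdx 5 3, IsOpen (blowDown k ⁻¹' V) := fun k =>
      Metric.isOpen_ball.preimage (continuous_blowDown k)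
    -- The 2 × 2 minors of the two normal directions: some minor is nonzero exactly when the
    -- directions span different lines, and this is an open condition separating points of one
    -- fibre.
    let D : NormalIdx 5 3 → NormalIdx 5 3 → Cn 5 × Cn 5 → ℂ := fun a b p =>
      blowDir i p.1 a * blowDir j p.2 b - blowDir i p.1 b * blowDir j p.2 a
    have hD : ∀ a b, Continuous (D a b) := by
      intro a b
      have h1 := fun a => (contDiff_blowDir_apply i a).continuous
      have h2 := fun a => (contDiff_blowDir_apply j a).continuous
      exact (((h1 a).comp continuous_fst).mul ((h2 b).comp continuous_snd)).sub
        (((h1 b).comp continuous_fst).mul ((h2 a).comp continuous_snd))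
    have hD0 : ∃ a b, D a b (x, y) ≠ 0 := by
      by_contra! h
      refine hne (NilBlowup.ext_of_mem hπ fun _ => ?_)
      rw [nilBlow_snd_of_eq hxi, nilBlow_snd_of_eq hyj, Projectivization.mk_eq_mk_iff']
      refine ⟨blowDir i x j, funext fun a => ?_⟩
      have := h a j
      simp only [D, blowDir_self, mul_one] at this
      rw [Pi.smul_apply, smul_eq_mul]
      linear_combination -this
    obtain ⟨a, b, hab⟩ := hD0
    have hopen : IsOpen {p | D a b p ≠ 0} := isOpen_ne_fun (hD a b) continuous_const
    obtain ⟨A, A', hA, hA', hxA, hyA', hAA'⟩ := isOpen_prod_iff.1 hopen x y hab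
    refine ⟨nilBlow i '' (A ∩ blowDown i ⁻¹' V), nilBlow j '' (A' ∩ blowDown j ⁻¹' V),
      nilBlowCover.isOpen_image i _ (hA.inter (hVo i)) (Set.inter_subset_right.trans (hV i)),
      nilBlowCover.isOpen_image j _ (hA'.inter (hVo j)) (Set.inter_subset_right.trans (hV j)),
      ⟨x, ⟨hxA, by simp [hx, V]⟩, rfl⟩, ⟨y, ⟨hyA', by simp [hy, V]⟩, rfl⟩, ?_⟩
    rw [Set.disjoint_left]
    rintro _ ⟨x', ⟨hxA, hxV⟩, rfl⟩ ⟨y', ⟨hyA, hyV⟩, h⟩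
    refine hAA' (Set.mk_mem_prod hxA hyA) ?_
    have h1 : blowDown j y' = blowDown i x' := hVi hyV hxV (congrArg nilBlowDown h)
    -- A common point of the two neighbourhoods would have proportional directions in the two
    -- charts, making every minor zero.
    have hprop : ∃ c : ℂ, blowDir i x' = c • blowDir j y' := by
      by_cases h0 : x' i = 0
      · have h0' : y' j = 0 := by
          rw [← normalPart_blowDown_eq_zero_iff, h1, normalPart_blowDown_eq_zero_iff, h0]
        have h2 := congrArg (fun q : NilBlowup => q.1.2) h.symm
        simp only [nilBlow_snd_of_eq h0, nilBlow_snd_of_eq h0'] at h2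
        obtain ⟨c, hc⟩ := (Projectivization.mk_eq_mk_iff' ℂ _ _ _ _).1 h2
        exact ⟨c, hc.symm⟩
      · have h2 := congrArg (normalPart 3) h1
        rw [normalPart_blowDown, normalPart_blowDown] at h2
        refine ⟨(x' i)⁻¹ * y' j, ?_⟩
        rw [mul_smul, h2, smul_smul, inv_mul_cancel₀ h0, one_smul]
    obtain ⟨c, hc⟩ := hprop
    simp only [D, hc, Pi.smul_apply, smul_eq_mul]
    ring
  · obtain ⟨U, V, hU, hV, h1, h2, h3⟩ := t2_separation hπ
    have hc := contMDiff_nilBlowDown.continuous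
    exact ⟨_, _, hU.preimage hc, hV.preimage hc, h1, h2, h3.preimage _⟩

theorem isClosed_nilY : IsClosed (nilY nilLattice) := isCompact_nilY.isClosed

/-- The inverse of the blow-down map over the complement of `Y`. -/
def nilBlowSection (m : Nilmanifold nilLattice) : NilBlowup := ⟨(m, dirBase), fun _ => rfl⟩

/-- Off Y some normal coordinate is nonzero, and dividing by it expresses the section analytically
in affine coordinates. -/
theorem contMDiffOn_nilBlowSection :
    ContMDiffOn 𝓘(ℂ, Cn 5) 𝓘(ℂ, Cn 5) ω nilBlowSection (nilY nilLattice)ᶜ := by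
  intro m hm
  refine ContMDiffAt.contMDiffWithinAt ?_
  obtain ⟨z, rfl, hz⟩ := exists_nilQ_norm_le m
  have hz0 : normalPart 3 z ≠ 0 := fun h => hm (nilQ_mem_nilY_of_normalPart h)
  obtain ⟨j, hj, -⟩ := exists_norm_max _ hz0
  refine contMDiffAt_of_comp_nilQ ?_
  have hn : ContDiff ℂ ω (normalPart 3 : Cn 5 → NormalIdx 5 3 → ℂ) :=
    contDiff_pi.2 fun k => contDiff_apply ℂ ℂ _
  have hb : ContDiffAt ℂ ω (fun z : Cn 5 => blowUp j z (normalPart 3 z)) z :=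
    contDiffAt_id.blowUp j hn.contDiffAt hj
  have hzj : ‖z j‖ < 1 := (hz j).trans_lt (by norm_num)
  have h1 : ∀ᶠ z' in 𝓝 z, nilBlowSection (nilQ z') = nilBlow j (blowUp j z' (normalPart 3 z')) := by
    filter_upwards [(continuous_apply (j : Fin 5)).norm.continuousAt.eventually (gt_mem_nhds hzj),
      (contDiff_pi.1 hn j).continuous.continuousAt.eventually_ne hj] with z' h2 h3
    exact (nilBlow_blowUp h3 (one_smul ℂ _).symm h2 rfl fun h => absurd (congrFun h j) h3).symm
  refine ContMDiffAt.congr_of_eventuallyEq ?_ h1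
  refine ContMDiffAt.comp z (nilBlowCover.contMDiffAt_map (i := j) ?_) hb.contMDiffAt
  change ‖blowUp j z (normalPart 3 z) j‖ < 1
  rwa [blowUp_self]

theorem bijOn_nilBlowDown : Set.BijOn nilBlowDown (nilBlowDown ⁻¹' (nilY nilLattice)ᶜ)
    (nilY nilLattice)ᶜ := by
  refine ⟨fun q hq => hq, fun q hq q' _ h => ?_, fun m hm => ⟨nilBlowSection m, hm, rfl⟩⟩
  exact NilBlowup.ext_of_mem h fun h' => absurd h' hq

theorem isLocalDiffeomorphOn_nilBlowDown : IsLocalDiffeomorphOn 𝓘(ℂ, Cn 5) 𝓘(ℂ, Cn 5) ω nilBlowDown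
    (nilBlowDown ⁻¹' (nilY nilLattice)ᶜ) := by
  rintro ⟨q, hq⟩
  exact ⟨{ toFun := nilBlowDown
           invFun := nilBlowSection
           source := nilBlowDown ⁻¹' (nilY nilLattice)ᶜ
           target := (nilY nilLattice)ᶜ
           map_source' := fun q hq => hq
           map_target' := fun m hm => hm
           left_inv' := fun q hq => NilBlowup.ext_of_mem rfl fun h => absurd h hq
           right_inv' := fun m hm => rfl
           open_source := isClosed_nilY.isOpen_compl.preimage contMDiff_nilBlowDown.continuous
           open_target := isClosed_nilY.isOpen_compl
           contMDiffOn_toFun := contMDiff_nilBlowDown.contMDiffOn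
           contMDiffOn_invFun := contMDiffOn_nilBlowSection }, hq, fun _ _ => rfl⟩

/-! ### The local model of the blow-up over an adapted chart -/

open Classical in
/-- The normal direction of a point of the blow-up, over a chart. -/
def nilBlowDir (φ : OpenPartialHomeomorph (Nilmanifold nilLattice) (Cn 5)) (q : NilBlowup) :
    Projectivization ℂ (NormalIdx 5 3 → ℂ) :=
  if h : normalPart 3 (φ (nilBlowDown q)) = 0 then q.1.2 else Projectivization.mk ℂ _ h

theorem nilBlowDir_of_eq {b z : Cn 5} {q : NilBlowup} (hz : z ∈ Metric.ball b (1 / 2))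
    (hq : nilBlowDown q = nilQ z) (h : normalPart 3 z = 0) :
    nilBlowDir (nilChart b) q = q.1.2 := by
  rw [nilBlowDir, dif_pos]
  rwa [hq, nilChart_nilQ hz]

theorem nilBlowDir_of_ne {b z : Cn 5} {q : NilBlowup} (hz : z ∈ Metric.ball b (1 / 2))
    (hq : nilBlowDown q = nilQ z) (h : normalPart 3 z ≠ 0) :
    nilBlowDir (nilChart b) q = Projectivization.mk ℂ _ h := by
  have h1 : nilChart b (nilBlowDown q) = z := by rw [hq, nilChart_nilQ hz]
  have h2 : ¬ normalPart 3 (nilChart b (nilBlowDown q)) = 0 := by rwa [h1]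
  rw [nilBlowDir, dif_neg h2]
  congr 1
  rw [h1]

theorem nilBlowDir_nilBlow {b x : Cn 5} {j : NormalIdx 5 3}
    (hx : blowDown j x ∈ Metric.ball b (1 / 2)) :
    nilBlowDir (nilChart b) (nilBlow j x) =
      Projectivization.mk ℂ (blowDir j x) (blowDir_ne_zero j x) := by
  by_cases h0 : x j = 0
  · rw [nilBlowDir_of_eq hx rfl (normalPart_blowDown_eq_zero_iff.2 h0), nilBlow_snd_of_eq h0]
  · rw [nilBlowDir_of_ne hx rfl fun h => h0 (normalPart_blowDown_eq_zero_iff.1 h)]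
    simp only [normalPart_blowDown]
    exact mk_smul_eq _ _

theorem exists_rep_nilBlowDir_nilBlow {b x : Cn 5} {j : NormalIdx 5 3}
    (hx : blowDown j x ∈ Metric.ball b (1 / 2)) :
    ∃ c : ℂ, c ≠ 0 ∧ (nilBlowDir (nilChart b) (nilBlow j x)).rep = c • blowDir j x := by
  rw [nilBlowDir_nilBlow hx]
  obtain ⟨c, hc⟩ := Projectivization.exists_smul_eq_mk_rep ℂ _ (blowDir_ne_zero j x)
  exact ⟨c, c.ne_zero, hc.symm⟩

theorem normalPart_mem_nilBlowDir {b z : Cn 5} {q : NilBlowup} (hz : z ∈ Metric.ball b (1 / 2))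
    (hq : nilBlowDown q = nilQ z) : normalPart 3 z ∈ (nilBlowDir (nilChart b) q).submodule := by
  by_cases h : normalPart 3 z = 0
  · rw [h]
    exact zero_mem _
  · rw [nilBlowDir_of_ne hz hq h, Projectivization.submodule_mk]
    exact Submodule.mem_span_singleton_self _

theorem norm_lt_one_of_mem_ball {b z : Cn 5} (hb : ∀ i : Fin 5, 3 ≤ (i : ℕ) → b i = 0)
    (hz : z ∈ Metric.ball b (1 / 2)) (i : Fin 5) (hi : 3 ≤ (i : ℕ)) : ‖z i‖ < 1 :=
  (norm_apply_lt_of_mem_ball (hb i hi) hz).trans (by norm_num)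

/-- This identifies the source of the affine chart with the set prescribed by `IsBlowup`: over the
ball, the j-th coordinates reach exactly the lines with nonzero j-th component. -/
theorem image_nilBlow_ball {b : Cn 5} (hb : ∀ i : Fin 5, 3 ≤ (i : ℕ) → b i = 0)
    (j : NormalIdx 5 3) : nilBlow j '' (blowDown j ⁻¹' Metric.ball b (1 / 2)) =
      {q | nilBlowDown q ∈ (nilChart b).source ∧ (nilBlowDir (nilChart b) q).rep j ≠ 0} := by
  refine Set.Subset.antisymm ?_ ?_
  · rintro _ ⟨x, hx, rfl⟩
    rw [Set.mem_preimage] at hx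
    have h1 : nilBlowDown (nilBlow j x) ∈ (nilChart b).source :=
      mem_nilChart_source.2 ⟨blowDown j x, hx, (nilBlowDown_nilBlow j x).symm⟩
    obtain ⟨c, hc, h⟩ := exists_rep_nilBlowDir_nilBlow hx
    have h2 : (nilBlowDir (nilChart b) (nilBlow j x)).rep j ≠ 0 := by
      rw [h]
      simpa using hc
    exact ⟨h1, h2⟩
  · rintro q ⟨hq, hj⟩
    obtain ⟨z, hz, hqz⟩ := mem_nilChart_source.1 hq
    obtain ⟨c, hc⟩ := normalPart_smul_of_mem (normalPart_mem_nilBlowDir hz hqz.symm)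
    refine ⟨blowUp j z (nilBlowDir (nilChart b) q).rep, ?_, ?_⟩
    · rw [Set.mem_preimage, blowDown_blowUp j hj hc]
      exact hz
    · refine nilBlow_blowUp hj hc (norm_lt_one_of_mem_ball hb hz j j.2) hqz.symm fun h0 => ?_
      rw [Projectivization.mk_rep, nilBlowDir_of_eq hz hqz.symm h0]

theorem isBlowup_nilBlowDown : IsBlowup 5 3 (nilY nilLattice) nilBlowDown where
  holomorphic := contMDiff_nilBlowDown
  bijOn_compl := bijOn_nilBlowDown
  localDiffeo_compl := isLocalDiffeomorphOn_nilBlowDown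
  local_model := by
    intro y hy
    obtain ⟨b, rfl, hb⟩ := exists_nilQ_of_mem_nilY hy
    have hVi : Set.InjOn nilQ (Metric.ball b (1 / 2)) := nilQ_injOn_of_close (ball_close b)
    refine ⟨nilChart b, mem_nilChart_source.2 ⟨b, Metric.mem_ball_self (by norm_num), rfl⟩,
      isAdaptedChart_nilChart hb, nilBlowDir (nilChart b), ⟨?_, ?_, ?_⟩, fun j => ?_⟩
    · intro q hq
      obtain ⟨z, hz, hqz⟩ := mem_nilChart_source.1 hq
      beta_reduce
      rw [← hqz, nilChart_nilQ hz]
      exact ⟨by rwa [nilChart_target], normalPart_mem_nilBlowDir hz hqz.symm⟩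
    · intro q hq q' hq' h
      obtain ⟨z, hz, hqz⟩ := mem_nilChart_source.1 hq
      obtain ⟨z', hz', hqz'⟩ := mem_nilChart_source.1 hq'
      simp only [Prod.mk.injEq, ← hqz, ← hqz', nilChart_nilQ hz, nilChart_nilQ hz'] at h
      obtain ⟨rfl, h⟩ := h
      refine NilBlowup.ext_of_mem (hqz.symm.trans hqz') fun hY => ?_
      rw [← hqz] at hY
      have h0 := normalPart_eq_zero_of_mem_nilY hY (norm_lt_one_of_mem_ball hb hz)
      rwa [nilBlowDir_of_eq hz hqz.symm h0, nilBlowDir_of_eq hz hqz'.symm h0] at h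
    · rintro ⟨z, ℓ⟩ ⟨hz, hℓ⟩
      simp only at hz hℓ
      rw [nilChart_target] at hz
      -- Over Y every line occurs as a second component; elsewhere the incidence condition forces
      -- the line to be spanned by the normal part.
      by_cases h0 : normalPart 3 z = 0
      · let q : NilBlowup := ⟨(nilQ z, ℓ), fun h => absurd (nilQ_mem_nilY_of_normalPart h0) h⟩
        refine ⟨q, mem_nilChart_source.2 ⟨z, hz, rfl⟩, Prod.ext (nilChart_nilQ hz) ?_⟩
        exact nilBlowDir_of_eq (q := q) hz rfl h0
      · let q : NilBlowup := nilBlowSection (nilQ z)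
        refine ⟨q, mem_nilChart_source.2 ⟨z, hz, rfl⟩, Prod.ext (nilChart_nilQ hz) ?_⟩
        exact (nilBlowDir_of_ne (q := q) hz rfl h0).trans (mk_eq_of_mem h0 hℓ)
    · have hUd : blowDown j ⁻¹' Metric.ball b (1 / 2) ⊆ nilBlowCover.dom j := by
        intro x hx
        have := norm_lt_one_of_mem_ball hb hx j j.2
        rwa [blowDown_self] at this
      have hUo : IsOpen (blowDown j ⁻¹' Metric.ball b (1 / 2)) :=
        Metric.isOpen_ball.preimage (continuous_blowDown j)
      have hinj : Set.InjOn (nilBlowCover.map j) (blowDown j ⁻¹' Metric.ball b (1 / 2)) :=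
        nilBlow_injOn hVi
      refine ⟨nilBlowCover.chart j (blowDown j ⁻¹' Metric.ball b (1 / 2)) hUo hUd hinj,
        nilBlowCover.mem_maximalAtlas j _ hUo hUd hinj, ?_, ?_⟩
      · exact image_nilBlow_ball hb j
      · rintro _ ⟨x, hx, rfl⟩
        rw [EtaleCover.chart_map _ hx]
        rw [Set.mem_preimage] at hx
        change x = blowupCoord 3 j (nilChart b (nilQ (blowDown j x)),
          nilBlowDir (nilChart b) (nilBlow j x))
        obtain ⟨c, hc, h⟩ := exists_rep_nilBlowDir_nilBlow hx
        rw [nilChart_nilQ hx, blowupCoord_eq, h, blowUp_blowDown j x hc]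

end

noncomputable section

/-! ### Averages of functions along vectors -/

section Averages

variable {E : Type*} [NormedAddCommGroup E] [NormedSpace ℝ E]

/-- The average of a function along the segment given by a vector. -/
def avg (u : E) (f : E → ℝ) (x : E) : ℝ := ∫ s in (0 : ℝ)..1, f (x + s • u)

theorem continuous_segment {F : Type*} [TopologicalSpace F] {f : E → F} (hf : Continuous f) (u x : E) :
    Continuous fun s : ℝ => f (x + s • u) :=
  hf.comp (by fun_prop)

theorem intervalIntegrable_segment {f : E → ℝ} (hf : Continuous f) (u x : E) :
    IntervalIntegrable (fun s : ℝ => f (x + s • u)) MeasureTheory.volume 0 1 :=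
  (continuous_segment hf u x).intervalIntegrable 0 1

theorem avg_add {f g : E → ℝ} (hf : Continuous f) (hg : Continuous g) (u : E) :
    avg u (fun x => f x + g x) = fun x => avg u f x + avg u g x :=
  funext fun x => intervalIntegral.integral_add (intervalIntegrable_segment hf u x)
    (intervalIntegrable_segment hg u x)

/-- Functions constant along a vector come out of the average. -/
theorem avg_mul {c : E → ℝ} {u : E} (hc : ∀ x (s : ℝ), c (x + s • u) = c x) (f : E → ℝ) :
    avg u (fun x => c x * f x) = fun x => c x * avg u f x := by
  funext x
  simp only [avg, hc]
  exact intervalIntegral.integral_const_mul _ _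

theorem avg_pos {f : E → ℝ} (hf : Continuous f) (h : ∀ x, 0 < f x) (u x : E) : 0 < avg u f x :=
  intervalIntegral.intervalIntegral_pos_of_pos (intervalIntegrable_segment hf u x)
    (fun _ => h _) one_pos

theorem abs_avg_le {f : E → ℝ} {u x : E} {C : ℝ}
    (h : ∀ s ∈ Set.Icc (0 : ℝ) 1, |f (x + s • u)| ≤ C) : |avg u f x| ≤ C := by
  have := intervalIntegral.norm_integral_le_of_norm_le_const (a := 0) (b := 1)
    (f := fun s : ℝ => f (x + s • u)) (C := C) fun s hs => by
      rw [Set.uIoc_of_le zero_le_one] at hs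
      exact h s ⟨hs.1.le, hs.2⟩
  simpa [avg] using this

theorem avg_comp {f : E → ℝ} {u : E} {T : E → E} (hT : ∀ x (s : ℝ), T (x + s • u) = T x + s • u)
    (hf : ∀ x, f (T x) = f x) (x : E) : avg u f (T x) = avg u f x := by
  simp only [avg, ← hT, hf]

theorem continuous_avg {f : E → ℝ} (hf : Continuous f) (u : E) : Continuous (avg u f) :=
  intervalIntegral.continuous_parametric_intervalIntegral_of_continuous'
    (f := fun x s => f (x + s • u)) (hf.comp (by fun_prop)) 0 1

/-- Differentiation under the integral sign, dominated by a bound for the derivative on the compact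
set swept out by a closed ball along the segment. -/
theorem hasFDerivAt_avg [FiniteDimensional ℝ E] {f : E → ℝ} (hf : ContDiff ℝ 1 f) (u x : E) :
    HasFDerivAt (avg u f) (∫ s in (0 : ℝ)..1, fderiv ℝ f (x + s • u)) x := by
  have hd : Continuous (fderiv ℝ f) := hf.continuous_fderiv (by simp)
  obtain ⟨C, hC⟩ : ∃ C, ∀ p ∈ Metric.closedBall x 1 ×ˢ Set.Icc (0 : ℝ) 1,
      ‖fderiv ℝ f (p.1 + p.2 • u)‖ ≤ C :=
    ((isCompact_closedBall x 1).prod isCompact_Icc).exists_bound_of_continuousOn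
      (hd.comp (by fun_prop)).continuousOn
  refine intervalIntegral.hasFDerivAt_integral_of_dominated_of_fderiv_le
    (F := fun x s => f (x + s • u)) (F' := fun x s => fderiv ℝ f (x + s • u))
    (bound := fun _ => C) (Metric.closedBall_mem_nhds x one_pos)
    ?_ (intervalIntegrable_segment hf.continuous u x) ?_ ?_ ?_ ?_
  · exact Filter.Eventually.of_forall fun y =>
      (continuous_segment hf.continuous u y).aestronglyMeasurable
  · exact (continuous_segment hd u x).aestronglyMeasurable
  · refine Filter.Eventually.of_forall fun s hs y hy => hC (y, s) ⟨hy, ?_⟩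
    rw [Set.uIoc_of_le zero_le_one] at hs
    exact ⟨hs.1.le, hs.2⟩
  · exact intervalIntegrable_const
  · refine Filter.Eventually.of_forall fun s _ y _ => ?_
    have h1 : HasFDerivAt f (fderiv ℝ f (y + s • u)) (y + s • u) :=
      (hf.differentiable (by simp) _).hasFDerivAt
    have h2 := h1.comp y ((hasFDerivAt_id y).add_const (s • u))
    rwa [ContinuousLinearMap.comp_id] at h2

theorem contDiff_avg [FiniteDimensional ℝ E] {f : E → ℝ} (hf : ContDiff ℝ 1 f) (u : E) : ContDiff ℝ 1 (avg u f) := by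
  refine contDiff_one_iff_fderiv.2 ⟨fun x => (hasFDerivAt_avg hf u x).differentiableAt, ?_⟩
  have h : fderiv ℝ (avg u f) = fun x => ∫ s in (0 : ℝ)..1, fderiv ℝ f (x + s • u) :=
    funext fun x => (hasFDerivAt_avg hf u x).fderiv
  rw [h]
  have hd : Continuous (fderiv ℝ f) := hf.continuous_fderiv (by simp)
  exact intervalIntegral.continuous_parametric_intervalIntegral_of_continuous'
    (f := fun x s => fderiv ℝ f (x + s • u)) (hd.comp (by fun_prop)) 0 1

theorem fderiv_avg [FiniteDimensional ℝ E] {f : E → ℝ} (hf : ContDiff ℝ 1 f) (u x v : E) :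
    fderiv ℝ (avg u f) x v = avg u (fun y => fderiv ℝ f y v) x := by
  have hd : Continuous (fderiv ℝ f) := hf.continuous_fderiv (by simp)
  rw [(hasFDerivAt_avg hf u x).fderiv]
  exact ContinuousLinearMap.intervalIntegral_apply
    ((continuous_segment hd u x).intervalIntegrable 0 1) v

/-- The derivative of the average along `u` is the average of the derivative, that is f(x + u) -
f(x), which vanishes by periodicity. -/
theorem fderiv_avg_eq_zero [FiniteDimensional ℝ E] {f : E → ℝ} (hf : ContDiff ℝ 1 f) {u : E} (hu : ∀ x, f (x + u) = f x)
    (x : E) : fderiv ℝ (avg u f) x u = 0 := by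
  rw [fderiv_avg hf]
  have h : ∀ s ∈ Set.uIcc (0 : ℝ) 1,
      HasDerivAt (fun s : ℝ => f (x + s • u)) (fderiv ℝ f (x + s • u) u) s := by
    intro s _
    have h1 : HasFDerivAt f (fderiv ℝ f (x + s • u)) (x + s • u) :=
      (hf.differentiable (by simp) _).hasFDerivAt
    have h2 : HasDerivAt (fun s : ℝ => x + s • u) u s := by
      simpa using ((hasDerivAt_id s).smul_const u).const_add x
    exact h1.comp_hasDerivAt s h2
  have hd : Continuous fun y => fderiv ℝ f y u :=
    (hf.continuous_fderiv (by simp)).clm_apply continuous_const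
  rw [avg, intervalIntegral.integral_eq_sub_of_hasDerivAt h (intervalIntegrable_segment hd u x)]
  simp [hu]

theorem add_smul_eq_of_fderiv_eq_zero {f : E → ℝ} (hf : ContDiff ℝ 1 f) {u : E}
    (h : ∀ x, fderiv ℝ f x u = 0) (x : E) (s : ℝ) : f (x + s • u) = f x := by
  have h1 : ∀ s : ℝ, HasDerivAt (fun s : ℝ => f (x + s • u)) 0 s := by
    intro s
    have h1 : HasFDerivAt f (fderiv ℝ f (x + s • u)) (x + s • u) :=
      (hf.differentiable (by simp) _).hasFDerivAt
    have h2 : HasDerivAt (fun s : ℝ => x + s • u) u s := by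
      simpa using ((hasDerivAt_id s).smul_const u).const_add x
    have h3 := h1.comp_hasDerivAt s h2
    rwa [h] at h3
  have := is_const_of_deriv_eq_zero (fun s => (h1 s).differentiableAt) (fun s => (h1 s).deriv) s 0
  simpa using this

/-- Successive averages along the vectors of a list. -/
def avgs : List E → (E → ℝ) → E → ℝ
  | [], f => f
  | u :: l, f => avgs l (avg u f)

theorem continuous_avgs {f : E → ℝ} (l : List E) (hf : Continuous f) : Continuous (avgs l f) := by
  induction l generalizing f with
  | nil => exact hf
  | cons u l ih => exact ih (continuous_avg hf u)

theorem contDiff_avgs [FiniteDimensional ℝ E] {f : E → ℝ} (l : List E) (hf : ContDiff ℝ 1 f) :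
    ContDiff ℝ 1 (avgs l f) := by
  induction l generalizing f with
  | nil => exact hf
  | cons u l ih => exact ih (contDiff_avg hf u)

theorem avgs_add {f g : E → ℝ} (l : List E) (hf : Continuous f) (hg : Continuous g) :
    avgs l (fun x => f x + g x) = fun x => avgs l f x + avgs l g x := by
  induction l generalizing f g with
  | nil => rfl
  | cons u l ih =>
    simp only [avgs]
    rw [avg_add hf hg, ih (continuous_avg hf u) (continuous_avg hg u)]

theorem avgs_mul {c : E → ℝ} (l : List E) (hc : ∀ u ∈ l, ∀ x (s : ℝ), c (x + s • u) = c x)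
    (f : E → ℝ) : avgs l (fun x => c x * f x) = fun x => c x * avgs l f x := by
  induction l generalizing f with
  | nil => rfl
  | cons u l ih =>
    simp only [avgs]
    rw [avg_mul (hc u List.mem_cons_self), ih fun w hw => hc w (List.mem_cons_of_mem u hw)]

theorem avgs_const_mul (c : ℝ) (l : List E) (f : E → ℝ) :
    avgs l (fun x => c * f x) = fun x => c * avgs l f x :=
  avgs_mul (c := fun _ => c) l (fun _ _ _ _ => rfl) f

theorem avgs_zero (l : List E) : avgs l (fun _ => 0) = fun _ => 0 := by
  simpa using avgs_const_mul 0 l fun _ => 0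

theorem avgs_sum {ι : Type*} (s : Finset ι) {f : ι → E → ℝ} (l : List E)
    (hf : ∀ i, Continuous (f i)) :
    avgs l (fun x => ∑ i ∈ s, f i x) = fun x => ∑ i ∈ s, avgs l (f i) x := by
  classical
  induction s using Finset.induction_on with
  | empty => simpa using avgs_zero l
  | insert a s ha ih =>
    simp only [Finset.sum_insert ha]
    rw [avgs_add l (hf a) (continuous_finsetSum s fun i _ => hf i), ih]

theorem avgs_pos {f : E → ℝ} (l : List E) (hf : Continuous f) (h : ∀ x, 0 < f x) (x : E) :
    0 < avgs l f x := by
  induction l generalizing f with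
  | nil => exact h x
  | cons u l ih => exact ih (continuous_avg hf u) (avg_pos hf h u)

theorem fderiv_avgs [FiniteDimensional ℝ E] {f : E → ℝ} (l : List E) (hf : ContDiff ℝ 1 f) (x v : E) :
    fderiv ℝ (avgs l f) x v = avgs l (fun y => fderiv ℝ f y v) x := by
  induction l generalizing f with
  | nil => rfl
  | cons u l ih =>
    simp only [avgs]
    rw [ih (contDiff_avg hf u)]
    congr 1
    exact funext fun y => fderiv_avg hf u y v

theorem fderiv_avgs_eq_zero_of_eq_zero [FiniteDimensional ℝ E] {f : E → ℝ} (l : List E) (hf : ContDiff ℝ 1 f) {v : E}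
    (h : ∀ x, fderiv ℝ f x v = 0) (x : E) : fderiv ℝ (avgs l f) x v = 0 := by
  rw [fderiv_avgs l hf]
  simp only [h, avgs_zero]

theorem avgs_comp {f : E → ℝ} (l : List E) {T : E → E}
    (hT : ∀ u ∈ l, ∀ x (s : ℝ), T (x + s • u) = T x + s • u)
    (hf : ∀ x, f (T x) = f x) (x : E) : avgs l f (T x) = avgs l f x := by
  induction l generalizing f with
  | nil => exact hf x
  | cons u l ih =>
    exact ih (fun w hw => hT w (List.mem_cons_of_mem u hw)) (avg_comp (hT u List.mem_cons_self) hf)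

/-- The average of a function periodic along the vectors of a list is constant along them. -/
theorem fderiv_avgs_eq_zero [FiniteDimensional ℝ E] {f : E → ℝ} (l : List E) (hf : ContDiff ℝ 1 f)
    (h : ∀ u ∈ l, ∀ x, f (x + u) = f x) {u : E} (hu : u ∈ l) (x : E) :
    fderiv ℝ (avgs l f) x u = 0 := by
  induction l generalizing f with
  | nil => exact absurd hu List.not_mem_nil
  | cons w l ih =>
    have hw := h w List.mem_cons_self
    rcases List.mem_cons.1 hu with rfl | hu
    · exact fderiv_avgs_eq_zero_of_eq_zero l (contDiff_avg hf u) (fderiv_avg_eq_zero hf hw) x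
    · refine ih (contDiff_avg hf w) (fun v hv => ?_) hu
      exact avg_comp (fun x s => by abel) (h v (List.mem_cons_of_mem w hv))

/-- `D k` contains the points reachable after `k` segments. A bound on the set reached after all the
averages passes to the iterated mean. -/
theorem abs_avgs_le {f : E → ℝ} {C : ℝ} (D : ℕ → Set E) (l : List E)
    (hD : ∀ k, ∀ x ∈ D k, ∀ u ∈ l, ∀ s ∈ Set.Icc (0 : ℝ) 1, x + s • u ∈ D (k + 1)) (k : ℕ)
    (hf : ∀ x ∈ D (k + l.length), |f x| ≤ C) (x : E) (hx : x ∈ D k) : |avgs l f x| ≤ C := by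
  induction l generalizing f with
  | nil => exact hf x hx
  | cons u l ih =>
    refine ih (fun k x hx w hw => hD k x hx w (List.mem_cons_of_mem u hw)) fun y hy => ?_
    refine abs_avg_le fun s hs => hf _ ?_
    exact hD _ y hy u List.mem_cons_self s hs

end Averages

end

noncomputable section

/-! ### Invariant forms on the universal cover of the exceptional divisor -/

section YFrame

/-- The vectors of the standard basis of `ℂ⁴`. -/
def eC (k : Fin 4) : Cn 4 := Pi.single k 1

/-- The form defining the group structure on the universal cover of `Y`. -/
def yForm (w z : Cn 4) : ℂ := conj (w 0) * z 0 + 2 * conj (w 1) * z 1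

/-- Left translations of the universal cover of `Y × ℂ`. -/
def yMul (γ x : Cn 4) : Cn 4 := x + (γ + yForm γ x • eC 2)

/-- Left invariant vector fields. -/
def yFrame (v x : Cn 4) : Cn 4 := v + yForm x v • eC 2

theorem yForm_add_left (a b z : Cn 4) : yForm (a + b) z = yForm a z + yForm b z := by
  simp only [yForm, Pi.add_apply, map_add]
  ring

theorem yForm_add_right (w a b : Cn 4) : yForm w (a + b) = yForm w a + yForm w b := by
  simp only [yForm, Pi.add_apply]
  ring

theorem yForm_smul_right (w : Cn 4) (c : ℂ) (a : Cn 4) : yForm w (c • a) = c * yForm w a := by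
  simp only [yForm, Pi.smul_apply, smul_eq_mul]
  ring

theorem yForm_smul_left (c : ℂ) (w a : Cn 4) : yForm (c • w) a = conj c * yForm w a := by
  simp only [yForm, Pi.smul_apply, smul_eq_mul, map_mul]
  ring

@[simp] theorem yForm_two_right (w : Cn 4) : yForm w (eC 2) = 0 := by
  simp [yForm, eC]

@[simp] theorem yForm_two_left (w : Cn 4) : yForm (eC 2) w = 0 := by
  simp [yForm, eC]

@[simp] theorem yForm_three_right (w : Cn 4) : yForm w (eC 3) = 0 := by
  simp [yForm, eC]

@[simp] theorem yForm_three_left (w : Cn 4) : yForm (eC 3) w = 0 := by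
  simp [yForm, eC]

theorem yForm_yFrame_left (x v w : Cn 4) : yForm (yFrame v x) w = yForm v w := by
  rw [yFrame, yForm_add_left, yForm_smul_left, yForm_two_left, mul_zero, add_zero]

theorem yForm_yFrame_right (x v w : Cn 4) : yForm w (yFrame v x) = yForm w v := by
  rw [yFrame, yForm_add_right, yForm_smul_right, yForm_two_right, mul_zero, add_zero]

theorem yForm_yMul_left (γ x v : Cn 4) : yForm (yMul γ x) v = yForm γ v + yForm x v := by
  rw [yMul, yForm_add_left, yForm_add_left, yForm_smul_left, yForm_two_left, mul_zero, add_zero,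
    add_comm]

theorem yFrame_smul (c : ℂ) (v x : Cn 4) : yFrame (c • v) x = c • yFrame v x := by
  rw [yFrame, yFrame, yForm_smul_right, smul_add, smul_smul]

theorem yFrame_smul_two (c : ℂ) (x : Cn 4) : yFrame (c • eC 2) x = c • eC 2 := by
  rw [yFrame, yForm_smul_right, yForm_two_right, mul_zero, zero_smul, add_zero]

/-- `yForm` as a linear map of its first variable. -/
def yFormLeft (v : Cn 4) : Cn 4 →L[ℝ] ℂ :=
  LinearMap.toContinuousLinearMap
    { toFun := fun w => yForm w v
      map_add' := fun a b => yForm_add_left a b v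
      map_smul' := fun r a => by
        simp only [yForm, Pi.smul_apply, Complex.real_smul, map_mul, Complex.conj_ofReal,
          RingHom.id_apply]
        ring }

theorem yFormLeft_apply (v w : Cn 4) : yFormLeft v w = yForm w v := rfl

theorem hasFDerivAt_yFrame (v x : Cn 4) :
    HasFDerivAt (yFrame v) ((yFormLeft v).smulRight (eC 2)) x := by
  have h := ((yFormLeft v).hasFDerivAt (x := x)).smul_const (eC 2)
  exact h.const_add v

theorem contDiff_yFrame (v : Cn 4) : ContDiff ℝ ∞ (yFrame v) :=
  contDiff_const.add ((yFormLeft v).contDiff.smul contDiff_const)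

/-- The frame varies only in the central direction, on which `yForm` vanishes. Brackets are
therefore central, with the antisymmetrisation of `yForm` as coefficient. -/
theorem lieBracket_yFrame (v w x : Cn 4) :
    VectorField.lieBracket ℝ (yFrame v) (yFrame w) x =
      yFrame ((yForm v w - yForm w v) • eC 2) x := by
  rw [VectorField.lieBracket, (hasFDerivAt_yFrame w x).fderiv, (hasFDerivAt_yFrame v x).fderiv,
    yFrame_smul_two, sub_smul]
  simp only [ContinuousLinearMap.smulRight_apply, yFormLeft_apply, yForm_yFrame_left]

theorem hasFDerivAt_yMul (γ x : Cn 4) : HasFDerivAt (yMul γ)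
    (ContinuousLinearMap.id ℂ (Cn 4) + (LinearMap.toContinuousLinearMap
      { toFun := fun z => yForm γ z
        map_add' := yForm_add_right γ
        map_smul' := yForm_smul_right γ } : Cn 4 →L[ℂ] ℂ).smulRight (eC 2)) x := by
  have h := ((LinearMap.toContinuousLinearMap
      { toFun := fun z => yForm γ z
        map_add' := yForm_add_right γ
        map_smul' := yForm_smul_right γ } : Cn 4 →L[ℂ] ℂ).hasFDerivAt (x := x)).smul_const (eC 2)
  exact (hasFDerivAt_id x).add (h.const_add γ)

theorem contDiff_yMul (γ : Cn 4) : ContDiff ℂ ω (yMul γ) := by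
  have h := ((LinearMap.toContinuousLinearMap
      { toFun := fun z => yForm γ z
        map_add' := yForm_add_right γ
        map_smul' := yForm_smul_right γ } : Cn 4 →L[ℂ] ℂ).contDiff (n := ω)).smul
          (contDiff_const (c := eC 2))
  exact contDiff_id.add (contDiff_const.add h)

theorem fderiv_yMul_yFrame (γ x v : Cn 4) :
    fderiv ℝ (yMul γ) x (yFrame v x) = yFrame v (yMul γ x) := by
  rw [(hasFDerivAt_yMul γ x).differentiableAt.fderiv_restrictScalars ℝ,
    (hasFDerivAt_yMul γ x).fderiv]
  change yFrame v x + yForm γ (yFrame v x) • eC 2 = _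
  rw [yForm_yFrame_right, yFrame, yFrame, yForm_yMul_left, add_smul]
  abel

/-- The evaluation of a form on left invariant vector fields. -/
def frameEval {k : ℕ} (α : Cn 4 → Cn 4 [⋀^Fin k]→L[ℝ] ℝ) (v : Fin k → Cn 4) (x : Cn 4) : ℝ :=
  α x fun i => yFrame (v i) x

theorem contDiff_frameEval {k : ℕ} {α : Cn 4 → Cn 4 [⋀^Fin k]→L[ℝ] ℝ}
    (hα : ContDiff ℝ ∞ α) (v : Fin k → Cn 4) : ContDiff ℝ ∞ (frameEval α v) :=
  contDiff_iff_contDiffAt.2 fun _ => hα.contDiffAt.form_apply fun i =>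
    (contDiff_yFrame (v i)).contDiffAt

theorem frameEval_zero_of_apply {k : ℕ} (α : Cn 4 → Cn 4 [⋀^Fin k]→L[ℝ] ℝ) {v : Fin k → Cn 4}
    {i : Fin k} (h : v i = 0) (x : Cn 4) : frameEval α v x = 0 :=
  (α x).map_coord_zero i (by simp [h, yFrame, yForm])

theorem frameEval_smul {k : ℕ} (α : Cn 4 → Cn 4 [⋀^Fin (k + 1)]→L[ℝ] ℝ) (c : ℝ) (a : Cn 4)
    (v : Fin k → Cn 4) (x : Cn 4) :
    frameEval α (Matrix.vecCons ((c : ℂ) • a) v) x = c * frameEval α (Matrix.vecCons a v) x := by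
  have h := (α x).toMultilinearMap.map_update_smul (fun i => yFrame (Matrix.vecCons a v i) x) 0 c
    (yFrame a x)
  have h1 : ∀ b, Function.update (fun i => yFrame (Matrix.vecCons a v i) x) 0 (yFrame b x) =
      fun i => yFrame (Matrix.vecCons b v i) x := by
    intro b
    funext i
    refine Fin.cases ?_ (fun i => ?_) i <;> simp
  have h2 : c • yFrame a x = yFrame ((c : ℂ) • a) x := by
    rw [yFrame_smul]
    rfl
  rw [h2, h1, h1] at h
  exact h

/-- Cartan's formula for the exterior derivative on left invariant vector fields. -/
theorem frameEval_extDeriv {k : ℕ} {α : Cn 4 → Cn 4 [⋀^Fin (k + 1)]→L[ℝ] ℝ}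
    (hα : ContDiff ℝ ∞ α) (v : Fin (k + 2) → Cn 4) (x : Cn 4) :
    frameEval (extDeriv α) v x =
      (∑ i, (-1) ^ i.val * fderiv ℝ (frameEval α (i.removeNth v)) x (yFrame (v i) x)) -
        ∑ i : Fin (k + 1), ∑ j ≥ i, (-1) ^ (i + j : ℕ) *
          frameEval α (Matrix.vecCons
            ((yForm (v i.castSucc) (v j.succ) - yForm (v j.succ) (v i.castSucc)) • eC 2)
            (j.removeNth (i.castSucc.removeNth v))) x := by
  have h := extDeriv_apply_vectorField (V := fun i => yFrame (v i)) (x := x)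
    (hα.contDiffAt.differentiableAt (by simp))
    fun i => (hasFDerivAt_yFrame (v i) x).differentiableAt
  refine h.trans ?_
  simp only [zsmul_eq_mul, Int.cast_pow, Int.cast_neg, Int.cast_one, lieBracket_yFrame]
  congr 1
  refine Finset.sum_congr rfl fun i _ => Finset.sum_congr rfl fun j _ => ?_
  congr 2
  funext l
  refine Fin.cases ?_ (fun l => ?_) l <;> rfl

/-! ### Means of lattice invariant functions -/

/-- The periods of invariant functions. -/
def yLattice : Set (Cn 4) := {γ | (∀ i, i ≠ 3 → γ i ∈ gaussZ) ∧ Complex.exp (γ 3) = 1}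

/-- Invariance of functions under the lattice. -/
def IsYInvariant (f : Cn 4 → ℝ) : Prop := ∀ γ ∈ yLattice, ∀ x, f (yMul γ x) = f x

theorem isYInvariant_frameEval {k : ℕ} {α : Cn 4 → Cn 4 [⋀^Fin k]→L[ℝ] ℝ}
    (hα : ∀ γ ∈ yLattice, pullForm (yMul γ) α = α) (v : Fin k → Cn 4) :
    IsYInvariant (frameEval α v) := by
  intro γ hγ x
  have h := congrFun (hα γ hγ) x
  unfold frameEval
  rw [← h, pullForm, ContinuousAlternatingMap.compContinuousLinearMap_apply]
  congr 1
  funext i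
  exact (fderiv_yMul_yFrame γ x (v i)).symm

/-- The directions of the centre. -/
def vertList : List (Cn 4) := [eC 2, Complex.I • eC 2]

/-- The other directions of the lattice. -/
def horList : List (Cn 4) := [eC 0, Complex.I • eC 0, eC 1, Complex.I • eC 1,
  (2 * Real.pi * Complex.I) • eC 3]

/-- The mean of an invariant function. -/
def yMean (f : Cn 4 → ℝ) : Cn 4 → ℝ := avgs horList (avgs vertList f)

theorem mem_yLattice_of_mem {u : Cn 4} (hu : u ∈ vertList ∨ u ∈ horList) : u ∈ yLattice := by
  have key : ∀ (k : Fin 4) (c : ℂ), k ≠ 3 → c ∈ gaussZ → c • eC k ∈ yLattice := by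
    intro k c hk hc
    refine ⟨fun i _ => ?_, ?_⟩
    · by_cases hik : i = k
      · subst hik
        simpa [eC] using hc
      · simp [eC, hik]
    · simp [eC, hk.symm]
  have h1 : ∀ k : Fin 4, k ≠ 3 → eC k ∈ yLattice := fun k hk => by
    simpa using key k 1 hk gaussZ.one_mem
  simp only [vertList, horList, List.mem_cons, List.not_mem_nil, or_false] at hu
  rcases hu with (rfl | rfl) | (rfl | rfl | rfl | rfl | rfl)
  · exact h1 2 (by decide)
  · exact key 2 _ (by decide) I_mem_gaussZ
  · exact h1 0 (by decide)
  · exact key 0 _ (by decide) I_mem_gaussZ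
  · exact h1 1 (by decide)
  · exact key 1 _ (by decide) I_mem_gaussZ
  · refine ⟨fun i hi => ?_, ?_⟩
    · simp [eC, hi]
    · simp [eC, Complex.exp_two_pi_mul_I]

theorem yForm_vert {u : Cn 4} (hu : u ∈ vertList) (x : Cn 4) : yForm u x = 0 ∧ yForm x u = 0 := by
  simp only [vertList, List.mem_cons, List.not_mem_nil, or_false] at hu
  rcases hu with rfl | rfl <;> simp [yForm_smul_left, yForm_smul_right]

theorem yMul_vert {u : Cn 4} (hu : u ∈ vertList) (x : Cn 4) : yMul u x = x + u := by
  rw [yMul, (yForm_vert hu x).1, zero_smul, add_zero]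

theorem real_smul_eq (r : ℝ) (x : Cn 4) : r • x = (r : ℂ) • x := rfl

theorem yMul_add_vert {u : Cn 4} (hu : u ∈ vertList) (γ x : Cn 4) (s : ℝ) :
    yMul γ (x + s • u) = yMul γ x + s • u := by
  rw [yMul, yMul, yForm_add_right, real_smul_eq, yForm_smul_right, (yForm_vert hu γ).2, mul_zero,
    add_zero]
  abel

variable {f : Cn 4 → ℝ}

/-- Central left translations are ordinary translations, so an invariant function is honestly
periodic in these directions. -/
theorem fderiv_avgs_vert (hf : ContDiff ℝ 1 f) (hi : IsYInvariant f) {u : Cn 4}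
    (hu : u ∈ vertList) (x : Cn 4) : fderiv ℝ (avgs vertList f) x u = 0 :=
  fderiv_avgs_eq_zero vertList hf (fun w hw x => by
    rw [← yMul_vert hw, hi w (mem_yLattice_of_mem (Or.inl hw))]) hu x

theorem smul_eC_eq (c : ℂ) (k : Fin 4) : c • eC k = c.re • eC k + c.im • Complex.I • eC k := by
  rw [real_smul_eq, real_smul_eq, smul_smul, ← add_smul, Complex.re_add_im]

theorem fderiv_smul_eC (x : Cn 4) (c : ℂ) (k : Fin 4) (g : Cn 4 → ℝ) : fderiv ℝ g x (c • eC k) =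
    c.re * fderiv ℝ g x (eC k) + c.im * fderiv ℝ g x (Complex.I • eC k) := by
  rw [smul_eC_eq, map_add, map_smul, map_smul]
  rfl

theorem avgs_vert_add_smul (hf : ContDiff ℝ 1 f) (hi : IsYInvariant f) (x : Cn 4) (c : ℂ) :
    avgs vertList f (x + c • eC 2) = avgs vertList f x := by
  have h1 := fun y s => add_smul_eq_of_fderiv_eq_zero (contDiff_avgs vertList hf)
    (fun x => fderiv_avgs_vert hf hi (u := eC 2) (by simp [vertList]) x) y s
  have h2 := fun y s => add_smul_eq_of_fderiv_eq_zero (contDiff_avgs vertList hf)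
    (fun x => fderiv_avgs_vert hf hi (u := Complex.I • eC 2) (by simp [vertList]) x) y s
  rw [smul_eC_eq, ← add_assoc, h2, h1]

/-- A left translation differs from x ↦ x + γ by a central vector, along which the central mean is
constant. This is why the centre is averaged first: afterwards the remaining lattice directions act
by plain translations. -/
theorem avgs_vert_periodic (hf : ContDiff ℝ 1 f) (hi : IsYInvariant f) {γ : Cn 4}
    (hγ : γ ∈ yLattice) (x : Cn 4) : avgs vertList f (x + γ) = avgs vertList f x := by
  have h : avgs vertList f (yMul γ x) = avgs vertList f x :=
    avgs_comp vertList (fun u hu y s => yMul_add_vert hu γ y s) (hi γ hγ) x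
  rw [yMul, ← add_assoc, avgs_vert_add_smul hf hi] at h
  exact h

theorem contDiff_yMean (hf : ContDiff ℝ 1 f) : ContDiff ℝ 1 (yMean f) :=
  contDiff_avgs _ (contDiff_avgs _ hf)

/-- The mean of an invariant function depends on the real part of the last coordinate only. -/
theorem fderiv_yMean_eq_zero (hf : ContDiff ℝ 1 f) (hi : IsYInvariant f) {v : Cn 4}
    (hv : (v 3).re = 0) (x : Cn 4) : fderiv ℝ (yMean f) x v = 0 := by
  have h1 : ∀ u ∈ horList, fderiv ℝ (yMean f) x u = 0 := fun u hu =>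
    fderiv_avgs_eq_zero horList (contDiff_avgs _ hf)
      (fun w hw y => avgs_vert_periodic hf hi (mem_yLattice_of_mem (Or.inr hw)) y) hu x
  have h2 : ∀ u ∈ vertList, fderiv ℝ (yMean f) x u = 0 := fun u hu =>
    fderiv_avgs_eq_zero_of_eq_zero horList (contDiff_avgs _ hf) (fderiv_avgs_vert hf hi hu) x
  -- The lattice period is 2πi e₃; the factor 2π is divided out.
  have h3 : fderiv ℝ (yMean f) x (Complex.I • eC 3) = 0 := by
    have h := h1 _ (show (2 * Real.pi * Complex.I) • eC 3 ∈ horList by simp [horList])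
    rw [mul_smul, show (2 * Real.pi : ℂ) = ((2 * Real.pi : ℝ) : ℂ) by push_cast; rfl,
      ← real_smul_eq, map_smul, smul_eq_mul] at h
    exact (mul_eq_zero.1 h).resolve_left (by positivity)
  have hv' : v = v 0 • eC 0 + v 1 • eC 1 + v 2 • eC 2 + v 3 • eC 3 := by
    ext i
    fin_cases i <;> simp [eC]
  rw [hv', map_add, map_add, map_add, fderiv_smul_eC x (v 0), fderiv_smul_eC x (v 1),
    fderiv_smul_eC x (v 2), fderiv_smul_eC x (v 3), hv, h3, h1 (eC 0) (by simp [horList]),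
    h1 (Complex.I • eC 0) (by simp [horList]), h1 (eC 1) (by simp [horList]),
    h1 (Complex.I • eC 1) (by simp [horList]), h2 (eC 2) (by simp [vertList]),
    h2 (Complex.I • eC 2) (by simp [vertList])]
  ring

theorem continuous_yForm_left (v : Cn 4) : Continuous fun x => yForm x v :=
  (yFormLeft v).continuous

/-- The mean of the derivative of an invariant function along a left invariant vector field. -/
theorem yMean_fderiv_yFrame (hf : ContDiff ℝ 1 f) (hi : IsYInvariant f) (v : Cn 4) :
    yMean (fun x => fderiv ℝ f x (yFrame v x)) = fun x => fderiv ℝ (yMean f) x v := by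
  have hd : ∀ w : Cn 4, Continuous fun x => fderiv ℝ f x w := fun w =>
    (hf.continuous_fderiv (by simp)).clm_apply continuous_const
  have hc : ∀ u ∈ vertList, ∀ x (s : ℝ), yForm (x + s • u) v = yForm x v := by
    intro u hu x s
    rw [yForm_add_left, real_smul_eq, yForm_smul_left, (yForm_vert hu v).1, mul_zero, add_zero]
  have hre : Continuous fun x => (yForm x v).re := Complex.continuous_re.comp (continuous_yForm_left v)
  have him : Continuous fun x => (yForm x v).im := Complex.continuous_im.comp (continuous_yForm_left v)
  -- The central component of the frame field has coefficients that are constant along the centre.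
  -- They come out of the central mean, which kills the central derivatives.
  have h1 : avgs vertList (fun x => fderiv ℝ f x (yFrame v x)) =
      fun x => fderiv ℝ (avgs vertList f) x v := by
    have e : (fun x => fderiv ℝ f x (yFrame v x)) = fun x => fderiv ℝ f x v +
        ((yForm x v).re * fderiv ℝ f x (eC 2) + (yForm x v).im * fderiv ℝ f x (Complex.I • eC 2)) := by
      funext x
      rw [yFrame, map_add, fderiv_smul_eC]
    have c1 : Continuous fun x => (yForm x v).re * fderiv ℝ f x (eC 2) := hre.mul (hd _)
    have c2 : Continuous fun x => (yForm x v).im * fderiv ℝ f x (Complex.I • eC 2) := him.mul (hd _)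
    have c3 : Continuous fun x => (yForm x v).re * fderiv ℝ f x (eC 2) +
      (yForm x v).im * fderiv ℝ f x (Complex.I • eC 2) := c1.add c2
    rw [e, avgs_add _ (hd v) c3, avgs_add _ c1 c2,
      avgs_mul (c := fun x => (yForm x v).re) _ (fun u hu x s => by rw [hc u hu]),
      avgs_mul (c := fun x => (yForm x v).im) _ (fun u hu x s => by rw [hc u hu])]
    funext x
    beta_reduce
    rw [← fderiv_avgs vertList hf, ← fderiv_avgs vertList hf, ← fderiv_avgs vertList hf,
      fderiv_avgs_vert hf hi (u := eC 2) (by simp [vertList]),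
      fderiv_avgs_vert hf hi (u := Complex.I • eC 2) (by simp [vertList])]
    ring
  rw [yMean, h1]
  funext x
  exact (fderiv_avgs horList (contDiff_avgs vertList hf) x v).symm

theorem yMean_const_mul (c : ℝ) (f : Cn 4 → ℝ) : yMean (fun x => c * f x) = fun x => c * yMean f x := by
  rw [yMean, avgs_const_mul, avgs_const_mul]
  rfl

theorem yMean_add {f g : Cn 4 → ℝ} (hf : Continuous f) (hg : Continuous g) :
    yMean (fun x => f x + g x) = fun x => yMean f x + yMean g x := by
  rw [yMean, avgs_add _ hf hg, avgs_add _ (continuous_avgs _ hf) (continuous_avgs _ hg)]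
  rfl

theorem yMean_sum {ι : Type*} (s : Finset ι) {f : ι → Cn 4 → ℝ} (hf : ∀ i, Continuous (f i)) :
    yMean (fun x => ∑ i ∈ s, f i x) = fun x => ∑ i ∈ s, yMean (f i) x := by
  rw [yMean, avgs_sum _ _ hf, avgs_sum _ _ fun i => continuous_avgs _ (hf i)]
  rfl

/-- The mean of Cartan's formula. -/
theorem yMean_frameEval_extDeriv {k : ℕ} {α : Cn 4 → Cn 4 [⋀^Fin (k + 1)]→L[ℝ] ℝ}
    (hα : ContDiff ℝ ∞ α) (hi : ∀ γ ∈ yLattice, pullForm (yMul γ) α = α)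
    (v : Fin (k + 2) → Cn 4) (x : Cn 4) :
    yMean (frameEval (extDeriv α) v) x =
      (∑ i, (-1) ^ i.val * fderiv ℝ (yMean (frameEval α (i.removeNth v))) x (v i)) -
        ∑ i : Fin (k + 1), ∑ j ≥ i, (-1) ^ (i + j : ℕ) *
          yMean (frameEval α (Matrix.vecCons
            ((yForm (v i.castSucc) (v j.succ) - yForm (v j.succ) (v i.castSucc)) • eC 2)
            (j.removeNth (i.castSucc.removeNth v)))) x := by
  have hc : ∀ w, ContDiff ℝ 1 (frameEval α w) := fun w =>
    (contDiff_frameEval hα w).of_le (by simp)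
  have hd : ∀ w (a : Cn 4), Continuous fun x => fderiv ℝ (frameEval α w) x (yFrame a x) :=
    fun w a => ((hc w).continuous_fderiv (by simp)).clm_apply (contDiff_yFrame a).continuous
  have e : frameEval (extDeriv α) v = fun x =>
      (∑ i, (-1) ^ i.val * fderiv ℝ (frameEval α (i.removeNth v)) x (yFrame (v i) x)) +
        ∑ i : Fin (k + 1), ∑ j ≥ i, -(-1) ^ (i + j : ℕ) *
          frameEval α (Matrix.vecCons
            ((yForm (v i.castSucc) (v j.succ) - yForm (v j.succ) (v i.castSucc)) • eC 2)
            (j.removeNth (i.castSucc.removeNth v))) x := by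
    funext x
    rw [frameEval_extDeriv hα, sub_eq_add_neg]
    simp only [Finset.sum_neg_distrib, neg_mul]
  rw [e, yMean_add, yMean_sum, yMean_sum]
  · simp only [yMean_const_mul, yMean_fderiv_yFrame (hc _) (isYInvariant_frameEval hi _)]
    rw [sub_eq_add_neg, ← Finset.sum_neg_distrib]
    congr 1
    refine Finset.sum_congr rfl fun i _ => ?_
    rw [yMean_sum, ← Finset.sum_neg_distrib]
    · refine Finset.sum_congr rfl fun j _ => ?_
      rw [yMean_const_mul]
      beta_reduce
      rw [neg_mul]
    · exact fun j => continuous_const.mul (hc _).continuous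
  · exact fun i => continuous_finsetSum _ fun j _ => continuous_const.mul (hc _).continuous
  · exact fun i => continuous_const.mul (hd _ _)
  · exact continuous_finsetSum _ fun i _ => continuous_const.mul (hd _ _)
  · exact continuous_finsetSum _ fun i _ => continuous_finsetSum _ fun j _ =>
      continuous_const.mul (hc _).continuous

end YFrame

end

noncomputable section

/-! ### The mean of the `d dᶜ`-equation on the exceptional divisor -/

section MeanEquation

theorem yMean_frameEval_eq_zero {k : ℕ} (α : Cn 4 → Cn 4 [⋀^Fin k]→L[ℝ] ℝ) {v : Fin k → Cn 4}
    {i : Fin k} (h : v i = 0) (x : Cn 4) : yMean (frameEval α v) x = 0 := by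
  have h1 : frameEval α v = fun _ => 0 := funext fun y => frameEval_zero_of_apply α h y
  rw [h1, yMean, avgs_zero, avgs_zero]

theorem yMean_frameEval_smul {k : ℕ} (α : Cn 4 → Cn 4 [⋀^Fin (k + 1)]→L[ℝ] ℝ) (c : ℝ) (a : Cn 4)
    (v : Fin k → Cn 4) (x : Cn 4) : yMean (frameEval α (Matrix.vecCons ((c : ℂ) • a) v)) x =
      c * yMean (frameEval α (Matrix.vecCons a v)) x := by
  have h1 : frameEval α (Matrix.vecCons ((c : ℂ) • a) v) =
      fun x => c * frameEval α (Matrix.vecCons a v) x := funext fun y => frameEval_smul α c a v y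
  rw [h1, yMean_const_mul]

theorem yForm_basis (a b : Fin 4) : yForm (eC a) (eC b) =
    if a = b then (if a = 0 then 1 else if a = 1 then 2 else 0) else 0 := by
  fin_cases a <;> fin_cases b <;> simp [yForm, eC]

/-- The mean of the derivative of an invariant five-form. -/
theorem yMean_extDeriv_five {Ψ : Cn 4 → Cn 4 [⋀^Fin 5]→L[ℝ] ℝ} (hΨ : ContDiff ℝ ∞ Ψ)
    (hi : ∀ γ ∈ yLattice, pullForm (yMul γ) Ψ = Ψ) (x : Cn 4) :
    yMean (frameEval (extDeriv Ψ)
      ![eC 0, Complex.I • eC 0, eC 1, Complex.I • eC 1, eC 3, Complex.I • eC 3]) x =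
    fderiv ℝ (yMean (frameEval Ψ
      ![eC 0, Complex.I • eC 0, eC 1, Complex.I • eC 1, Complex.I • eC 3])) x (eC 3) -
    2 * yMean (frameEval Ψ
      ![Complex.I • eC 2, eC 1, Complex.I • eC 1, eC 3, Complex.I • eC 3]) x -
    4 * yMean (frameEval Ψ
      ![Complex.I • eC 2, eC 0, Complex.I • eC 0, eC 3, Complex.I • eC 3]) x := by
  have hc : ∀ w, ContDiff ℝ 1 (frameEval Ψ w) := fun w =>
    (contDiff_frameEval hΨ w).of_le (by simp)
  have hz : ∀ w v, (v 3).re = 0 → fderiv ℝ (yMean (frameEval Ψ w)) x v = 0 := fun w v hv =>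
    fderiv_yMean_eq_zero (hc w) (isYInvariant_frameEval hi w) hv x
  have hb0 : ∀ w, yMean (frameEval Ψ (Matrix.vecCons 0 w)) x = 0 := fun w =>
    yMean_frameEval_eq_zero Ψ (i := 0) rfl x
  set v : Fin 6 → Cn 4 :=
    ![eC 0, Complex.I • eC 0, eC 1, Complex.I • eC 1, eC 3, Complex.I • eC 3] with hv
  rw [yMean_frameEval_extDeriv hΨ hi]
  -- The only nonzero brackets are those of e_k with ie_k for k = 0, 1; such pairs are adjacent in
  -- `v`, that is i = j in the double sum.
  have h1 : ∀ i j : Fin 5, i ≤ j → j ≠ i →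
      yForm (v i.castSucc) (v j.succ) - yForm (v j.succ) (v i.castSucc) = 0 := by
    intro i j hij hne
    fin_cases i <;> fin_cases j <;> first
      | exact absurd rfl hne
      | exact absurd hij (by decide)
      | simp [v, yForm_smul_left, yForm_smul_right, yForm_basis]
  have h2 : ∀ i : Fin 5, (∑ j ≥ i, (-1) ^ (i + j : ℕ) * yMean (frameEval Ψ (Matrix.vecCons
      ((yForm (v i.castSucc) (v j.succ) - yForm (v j.succ) (v i.castSucc)) • eC 2)
      (j.removeNth (i.castSucc.removeNth v)))) x) = yMean (frameEval Ψ (Matrix.vecCons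
      ((yForm (v i.castSucc) (v i.succ) - yForm (v i.succ) (v i.castSucc)) • eC 2)
      (i.removeNth (i.castSucc.removeNth v)))) x := by
    intro i
    rw [Finset.sum_eq_single_of_mem i (by simp)]
    · rw [← two_mul, pow_mul]
      simp
    · intro j hj hne
      rw [h1 i j (Finset.mem_Ici.1 hj) hne, zero_smul, hb0, mul_zero]
  have h3 : ∀ i : Fin 6, i ≠ 4 → (v i 3).re = 0 := by
    intro i hi
    fin_cases i <;> first | exact absurd rfl hi | simp [v, eC]
  -- Means depend only on the real part of the last coordinate, so only the derivative along e₃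
  -- survives.
  rw [Finset.sum_eq_single_of_mem (4 : Fin 6) (Finset.mem_univ _)
    fun i _ hne => by rw [hz _ _ (h3 i hne), mul_zero]]
  simp only [h2]
  rw [show ∀ f : Fin (4 + 1) → ℝ, ∑ i, f i = f 0 + f 1 + f 2 + f 3 + f 4 from
    fun f => Fin.sum_univ_five f]
  have e : Fin.removeNth 4 v =
      ![eC 0, Complex.I • eC 0, eC 1, Complex.I • eC 1, Complex.I • eC 3] := by
    funext i
    fin_cases i <;> rfl
  have e0 : (0 : Fin 5).removeNth ((0 : Fin 5).castSucc.removeNth v) =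
      ![eC 1, Complex.I • eC 1, eC 3, Complex.I • eC 3] := by
    funext i
    fin_cases i <;> rfl
  have e2 : (2 : Fin 5).removeNth ((2 : Fin 5).castSucc.removeNth v) =
      ![eC 0, Complex.I • eC 0, eC 3, Complex.I • eC 3] := by
    funext i
    fin_cases i <;> rfl
  -- [e₀, ie₀] = 2i e₂ and, below, [e₁, ie₁] = 4i e₂; these produce the factors 2 and 4 of the
  -- statement.
  have c0 : yForm (v (0 : Fin 5).castSucc) (v (0 : Fin 5).succ) -
      yForm (v (0 : Fin 5).succ) (v (0 : Fin 5).castSucc) = ((2 : ℝ) : ℂ) * Complex.I := by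
    simp [v, yForm_smul_left, yForm_smul_right, yForm_basis]
    ring
  have c1 : yForm (v (1 : Fin 5).castSucc) (v (1 : Fin 5).succ) -
      yForm (v (1 : Fin 5).succ) (v (1 : Fin 5).castSucc) = 0 := by
    simp [v, yForm_smul_left, yForm_smul_right, yForm_basis]
  have c2 : yForm (v (2 : Fin 5).castSucc) (v (2 : Fin 5).succ) -
      yForm (v (2 : Fin 5).succ) (v (2 : Fin 5).castSucc) = ((4 : ℝ) : ℂ) * Complex.I := by
    simp [v, yForm_smul_left, yForm_smul_right, yForm_basis]
    ring
  have c3 : yForm (v (3 : Fin 5).castSucc) (v (3 : Fin 5).succ) -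
      yForm (v (3 : Fin 5).succ) (v (3 : Fin 5).castSucc) = 0 := by
    simp [v, yForm_smul_right, yForm_basis]
  have c4 : yForm (v (4 : Fin 5).castSucc) (v (4 : Fin 5).succ) -
      yForm (v (4 : Fin 5).succ) (v (4 : Fin 5).castSucc) = 0 := by
    simp [v, yForm_smul_right]
  rw [c0, c1, c2, c3, c4, zero_smul, hb0, hb0, hb0, mul_smul, mul_smul, yMean_frameEval_smul,
    yMean_frameEval_smul, e, e0, e2]
  have e4 : v 4 = eC 3 := rfl
  rw [e4]
  norm_num
  ring

/-- The mean of the derivative of an invariant four-form. -/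
theorem yMean_extDeriv_four {Θ : Cn 4 → Cn 4 [⋀^Fin 4]→L[ℝ] ℝ} (hΘ : ContDiff ℝ ∞ Θ)
    (hi : ∀ γ ∈ yLattice, pullForm (yMul γ) Θ = Θ) {a : Fin 4} {κ : ℝ}
    (ha : a = 0 ∧ κ = 1 ∨ a = 1 ∧ κ = 2) (x : Cn 4) :
    yMean (frameEval (extDeriv Θ)
      ![eC 2, -Complex.I • eC a, eC a, -Complex.I • eC 3, eC 3]) x =
    fderiv ℝ (yMean (frameEval Θ
      ![eC 2, -Complex.I • eC a, eC a, -Complex.I • eC 3])) x (eC 3) -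
    2 * κ * yMean (frameEval Θ
      ![Complex.I • eC 2, eC 2, -Complex.I • eC 3, eC 3]) x := by
  have hc : ∀ w, ContDiff ℝ 1 (frameEval Θ w) := fun w =>
    (contDiff_frameEval hΘ w).of_le (by simp)
  have hz : ∀ w v, (v 3).re = 0 → fderiv ℝ (yMean (frameEval Θ w)) x v = 0 := fun w v hv =>
    fderiv_yMean_eq_zero (hc w) (isYInvariant_frameEval hi w) hv x
  have hb0 : ∀ w, yMean (frameEval Θ (Matrix.vecCons 0 w)) x = 0 := fun w =>
    yMean_frameEval_eq_zero Θ (i := 0) rfl x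
  have ha3 : a ≠ 3 := by
    rcases ha with ⟨rfl, -⟩ | ⟨rfl, -⟩ <;> decide
  have hκ : yForm (eC a) (eC a) = κ := by
    rcases ha with ⟨rfl, rfl⟩ | ⟨rfl, rfl⟩ <;> simp [yForm_basis]
  set v : Fin 5 → Cn 4 := ![eC 2, -Complex.I • eC a, eC a, -Complex.I • eC 3, eC 3] with hv
  rw [yMean_frameEval_extDeriv hΘ hi]
  have h1 : ∀ i j : Fin 4, i ≤ j → ¬ (i = 1 ∧ j = 1) →
      yForm (v i.castSucc) (v j.succ) - yForm (v j.succ) (v i.castSucc) = 0 := by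
    intro i j hij hne
    fin_cases i <;> fin_cases j <;> first
      | exact absurd ⟨rfl, rfl⟩ hne
      | exact absurd hij (by decide)
      | simp [v, yForm_smul_left, yForm_smul_right, -neg_smul]
  have h3 : ∀ i : Fin 5, i ≠ 4 → (v i 3).re = 0 := by
    intro i hi
    fin_cases i <;> first | exact absurd rfl hi | simp [v, eC, ha3.symm]
  rw [Finset.sum_eq_single_of_mem (4 : Fin 5) (Finset.mem_univ _)
      fun i _ hne => by rw [hz _ _ (h3 i hne), mul_zero],
    Finset.sum_eq_single_of_mem (1 : Fin 4) (Finset.mem_univ _)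
      fun i _ hne => Finset.sum_eq_zero fun j hj => by
        rw [h1 i j (Finset.mem_Ici.1 hj) fun h => hne h.1, zero_smul, hb0, mul_zero],
    Finset.sum_eq_single_of_mem (1 : Fin 4) (Finset.mem_Ici.2 le_rfl)
      fun j hj hne => by
        rw [h1 1 j (Finset.mem_Ici.1 hj) fun h => hne h.2, zero_smul, hb0, mul_zero]]
  have e : Fin.removeNth 4 v = ![eC 2, -Complex.I • eC a, eC a, -Complex.I • eC 3] := by
    funext i
    fin_cases i <;> rfl
  have e1 : (1 : Fin 4).removeNth ((1 : Fin 4).castSucc.removeNth v) =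
      ![eC 2, -Complex.I • eC 3, eC 3] := by
    funext i
    fin_cases i <;> rfl
  have c1 : yForm (v (1 : Fin 4).castSucc) (v (1 : Fin 4).succ) -
      yForm (v (1 : Fin 4).succ) (v (1 : Fin 4).castSucc) = ((2 * κ : ℝ) : ℂ) * Complex.I := by
    change yForm (-Complex.I • eC a) (eC a) - yForm (eC a) (-Complex.I • eC a) = _
    rw [yForm_smul_left, yForm_smul_right, hκ]
    simp
    ring
  have e4 : v 4 = eC 3 := rfl
  rw [c1, mul_smul, yMean_frameEval_smul, e, e1, e4]
  norm_num

theorem frameEval_Jform {k : ℕ} (α : Cn 4 → Cn 4 [⋀^Fin k]→L[ℝ] ℝ) (v : Fin k → Cn 4) :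
    frameEval (Jform α) v = frameEval α fun i => Complex.I • v i := by
  funext x
  simp only [frameEval, Jform_apply, yFrame_smul]

theorem frameEval_JinvForm {k : ℕ} (α : Cn 4 → Cn 4 [⋀^Fin k]→L[ℝ] ℝ) (v : Fin k → Cn 4) :
    frameEval (JinvForm α) v = frameEval α fun i => -Complex.I • v i := by
  funext x
  simp only [frameEval, JinvForm_apply, yFrame_smul]
  simp only [neg_smul]

/-- The mean of `dᶜ` of an invariant four-form. -/
theorem yMean_dcForm {Ω : Cn 4 → Cn 4 [⋀^Fin 4]→L[ℝ] ℝ} (hΩ : ContDiff ℝ ∞ Ω)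
    (hi : ∀ γ ∈ yLattice, pullForm (yMul γ) Ω = Ω) {a : Fin 4} {κ : ℝ}
    (ha : a = 0 ∧ κ = 1 ∨ a = 1 ∧ κ = 2) (x : Cn 4) :
    yMean (frameEval (dcForm Ω)
      ![Complex.I • eC 2, eC a, Complex.I • eC a, eC 3, Complex.I • eC 3]) x =
    fderiv ℝ (yMean (frameEval (Jform Ω)
      ![eC 2, -Complex.I • eC a, eC a, -Complex.I • eC 3])) x (eC 3) +
    2 * κ * yMean (frameEval Ω ![eC 2, Complex.I • eC 2, eC 3, Complex.I • eC 3]) x := by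
  have hJ : ContDiff ℝ ∞ (Jform Ω) := contDiff_iff_contDiffAt.2 fun y => hΩ.contDiffAt.jform
  have hJi : ∀ γ ∈ yLattice, pullForm (yMul γ) (Jform Ω) = Jform Ω := by
    intro γ hγ
    conv_rhs => rw [← hi γ hγ]
    funext y
    exact (Jform_pullForm ((contDiff_yMul γ).differentiable (by simp) y) Ω).symm
  rw [dcForm, frameEval_JinvForm]
  have e : (fun i => -Complex.I •
      ![Complex.I • eC 2, eC a, Complex.I • eC a, eC 3, Complex.I • eC 3] i) =
      ![eC 2, -Complex.I • eC a, eC a, -Complex.I • eC 3, eC 3] := by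
    funext i
    fin_cases i <;> simp [smul_smul]
  -- i · (ie₂) = -e₂ while i · (-ie₃) = e₃. The single sign turns the minus of `yMean_extDeriv_four`
  -- into a plus.
  have e' : (fun i => Complex.I • ![Complex.I • eC 2, eC 2, -Complex.I • eC 3, eC 3] i) =
      Matrix.vecCons (((-1 : ℝ) : ℂ) • eC 2) ![Complex.I • eC 2, eC 3, Complex.I • eC 3] := by
    funext i
    fin_cases i <;> simp [smul_smul]
  rw [e, yMean_extDeriv_four hJ hJi ha, frameEval_Jform Ω ![Complex.I • eC 2, _, _, _], e',
    yMean_frameEval_smul]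
  ring

/-- The mean of the equation `d dᶜ Ω = 0` for an invariant four-form. -/
theorem yMean_ddcForm {Ω : Cn 4 → Cn 4 [⋀^Fin 4]→L[ℝ] ℝ} (hΩ : ContDiff ℝ ∞ Ω)
    (hi : ∀ γ ∈ yLattice, pullForm (yMul γ) Ω = Ω) (hdd : ∀ x, ddcForm Ω x = 0) (x : Cn 4) :
    fderiv ℝ (yMean (frameEval (dcForm Ω)
      ![eC 0, Complex.I • eC 0, eC 1, Complex.I • eC 1, Complex.I • eC 3])) x (eC 3) -
    2 * fderiv ℝ (yMean (frameEval (Jform Ω)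
      ![eC 2, -Complex.I • eC 1, eC 1, -Complex.I • eC 3])) x (eC 3) -
    4 * fderiv ℝ (yMean (frameEval (Jform Ω)
      ![eC 2, -Complex.I • eC 0, eC 0, -Complex.I • eC 3])) x (eC 3) =
    16 * yMean (frameEval Ω ![eC 2, Complex.I • eC 2, eC 3, Complex.I • eC 3]) x := by
  have hΨ : ContDiff ℝ ∞ (dcForm Ω) := contDiff_iff_contDiffAt.2 fun y => hΩ.contDiffAt.dcForm
  have hΨi : ∀ γ ∈ yLattice, pullForm (yMul γ) (dcForm Ω) = dcForm Ω := by
    intro γ hγ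
    conv_rhs => rw [← hi γ hγ]
    funext y
    exact (dcForm_pullForm (contDiff_yMul γ).contDiffAt
      (hΩ.contDiffAt.differentiableAt (by simp))).symm
  have h := yMean_extDeriv_five hΨ hΨi x
  have h0 : yMean (frameEval (extDeriv (dcForm Ω))
      ![eC 0, Complex.I • eC 0, eC 1, Complex.I • eC 1, eC 3, Complex.I • eC 3]) x = 0 := by
    have : frameEval (extDeriv (dcForm Ω))
      ![eC 0, Complex.I • eC 0, eC 1, Complex.I • eC 1, eC 3, Complex.I • eC 3] = fun _ => 0 := by
      funext y
      have := hdd y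
      rw [ddcForm] at this
      rw [frameEval, this]
      rfl
    rw [this, yMean, avgs_zero, avgs_zero]
  -- 16 = 4·2 + 2·4: the bracket factor of the outer derivative in each horizontal plane is
  -- multiplied by that of the inner one in the complementary plane. The signs agree, so nothing
  -- cancels.
  rw [h0, yMean_dcForm hΩ hi (Or.inl ⟨rfl, rfl⟩), yMean_dcForm hΩ hi (Or.inr ⟨rfl, rfl⟩)] at h
  linarith

end MeanEquation
end

noncomputable section

/-! ### Positivity of the square of a fundamental form -/

/-- The 24 permutations fall into three pairings of four arguments; each pairing occurs 8 times with
the same signed value. -/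
theorem altSum_pair {V : Type*} (F : V → V → ℝ) (hF : ∀ a b, F b a = - F a b) (v : Fin 4 → V) :
    altSum (fun w : Fin 4 → V => F (w 0) (w 1) * F (w 2) (w 3)) v =
      8 * (F (v 0) (v 1) * F (v 2) (v 3) - F (v 0) (v 2) * F (v 1) (v 3) +
        F (v 0) (v 3) * F (v 1) (v 2)) := by
  have d2 : ∀ (e : Equiv.Perm (Fin 3)) (p : Fin 4), Equiv.Perm.decomposeFin.symm (p, e) 2 =
      Equiv.swap 0 p (e 1).succ := fun e p => Equiv.Perm.decomposeFin_symm_apply_succ e p 1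
  have d3 : ∀ (e : Equiv.Perm (Fin 3)) (p : Fin 4), Equiv.Perm.decomposeFin.symm (p, e) 3 =
      Equiv.swap 0 p (e 2).succ := fun e p => Equiv.Perm.decomposeFin_symm_apply_succ e p 2
  have d2' : ∀ (e : Equiv.Perm (Fin 2)) (p : Fin 3), Equiv.Perm.decomposeFin.symm (p, e) 2 =
      Equiv.swap 0 p (e 1).succ := fun e p => Equiv.Perm.decomposeFin_symm_apply_succ e p 1
  unfold altSum
  rw [← Equiv.sum_comp Equiv.Perm.decomposeFin.symm, Fintype.sum_prod_type]
  simp only [← Equiv.sum_comp (Equiv.Perm.decomposeFin (n := 2)).symm,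
    ← Equiv.sum_comp (Equiv.Perm.decomposeFin (n := 1)).symm, Fintype.sum_prod_type]
  simp [Fin.sum_univ_succ, Equiv.Perm.decomposeFin.symm_sign, d2, d3, d2', Equiv.swap_apply_def]
  rw [hF (v 0) (v 1), hF (v 0) (v 2), hF (v 0) (v 3),
    hF (v 1) (v 2), hF (v 1) (v 3), hF (v 2) (v 3)]
  ring

section Positivity

variable {n : ℕ} {M : Type*} [TopologicalSpace M] [ChartedSpace (Cn n) M]

theorem multI_multI {V : Type*} [AddCommGroup V] [Module ℂ V] [TopologicalSpace V]
    [ContinuousConstSMul ℂ V] (a : V) : multI V (multI V a) = -a := by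
  simp [multI, smul_smul]

theorem HermitianMetric.val_multI_left (g : HermitianMetric n M) (x : M) (a b : Tan n M x) :
    g.val x a (multI (Tan n M x) b) = -g.val x (multI (Tan n M x) a) b := by
  have h := g.isometry_J x a (multI (Tan n M x) b)
  rw [multI_multI, map_neg] at h
  exact h.symm

/-- The Cauchy-Schwarz inequality for the Hermitian form of a metric. -/
theorem HermitianMetric.sq_add_sq_lt (g : HermitianMetric n M) (x : M) {a c : Tan n M x}
    (ha : a ≠ 0) (hc : ∀ s r : ℝ, c ≠ s • a + r • multI (Tan n M x) a) :
    g.val x a c ^ 2 + g.val x (multI (Tan n M x) a) c ^ 2 < g.val x a a * g.val x c c := by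
  have hA := g.pos x a ha
  set A := g.val x a a with hAdef
  set s := g.val x a c with hs
  set r := g.val x (multI (Tan n M x) a) c with hr
  -- The component of `c` orthogonal to the complex line of `a` is nonzero; positivity of its norm
  -- is the strict inequality.
  have h0 : c - ((s / A) • a + (r / A) • multI (Tan n M x) a) ≠ 0 := fun h =>
    hc _ _ (sub_eq_zero.1 h)
  have h1 := g.pos x _ h0
  have e1 : g.val x (multI (Tan n M x) a) (multI (Tan n M x) a) = A := g.isometry_J x a a
  have e2 : g.val x (multI (Tan n M x) a) a = 0 := g.val_J_self x a
  have e3 : g.val x a (multI (Tan n M x) a) = 0 := by rw [g.symm, e2]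
  have e4 : g.val x c a = s := g.symm x c a
  have e5 : g.val x c (multI (Tan n M x) a) = r := g.symm x c _
  simp only [map_sub, map_add, map_smul, LinearMap.sub_apply, LinearMap.add_apply,
    LinearMap.smul_apply, smul_eq_mul, e1, e2, e3, e4, e5, ← hs, ← hr, ← hAdef] at h1
  have h2 : 0 < A * (g.val x c c) - (s ^ 2 + r ^ 2) := by
    have := mul_pos hA h1
    field_simp at this
    nlinarith
  linarith

/-- F²(a, Ja, c, Jc) = 2 (g(a,a) g(c,c) - g(a,c)² - g(Ja,c)²), which is positive by strict
Cauchy-Schwarz for complex independent vectors. -/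
theorem HermitianMetric.wedgePow_two_pos (g : HermitianMetric n M) (x : M) {a c : Tan n M x}
    (ha : a ≠ 0) (hc : ∀ s r : ℝ, c ≠ s • a + r • multI (Tan n M x) a)
    {v : Fin (2 * 2) → Tan n M x} (h0 : v 0 = a) (h1 : v 1 = multI (Tan n M x) a) (h2 : v 2 = c)
    (h3 : v 3 = multI (Tan n M x) c) : 0 < wedgePow (g.fundamentalForm x) 2 v := by
  let F : Tan n M x → Tan n M x → ℝ := fun a b => g.val x (multI (Tan n M x) a) b
  have hF : ∀ a b, F b a = -F a b := by
    intro a b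
    simp only [F]
    rw [g.symm, g.val_multI_left]
  have h := altSum_pair F hF v
  have e : altSum (tensorPow (g.fundamentalForm x) 2) v =
      altSum (fun w : Fin 4 → Tan n M x => F (w 0) (w 1) * F (w 2) (w 3)) v := by
    refine altSum_congr (fun w => ?_) v
    simp only [tensorPow, one_mul]
    rfl
  rw [wedgePow_apply, e, h, h0, h1, h2, h3]
  have f1 : F a (multI _ a) = g.val x a a := g.isometry_J x a a
  have f2 : F c (multI _ c) = g.val x c c := g.isometry_J x c c
  have f3 : F a c = g.val x (multI _ a) c := rfl
  have f4 : F (multI _ a) (multI _ c) = g.val x (multI _ a) c := g.isometry_J x _ _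
  have f5 : F a (multI _ c) = g.val x a c := g.isometry_J x a c
  have f6 : F (multI _ a) c = -g.val x a c := by
    simp only [F, multI_multI, map_neg, LinearMap.neg_apply]
  rw [f1, f2, f3, f4, f5, f6]
  have := g.sq_add_sq_lt x ha hc
  refine mul_pos (by norm_num) (mul_pos (by norm_num) ?_)
  nlinarith

end Positivity
end

noncomputable section

/-! ### The universal cover of an open subset of the exceptional divisor -/

section Divisor

/-- The inclusion of the coordinates of `Y`. -/
def divIn : Cn 4 →L[ℂ] Cn 5 :=
  LinearMap.toContinuousLinearMap
    { toFun := fun x => ![x 0, x 1, x 2, 0, 0]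
      map_add' := fun x y => by
        ext i
        fin_cases i <;> simp
      map_smul' := fun c x => by
        ext i
        fin_cases i <;> simp }

theorem divIn_apply (x : Cn 4) : divIn x = ![x 0, x 1, x 2, 0, 0] := rfl

/-- The parametrisation of the exceptional divisor, in affine coordinates, by the logarithm of the
coordinate on the projective line. -/
def divParam (k : NormalIdx 5 3) (ε : ℝ) (x : Cn 4) : Cn 5 :=
  divIn x + Complex.exp (ε * x 3) • Pi.single (k : Fin 5) 1

theorem divIn_normal (x : Cn 4) (i : NormalIdx 5 3) : divIn x i = 0 := by
  obtain ⟨i, hi⟩ := i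
  fin_cases i
  · simp at hi
  · simp at hi
  · simp at hi
  · rfl
  · rfl

theorem divParam_self (k : NormalIdx 5 3) (ε : ℝ) (x : Cn 4) :
    divParam k ε x k = Complex.exp (ε * x 3) := by
  simp [divParam, divIn_normal]

theorem divParam_other {j k : NormalIdx 5 3} (h : j ≠ k) (ε : ℝ) (x : Cn 4) :
    divParam k ε x j = 0 := by
  have h' : (j : Fin 5) ≠ k := fun e => h (Subtype.ext e)
  simp [divParam, divIn_normal, h']

theorem divParam_of_lt (k : NormalIdx 5 3) (ε : ℝ) (x : Cn 4) {i : Fin 5} (hi : ¬ 3 ≤ (i : ℕ)) :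
    divParam k ε x i = divIn x i := by
  have h : i ≠ k := fun e => hi (e ▸ k.2)
  simp [divParam, h]

theorem divParam_mem_dom {j k : NormalIdx 5 3} (h : j ≠ k) (ε : ℝ) (x : Cn 4) :
    divParam k ε x ∈ nilBlowDom j := by
  change ‖divParam k ε x j‖ < 1
  rw [divParam_other h, norm_zero]
  exact one_pos

theorem blowDown_divParam {j k : NormalIdx 5 3} (h : j ≠ k) (ε : ℝ) (x : Cn 4) :
    blowDown j (divParam k ε x) = divIn x := by
  ext i
  by_cases hi : 3 ≤ (i : ℕ)
  · rw [show i = ((⟨i, hi⟩ : NormalIdx 5 3) : Fin 5) from rfl, blowDown_normal, divParam_other h,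
      zero_mul, divIn_normal]
  · rw [blowDown_of_lt _ _ hi, divParam_of_lt _ _ _ hi]

theorem normalIdx_eq_of_ne : ∀ {i j k : NormalIdx 5 3}, j ≠ k → i ≠ j → i = k := by decide

theorem blowDir_divParam {j k : NormalIdx 5 3} (h : j ≠ k) (ε : ℝ) (x : Cn 4) :
    blowDir j (divParam k ε x) = fun i => if i = j then 1 else Complex.exp (ε * x 3) := by
  funext i
  unfold blowDir
  split_ifs with hi
  · rfl
  · rw [normalIdx_eq_of_ne h hi, divParam_self]

theorem nilBlow_divParam_eq {j k j' k' : NormalIdx 5 3} (h : j ≠ k) (h' : j' ≠ k') {ε ε' : ℝ}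
    {x x' : Cn 4} (hx : nilQ (divIn x) = nilQ (divIn x'))
    (hd : ∃ c : ℂ, c • blowDir j' (divParam k' ε' x') = blowDir j (divParam k ε x)) :
    nilBlow j (divParam k ε x) = nilBlow j' (divParam k' ε' x') := by
  refine NilBlowup.ext_of_mem ?_ fun _ => ?_
  · rw [nilBlowDown_nilBlow, nilBlowDown_nilBlow, blowDown_divParam h, blowDown_divParam h', hx]
  · rw [nilBlow_snd_of_eq (divParam_other h ε x), nilBlow_snd_of_eq (divParam_other h' ε' x')]
    exact (Projectivization.mk_eq_mk_iff' ℂ _ _ _ _).2 hd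

/-- The affine coordinates on ℙ¹ are inverse to each other, so one logarithm serves both charts up
to sign. -/
theorem nilBlow_divParam_swap {j k : NormalIdx 5 3} (h : j ≠ k) (x : Cn 4) :
    nilBlow k (divParam j (-1) x) = nilBlow j (divParam k 1 x) := by
  refine nilBlow_divParam_eq h.symm h rfl ⟨Complex.exp (-x 3), ?_⟩
  rw [blowDir_divParam h, blowDir_divParam h.symm]
  funext i
  by_cases hi : i = j
  · subst hi
    simp [h]
  · have hk := normalIdx_eq_of_ne h hi
    subst hk
    simp [h.symm, ← Complex.exp_add]

theorem divIn_yMul (γ x : Cn 4) : divIn (yMul γ x) = nilT (divIn γ) (divIn x) := by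
  ext i
  fin_cases i
  · simp [divIn_apply, yMul, nilT, nilPerm_symm_apply, nilPerm_apply, nilMul, nilSigma, eC, add_comm]
  · simp [divIn_apply, yMul, nilT, nilPerm_symm_apply, nilPerm_apply, nilMul, nilSigma, eC, add_comm]
  · simp [divIn_apply, yMul, nilT, nilPerm_symm_apply, nilPerm_apply, nilMul, nilSigma, eC, yForm,
      nilForm]
    ring
  · simp [divIn_apply, nilT, nilPerm_symm_apply, nilPerm_apply, nilMul, nilSigma]
  · simp [divIn_apply, nilT, nilPerm_symm_apply, nilPerm_apply, nilMul, nilSigma]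

theorem divIn_mem_gaussZ {γ : Cn 4} (hγ : γ ∈ yLattice) (i : Fin 5) : divIn γ i ∈ gaussZ := by
  fin_cases i
  · exact hγ.1 0 (by decide)
  · exact hγ.1 1 (by decide)
  · exact hγ.1 2 (by decide)
  · exact zero_mem _
  · exact zero_mem _

/-- Lattice translations along Y do not touch the normal coordinates, hence act trivially on lines;
the last coordinate moves by a period of the exponential. -/
theorem nilBlow_divParam_yMul {j k : NormalIdx 5 3} (h : j ≠ k) {γ : Cn 4} (hγ : γ ∈ yLattice)
    (x : Cn 4) : nilBlow j (divParam k 1 (yMul γ x)) = nilBlow j (divParam k 1 x) := by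
  refine nilBlow_divParam_eq h h ?_ ⟨1, ?_⟩
  · rw [divIn_yMul, nilQ_nilT (divIn_mem_gaussZ hγ)]
  · have h3 : yMul γ x 3 = x 3 + γ 3 := by simp [yMul, eC]
    rw [blowDir_divParam h, blowDir_divParam h, one_smul, h3, mul_add, Complex.exp_add]
    simp [hγ.2]

theorem hasFDerivAt_divParam (k : NormalIdx 5 3) (ε : ℝ) (x : Cn 4) :
    HasFDerivAt (divParam k ε) (divIn + ((Complex.exp (ε * x 3) * ε) •
      (ContinuousLinearMap.proj 3 : Cn 4 →L[ℂ] ℂ)).smulRight (Pi.single (k : Fin 5) (1 : ℂ))) x := by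
  have h1 : HasFDerivAt (fun x : Cn 4 => (ε : ℂ) * x 3)
      ((ε : ℂ) • (ContinuousLinearMap.proj 3 : Cn 4 →L[ℂ] ℂ)) x :=
    (ContinuousLinearMap.proj (R := ℂ) (φ := fun _ : Fin 4 => ℂ) 3).hasFDerivAt.const_mul (ε : ℂ)
  have h2 := h1.cexp.smul_const (Pi.single (k : Fin 5) (1 : ℂ) : Cn 5)
  have h3 := (divIn.hasFDerivAt (x := x)).add h2
  rw [smul_smul] at h3
  exact h3

theorem contDiff_divParam (k : NormalIdx 5 3) (ε : ℝ) : ContDiff ℂ ω (divParam k ε) := by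
  have h1 : ContDiff ℂ ω fun x : Cn 4 => Complex.exp (ε * x 3) :=
    (contDiff_const.mul (contDiff_apply ℂ ℂ 3)).cexp
  exact divIn.contDiff.add (h1.smul contDiff_const)

theorem fderiv_divParam (k : NormalIdx 5 3) (ε : ℝ) (x v : Cn 4) :
    fderiv ℝ (divParam k ε) x v =
      divIn v + (Complex.exp (ε * x 3) * ε * v 3) • Pi.single (k : Fin 5) 1 := by
  rw [(hasFDerivAt_divParam k ε x).differentiableAt.fderiv_restrictScalars ℝ,
    (hasFDerivAt_divParam k ε x).fderiv]
  rfl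

/-! ### Pull-back of the metric to affine coordinates and to the divisor -/

variable (g : HermitianMetric 5 NilBlowup)

/-- The square of the fundamental form. -/
def sqForm (q : NilBlowup) : Tan 5 NilBlowup q [⋀^Fin (2 * 2)]→L[ℝ] ℝ :=
  wedgePow (g.fundamentalForm q) 2

theorem mpull_sqForm {m : ℕ} (f : Cn m → NilBlowup) :
    mpull f (sqForm g) = fun u => wedgePow (mpull f g.fundamentalForm u) 2 := by
  funext u
  exact compContinuousLinearMap_wedgePow _ _ 2

theorem contDiffAt_mpull_fundamentalForm {j : NormalIdx 5 3} {u : Cn 5} (hu : u ∈ nilBlowDom j)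
    (w : Fin 2 → Cn 5) :
    ContDiffAt ℝ ∞ (fun y => mpull (nilBlow j) g.fundamentalForm y w) u := by
  obtain ⟨U, hU, huU, hUd, hinj⟩ := nilBlowCover.locInj j u hu
  have h := g.smooth (nilBlowCover.chart j U hU hUd hinj) ⟨j, U, hU, hUd, hinj, rfl⟩
    (Complex.I • w 0) (w 1)
  have h1 := h.contDiffAt (hU.mem_nhds huU)
  refine h1.congr_of_eventuallyEq (Filter.Eventually.of_forall fun y => ?_)
  change g.val (nilBlow j y) (multI _ (mfderiv 𝓘(ℂ, Cn 5) 𝓘(ℂ, Cn 5) (nilBlow j) y (w 0)))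
      (mfderiv 𝓘(ℂ, Cn 5) 𝓘(ℂ, Cn 5) (nilBlow j) y (w 1)) =
    g.val (nilBlow j y) (mfderiv 𝓘(ℂ, Cn 5) 𝓘(ℂ, Cn 5) (nilBlow j) y (Complex.I • w 0))
      (mfderiv 𝓘(ℂ, Cn 5) 𝓘(ℂ, Cn 5) (nilBlow j) y (w 1))
  congr 2
  exact ((mfderiv 𝓘(ℂ, Cn 5) 𝓘(ℂ, Cn 5) (nilBlow j) y).map_smul Complex.I (w 0)).symm

theorem contDiffAt_mpull_sqForm {j : NormalIdx 5 3} {u : Cn 5} (hu : u ∈ nilBlowDom j) :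
    ContDiffAt ℝ ∞ (mpull (nilBlow j) (sqForm g)) u := by
  rw [mpull_sqForm]
  exact ContDiffAt.wedgePow (contDiffAt_mpull_fundamentalForm g hu) 2

theorem ddcForm_mpull_sqForm (hg : g.DdcPowClosed 2) {j : NormalIdx 5 3} {u : Cn 5}
    (hu : u ∈ nilBlowDom j) : ddcForm (mpull (nilBlow j) (sqForm g)) u = 0 := by
  obtain ⟨U, hU, huU, hUd, hinj⟩ := nilBlowCover.locInj j u hu
  exact hg (nilBlowCover.chart j U hU hUd hinj) ⟨j, U, hU, hUd, hinj, rfl⟩ u huU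

/-- The map to the exceptional divisor. -/
def divMap (x : Cn 4) : NilBlowup := nilBlow ⟨3, le_rfl⟩ (divParam ⟨4, by norm_num⟩ 1 x)

/-- The square of the fundamental form, pulled back to the divisor. -/
def divForm : Cn 4 → Cn 4 [⋀^Fin (2 * 2)]→L[ℝ] ℝ := mpull divMap (sqForm g)

theorem mdifferentiableAt_nilBlow {j : NormalIdx 5 3} {u : Cn 5} (hu : u ∈ nilBlowDom j) :
    MDifferentiableAt 𝓘(ℂ, Cn 5) 𝓘(ℂ, Cn 5) (nilBlow j) u :=
  nilBlowCover.mdifferentiableAt (i := j) hu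

theorem differentiableAt_divParam (k : NormalIdx 5 3) (ε : ℝ) (x : Cn 4) :
    DifferentiableAt ℂ (divParam k ε) x :=
  (hasFDerivAt_divParam k ε x).differentiableAt

theorem mdifferentiableAt_divMap (x : Cn 4) :
    MDifferentiableAt 𝓘(ℂ, Cn 4) 𝓘(ℂ, Cn 5) divMap x :=
  MDifferentiableAt.comp x (mdifferentiableAt_nilBlow (divParam_mem_dom (by decide) 1 x))
    (differentiableAt_divParam _ 1 x).mdifferentiableAt

theorem divForm_eq {j k : NormalIdx 5 3} (hjk : j ≠ k) {ε : ℝ}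
    (h : divMap = nilBlow j ∘ divParam k ε) :
    divForm g = pullForm (divParam k ε) (mpull (nilBlow j) (sqForm g)) := by
  funext x
  rw [divForm, h]
  exact mpull_comp _ (differentiableAt_divParam k ε x)
    (mdifferentiableAt_nilBlow (divParam_mem_dom hjk ε x))

theorem divMap_eq_left : divMap =
    nilBlow ⟨3, le_rfl⟩ ∘ divParam ⟨4, by norm_num⟩ 1 := rfl

/-- The two descriptions of `divMap` control the two ends: the first extends across real part -∞,
this one across real part +∞. -/
theorem divMap_eq_right : divMap =
    nilBlow ⟨4, by norm_num⟩ ∘ divParam ⟨3, le_rfl⟩ (-1) :=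
  funext fun x => (nilBlow_divParam_swap (by decide) x).symm

theorem contDiff_divForm : ContDiff ℝ ∞ (divForm g) := by
  rw [divForm_eq g (by decide) divMap_eq_left]
  exact contDiff_iff_contDiffAt.2 fun x => (contDiff_divParam _ 1).contDiffAt.pullForm
    (contDiffAt_mpull_sqForm g (divParam_mem_dom (by decide) 1 x))

theorem ddcForm_divForm (hg : g.DdcPowClosed 2) (x : Cn 4) : ddcForm (divForm g) x = 0 := by
  have hx := divParam_mem_dom (j := ⟨3, le_rfl⟩) (k := ⟨4, by norm_num⟩) (by decide) 1 x
  rw [divForm_eq g (by decide) divMap_eq_left, ddcForm_pullForm (contDiff_divParam _ 1).contDiffAt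
    (contDiffAt_mpull_sqForm g hx), pullForm, ddcForm_mpull_sqForm g hg hx]
  rfl

theorem pullForm_yMul_divForm {γ : Cn 4} (hγ : γ ∈ yLattice) :
    pullForm (yMul γ) (divForm g) = divForm g := by
  have h : divMap ∘ yMul γ = divMap := funext fun x => nilBlow_divParam_yMul (by decide) hγ x
  funext x
  have h1 := mpull_comp (sqForm g) (φ := yMul γ) (P := divMap) (u := x)
    ((contDiff_yMul γ).differentiable (by simp) x) (mdifferentiableAt_divMap _)
  rw [h] at h1
  exact h1.symm

end Divisor
end

noncomputable section

/-! ### Positivity and decay on the divisor -/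

section Decay

variable (g : HermitianMetric 5 NilBlowup)

theorem mfderiv_divMap_injective {x v : Cn 4}
    (h : mfderiv 𝓘(ℂ, Cn 4) 𝓘(ℂ, Cn 5) divMap x v = 0) : v = 0 := by
  have hx := divParam_mem_dom (j := ⟨3, le_rfl⟩) (k := ⟨4, by norm_num⟩) (by decide) 1 x
  have h1 := mfderiv_comp x (mdifferentiableAt_nilBlow hx)
    (differentiableAt_divParam ⟨4, by norm_num⟩ 1 x).mdifferentiableAt
  have h2 : mfderiv 𝓘(ℂ, Cn 5) 𝓘(ℂ, Cn 5) (nilBlow ⟨3, le_rfl⟩) (divParam ⟨4, by norm_num⟩ 1 x)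
      (fderiv ℂ (divParam ⟨4, by norm_num⟩ 1) x v) = 0 := by
    rw [mfderiv_eq_fderiv] at h1
    exact (DFunLike.congr_fun h1 v).symm.trans h
  let D := (nilBlowCover.isLocalDiffeomorphAt hx).mfderivToContinuousLinearEquiv (by simp)
  have h3 : D (fderiv ℂ (divParam ⟨4, by norm_num⟩ 1) x v) = 0 := h2
  have h4 := D.map_eq_zero_iff.1 h3
  rw [(hasFDerivAt_divParam _ 1 x).fderiv] at h4
  have h5 : divIn v + (Complex.exp ((1 : ℝ) * x 3) * (1 : ℝ) * v 3) • Pi.single (4 : Fin 5) 1 = 0 := h4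
  have h6 := fun i => congrFun h5 i
  have e0 := h6 0
  have e1 := h6 1
  have e2 := h6 2
  have e4 := h6 4
  simp [divIn_apply] at e0 e1 e2 e4
  ext i
  fin_cases i <;> assumption

theorem yFrame_three (c : ℂ) (x : Cn 4) : yFrame (c • eC 3) x = c • eC 3 := by
  rw [yFrame, yForm_smul_right, yForm_three_right, mul_zero, zero_smul, add_zero]

/-- e₂ and e₃ are complex independent, are not changed by the frame, and stay independent because
`divMap` is an immersion. -/
theorem frameEval_divForm_pos (x : Cn 4) :
    0 < frameEval (divForm g) ![eC 2, Complex.I • eC 2, eC 3, Complex.I • eC 3] x := by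
  let D : Cn 4 →L[ℂ] Tan 5 NilBlowup (divMap x) := mfderiv 𝓘(ℂ, Cn 4) 𝓘(ℂ, Cn 5) divMap x
  have h2 : yFrame (eC 2) x = eC 2 := by simpa using yFrame_smul_two 1 x
  have h3 : yFrame (eC 3) x = eC 3 := by simpa using yFrame_three 1 x
  have hD : ∀ v, D v = 0 → v = 0 := fun v h => mfderiv_divMap_injective h
  refine g.wedgePow_two_pos (divMap x) (a := D (eC 2)) (c := D (eC 3)) (fun h => ?_)
    (fun s r h => ?_) ?_ ?_ ?_ ?_
  · have := congrFun (hD _ h) 2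
    simp [eC] at this
  · have h' : D (eC 3 - ((s : ℂ) • eC 2 + (r : ℂ) • Complex.I • eC 2)) = 0 := by
      rw [map_sub, map_add, map_smul, map_smul, map_smul, sub_eq_zero]
      exact h
    have := congrFun (hD _ h') 3
    simp [eC] at this
  · change D (yFrame (eC 2) x) = _
    rw [h2]
  · change D (yFrame (Complex.I • eC 2) x) = _
    rw [yFrame_smul_two]
    exact D.map_smul _ _
  · change D (yFrame (eC 3) x) = _
    rw [h3]
  · change D (yFrame (Complex.I • eC 3) x) = _
    rw [yFrame_three]
    exact D.map_smul _ _

theorem norm_divIn_le (v : Cn 4) : ‖divIn v‖ ≤ ‖v‖ := by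
  refine (pi_norm_le_iff_of_nonneg (norm_nonneg v)).2 fun i => ?_
  fin_cases i
  · exact norm_le_pi_norm v 0
  · exact norm_le_pi_norm v 1
  · exact norm_le_pi_norm v 2
  · simp [divIn_apply]
  · simp [divIn_apply]

theorem norm_exp_mul (ε : ℝ) (z : ℂ) : ‖Complex.exp (ε * z)‖ = Real.exp (ε * z.re) := by
  rw [Complex.norm_exp, Complex.re_ofReal_mul]

theorem norm_fderiv_divParam_le (k : NormalIdx 5 3) {ε : ℝ} (hε : |ε| = 1) {x : Cn 4}
    (hx : ε * (x 3).re ≤ 0) (v : Cn 4) : ‖fderiv ℝ (divParam k ε) x v‖ ≤ 2 * ‖v‖ := by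
  rw [fderiv_divParam, two_mul]
  refine (norm_add_le _ _).trans (add_le_add (norm_divIn_le v) ?_)
  rw [norm_smul, Pi.norm_single, norm_one, mul_one, norm_mul, norm_mul, norm_exp_mul,
    Complex.norm_real, Real.norm_eq_abs, hε, mul_one]
  calc Real.exp (ε * (x 3).re) * ‖v 3‖ ≤ 1 * ‖v‖ :=
        mul_le_mul (Real.exp_le_one_iff.2 hx) (norm_le_pi_norm v 3) (norm_nonneg _) zero_le_one
    _ = ‖v‖ := one_mul _

theorem norm_fderiv_divParam_three (k : NormalIdx 5 3) {ε : ℝ} (hε : |ε| = 1) (x : Cn 4) (c : ℂ) :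
    ‖fderiv ℝ (divParam k ε) x (c • eC 3)‖ = Real.exp (ε * (x 3).re) * ‖c‖ := by
  have h : divIn (c • eC 3) = 0 := by
    ext i
    fin_cases i <;> simp [divIn_apply, eC]
  rw [fderiv_divParam, h, zero_add, norm_smul, Pi.norm_single, norm_one, mul_one, norm_mul,
    norm_mul, norm_exp_mul, Complex.norm_real, Real.norm_eq_abs, hε, mul_one]
  simp [eC]

theorem norm_yFrame_le {x : Cn 4} (hx : ∀ i, i ≠ 3 → ‖x i‖ ≤ 7) (v : Cn 4) :
    ‖yFrame v x‖ ≤ 22 * ‖v‖ := by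
  have h0 := hx 0 (by decide)
  have h1 := hx 1 (by decide)
  have hv := norm_le_pi_norm v
  -- 21 = 7 + 2·7, from the two coefficients of `yForm`.
  have h2 : ‖yForm x v‖ ≤ 21 * ‖v‖ := by
    rw [yForm]
    refine (norm_add_le _ _).trans ?_
    simp only [norm_mul, RCLike.norm_conj, RCLike.norm_ofNat]
    have a1 := mul_le_mul h0 (hv 0) (norm_nonneg _) (by norm_num)
    have a2 := mul_le_mul h1 (hv 1) (norm_nonneg _) (by norm_num)
    linarith
  have h3 : ‖yForm x v • eC 2‖ = ‖yForm x v‖ := by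
    rw [norm_smul, eC, Pi.norm_single, norm_one, mul_one]
  calc ‖yFrame v x‖ ≤ ‖v‖ + ‖yForm x v • eC 2‖ := norm_add_le _ _
    _ ≤ 22 * ‖v‖ := by
      rw [h3]
      linarith

/-- On the half of the cylinder towards the chosen end the affine coordinate exp(ε x₃) is bounded by
1. The images stay in a compact part of the chart, where the form is bounded. -/
theorem divParam_mem_compact {j k : NormalIdx 5 3} (hjk : j ≠ k) {ε : ℝ} {x : Cn 4}
    (hx : ∀ i, i ≠ 3 → ‖x i‖ ≤ 7) (hx3 : ε * (x 3).re ≤ 0) :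
    divParam k ε x ∈ Metric.closedBall (0 : Cn 5) 7 ∩ {y | y j = 0} := by
  refine ⟨mem_closedBall_zero_iff.2 ((pi_norm_le_iff_of_nonneg (by norm_num)).2 fun i => ?_),
    divParam_other hjk ε x⟩
  by_cases hi : 3 ≤ (i : ℕ)
  · by_cases hij : (⟨i, hi⟩ : NormalIdx 5 3) = j
    · rw [show i = ((⟨i, hi⟩ : NormalIdx 5 3) : Fin 5) from rfl, hij, divParam_other hjk, norm_zero]
      norm_num
    · have hik := normalIdx_eq_of_ne hjk hij
      rw [show i = ((⟨i, hi⟩ : NormalIdx 5 3) : Fin 5) from rfl, hik, divParam_self, norm_exp_mul]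
      exact (Real.exp_le_one_iff.2 hx3).trans (by norm_num)
  · rw [divParam_of_lt k ε x hi]
    fin_cases i
    · exact hx 0 (by decide)
    · exact hx 1 (by decide)
    · exact hx 2 (by decide)
    · simp at hi
    · simp at hi

/-- Decay of pull-backs to the divisor, evaluated on vertical vectors. -/
theorem exists_bound_frameEval {m : ℕ} {β : Cn 5 → Cn 5 [⋀^Fin m]→L[ℝ] ℝ} {j k : NormalIdx 5 3}
    (hjk : j ≠ k) (hβ : ContinuousOn β (nilBlowDom j)) {ε : ℝ} (hε : |ε| = 1) (v : Fin m → Cn 4)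
    {i₀ : Fin m} {c : ℂ} (hv : v i₀ = c • eC 3) :
    ∃ C : ℝ, ∀ x : Cn 4, (∀ i, i ≠ 3 → ‖x i‖ ≤ 7) → ε * (x 3).re ≤ 0 →
      |frameEval (pullForm (divParam k ε) β) v x| ≤ C * Real.exp (ε * (x 3).re) := by
  have hK : IsCompact (Metric.closedBall (0 : Cn 5) 7 ∩ {y : Cn 5 | y j = 0}) :=
    (isCompact_closedBall (0 : Cn 5) 7).inter_right
      (isClosed_eq (continuous_apply (j : Fin 5)) continuous_const)
  have hKd : Metric.closedBall (0 : Cn 5) 7 ∩ {y : Cn 5 | y j = 0} ⊆ nilBlowDom j := by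
    rintro y ⟨-, hy⟩
    have hy' : y j = 0 := hy
    change ‖y j‖ < 1
    rw [hy', norm_zero]
    exact one_pos
  obtain ⟨C, hC⟩ := hK.exists_bound_of_continuousOn (hβ.mono hKd)
  -- 44 = 2·22: the derivative of `divParam` contributes 2 and the frame 22. The slot carrying c e₃
  -- is kept apart, as it supplies the exponential.
  refine ⟨C * (‖c‖ * ∏ i ∈ Finset.univ.erase i₀, 44 * ‖v i‖), fun x hx hx3 => ?_⟩
  have h1 := hC _ (divParam_mem_compact hjk hx hx3)
  let w : Fin m → Cn 5 := fun i => fderiv ℝ (divParam k ε) x (yFrame (v i) x)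
  have h2 : |frameEval (pullForm (divParam k ε) β) v x| ≤
      ‖β (divParam k ε x)‖ * ∏ i, ‖w i‖ :=
    (β (divParam k ε x)).le_opNorm w
  have h3 : ‖w i₀‖ = Real.exp (ε * (x 3).re) * ‖c‖ := by
    simp only [w, hv, yFrame_three]
    exact norm_fderiv_divParam_three k hε x c
  have h4 : ∏ i ∈ Finset.univ.erase i₀, ‖w i‖ ≤ ∏ i ∈ Finset.univ.erase i₀, 44 * ‖v i‖ := by
    refine Finset.prod_le_prod (fun i _ => norm_nonneg _) fun i _ => ?_
    refine (norm_fderiv_divParam_le k hε hx3 _).trans ?_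
    have := norm_yFrame_le hx (v i)
    linarith
  have h5 : ∏ i, ‖w i‖ ≤ Real.exp (ε * (x 3).re) *
      (‖c‖ * ∏ i ∈ Finset.univ.erase i₀, 44 * ‖v i‖) := by
    rw [← Finset.mul_prod_erase _ _ (Finset.mem_univ i₀), h3, mul_assoc]
    exact mul_le_mul_of_nonneg_left (mul_le_mul_of_nonneg_left h4 (norm_nonneg c))
      (Real.exp_pos _).le
  calc |frameEval (pullForm (divParam k ε) β) v x|
      ≤ ‖β (divParam k ε x)‖ * ∏ i, ‖w i‖ := h2
    _ ≤ C * (Real.exp (ε * (x 3).re) * (‖c‖ * ∏ i ∈ Finset.univ.erase i₀, 44 * ‖v i‖)) :=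
        mul_le_mul h1 h5 (Finset.prod_nonneg fun i _ => norm_nonneg _)
          ((norm_nonneg _).trans h1)
    _ = _ := by ring

/-- The mean is a mean over a bounded set of points with the same real part of the last
coordinate. -/
theorem abs_yMean_le {f : Cn 4 → ℝ} {C r : ℝ}
    (hf : ∀ x : Cn 4, (∀ i, i ≠ 3 → ‖x i‖ ≤ 7) → (x 3).re = r → |f x| ≤ C) :
    |yMean f (r • eC 3)| ≤ C := by
  -- There are 2 + 5 = 7 averages starting from zero coordinates, each of size at most 1 away from
  -- the last coordinate, which explains the radius 7. The period 2πi e₃ changes neither the real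
  -- part nor the other coordinates.
  let D : ℕ → Set (Cn 4) := fun k => {x | (∀ i, i ≠ 3 → ‖x i‖ ≤ k) ∧ (x 3).re = r}
  have key : ∀ l : List (Cn 4), (∀ u ∈ l, (∀ i, i ≠ 3 → ‖u i‖ ≤ 1) ∧ (u 3).re = 0) →
      ∀ k, ∀ x ∈ D k, ∀ u ∈ l, ∀ s ∈ Set.Icc (0 : ℝ) 1, x + s • u ∈ D (k + 1) := by
    intro l hl k x hx u hu s hs
    obtain ⟨h1, h2⟩ := hl u hu
    refine ⟨fun i hi => ?_, ?_⟩
    · push_cast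
      refine (norm_add_le _ _).trans (add_le_add (hx.1 i hi) ?_)
      rw [Pi.smul_apply, norm_smul, Real.norm_eq_abs, abs_of_nonneg hs.1]
      exact mul_le_one₀ hs.2 (norm_nonneg _) (h1 i hi)
    · simp [h2, hx.2]
  have hunit : ∀ (k : Fin 4) (c : ℂ), k ≠ 3 → ‖c‖ ≤ 1 →
      (∀ i, i ≠ 3 → ‖(c • eC k) i‖ ≤ 1) ∧ ((c • eC k) 3).re = 0 := by
    intro k c hk hc
    refine ⟨fun i _ => ?_, by simp [eC, hk.symm]⟩
    by_cases hik : i = k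
    · subst hik
      simpa [eC] using hc
    · simp [eC, hik]
  have hunit1 : ∀ k : Fin 4, k ≠ 3 →
      (∀ i, i ≠ 3 → ‖eC k i‖ ≤ 1) ∧ (eC k 3).re = 0 := by
    intro k hk
    simpa using hunit k 1 hk (by simp)
  have hI : ‖Complex.I‖ ≤ 1 := by simp
  refine abs_avgs_le D horList (key _ ?_) 0 (fun x hx => ?_) _ ?_
  · intro u hu
    simp only [horList, List.mem_cons, List.not_mem_nil, or_false] at hu
    rcases hu with rfl | rfl | rfl | rfl | rfl
    · exact hunit1 0 (by decide)
    · exact hunit 0 _ (by decide) hI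
    · exact hunit1 1 (by decide)
    · exact hunit 1 _ (by decide) hI
    · refine ⟨fun i hi => by simp [eC, hi], by simp [eC]⟩
  · refine abs_avgs_le D vertList (key _ ?_) _ (fun y hy => ?_) x hx
    · intro u hu
      simp only [vertList, List.mem_cons, List.not_mem_nil, or_false] at hu
      rcases hu with rfl | rfl
      · exact hunit1 2 (by decide)
      · exact hunit 2 _ (by decide) hI
    · refine hf y (fun i hi => (hy.1 i hi).trans ?_) hy.2
      simp [horList, vertList]
  · refine ⟨fun i hi => by simp [eC, hi], by simp [eC]⟩

end Decay
end

noncomputable section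

/-! ### Non-existence of the metric on the blow-up -/

section Obstruction

variable (g : HermitianMetric 5 NilBlowup)

theorem Jform_divForm {j k : NormalIdx 5 3} (hjk : j ≠ k) {ε : ℝ}
    (h : divMap = nilBlow j ∘ divParam k ε) :
    Jform (divForm g) = pullForm (divParam k ε) (Jform (mpull (nilBlow j) (sqForm g))) := by
  rw [divForm_eq g hjk h]
  exact funext fun x => Jform_pullForm (differentiableAt_divParam k ε x) _

theorem dcForm_divForm {j k : NormalIdx 5 3} (hjk : j ≠ k) {ε : ℝ}
    (h : divMap = nilBlow j ∘ divParam k ε) :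
    dcForm (divForm g) = pullForm (divParam k ε) (dcForm (mpull (nilBlow j) (sqForm g))) := by
  rw [divForm_eq g hjk h]
  exact funext fun x => dcForm_pullForm (contDiff_divParam k ε).contDiffAt
    ((contDiffAt_mpull_sqForm g (divParam_mem_dom hjk ε x)).differentiableAt (by simp))

/-- In affine coordinates e₃ becomes exp(ε x₃) times a bounded vector, so one argument along e₃
forces exponential decay, uniformly over the points that are averaged. -/
theorem tendsto_yMean_pullForm {m : ℕ} {β : Cn 5 → Cn 5 [⋀^Fin m]→L[ℝ] ℝ} {j k : NormalIdx 5 3}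
    (hjk : j ≠ k) (hβ : ContinuousOn β (nilBlowDom j)) {ε : ℝ} (hε : |ε| = 1) (v : Fin m → Cn 4)
    {i₀ : Fin m} {c : ℂ} (hv : v i₀ = c • eC 3) {l : Filter ℝ}
    (hl : Filter.Tendsto (fun r => ε * r) l Filter.atBot) :
    Filter.Tendsto (fun r : ℝ => yMean (frameEval (pullForm (divParam k ε) β) v) (r • eC 3)) l
      (𝓝 0) := by
  obtain ⟨C, hC⟩ := exists_bound_frameEval hjk hβ hε v hv
  have h := ((Real.tendsto_exp_atBot.comp hl).const_mul C)
  rw [mul_zero] at h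
  refine squeeze_zero_norm' ?_ h
  filter_upwards [hl.eventually (Filter.eventually_le_atBot 0)] with r hr
  exact abs_yMean_le fun x hx hxr => by
    have := hC x hx (by rwa [hxr])
    rwa [hxr] at this

theorem tendsto_yMean_Jform {j k : NormalIdx 5 3} (hjk : j ≠ k) {ε : ℝ} (hε : |ε| = 1)
    (h : divMap = nilBlow j ∘ divParam k ε) (v : Fin (2 * 2) → Cn 4) {i₀ : Fin (2 * 2)} {c : ℂ}
    (hv : v i₀ = c • eC 3) {l : Filter ℝ} (hl : Filter.Tendsto (fun r => ε * r) l Filter.atBot) :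
    Filter.Tendsto (fun r : ℝ => yMean (frameEval (Jform (divForm g)) v) (r • eC 3)) l (𝓝 0) := by
  rw [Jform_divForm g hjk h]
  exact tendsto_yMean_pullForm hjk (fun u hu =>
    (contDiffAt_mpull_sqForm g hu).jform.continuousAt.continuousWithinAt) hε v hv hl

theorem tendsto_yMean_dcForm {j k : NormalIdx 5 3} (hjk : j ≠ k) {ε : ℝ} (hε : |ε| = 1)
    (h : divMap = nilBlow j ∘ divParam k ε) (v : Fin (2 * 2 + 1) → Cn 4) {i₀ : Fin (2 * 2 + 1)}
    {c : ℂ} (hv : v i₀ = c • eC 3) {l : Filter ℝ}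
    (hl : Filter.Tendsto (fun r => ε * r) l Filter.atBot) :
    Filter.Tendsto (fun r : ℝ => yMean (frameEval (dcForm (divForm g)) v) (r • eC 3)) l (𝓝 0) := by
  rw [dcForm_divForm g hjk h]
  exact tendsto_yMean_pullForm hjk (fun u hu =>
    (contDiffAt_mpull_sqForm g hu).dcForm.continuousAt.continuousWithinAt) hε v hv hl

/-- The averaged current along the cylinder direction of the exceptional divisor. -/
def divFlux (r : ℝ) : ℝ :=
  yMean (frameEval (dcForm (divForm g))
      ![eC 0, Complex.I • eC 0, eC 1, Complex.I • eC 1, Complex.I • eC 3]) (r • eC 3) -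
    2 * yMean (frameEval (Jform (divForm g))
      ![eC 2, -Complex.I • eC 1, eC 1, -Complex.I • eC 3]) (r • eC 3) -
    4 * yMean (frameEval (Jform (divForm g))
      ![eC 2, -Complex.I • eC 0, eC 0, -Complex.I • eC 3]) (r • eC 3)

/-- Each of the three terms of the flux has ie₃ or -ie₃ as its last argument. -/
theorem tendsto_divFlux {j k : NormalIdx 5 3} (hjk : j ≠ k) {ε : ℝ} (hε : |ε| = 1)
    (h : divMap = nilBlow j ∘ divParam k ε) {l : Filter ℝ}
    (hl : Filter.Tendsto (fun r => ε * r) l Filter.atBot) :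
    Filter.Tendsto (divFlux g) l (𝓝 0) := by
  have h1 := tendsto_yMean_dcForm g hjk hε h
    ![eC 0, Complex.I • eC 0, eC 1, Complex.I • eC 1, Complex.I • eC 3] (i₀ := 4) rfl hl
  have h2 := tendsto_yMean_Jform g hjk hε h
    ![eC 2, -Complex.I • eC 1, eC 1, -Complex.I • eC 3] (i₀ := 3) rfl hl
  have h3 := tendsto_yMean_Jform g hjk hε h
    ![eC 2, -Complex.I • eC 0, eC 0, -Complex.I • eC 3] (i₀ := 3) rfl hl
  have h4 := (h1.sub (h2.const_mul 2)).sub (h3.const_mul 4)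
  rw [mul_zero, mul_zero, sub_zero, sub_zero] at h4
  exact h4

theorem hasDerivAt_yMean_line {f : Cn 4 → ℝ} (hf : ContDiff ℝ ∞ f) (r : ℝ) :
    HasDerivAt (fun r : ℝ => yMean f (r • eC 3)) (fderiv ℝ (yMean f) (r • eC 3) (eC 3)) r := by
  have h1 : HasDerivAt (fun r : ℝ => r • eC 3) (eC 3) r := by
    simpa using (hasDerivAt_id r).smul_const (eC 3)
  exact (((contDiff_yMean (hf.of_le (by simp))).differentiable (by simp)
    (r • eC 3)).hasFDerivAt).comp_hasDerivAt r h1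

theorem hasDerivAt_divFlux (hg : g.DdcPowClosed 2) (r : ℝ) :
    HasDerivAt (divFlux g) (16 * yMean (frameEval (divForm g)
      ![eC 2, Complex.I • eC 2, eC 3, Complex.I • eC 3]) (r • eC 3)) r := by
  have hΩ := contDiff_divForm g
  have hd : ContDiff ℝ ∞ (dcForm (divForm g)) :=
    contDiff_iff_contDiffAt.2 fun y => hΩ.contDiffAt.dcForm
  have hJ : ContDiff ℝ ∞ (Jform (divForm g)) :=
    contDiff_iff_contDiffAt.2 fun y => hΩ.contDiffAt.jform
  have key := yMean_ddcForm (Ω := divForm g) hΩ (fun γ hγ => pullForm_yMul_divForm g hγ)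
    (ddcForm_divForm g hg) (r • eC 3)
  have h1 := hasDerivAt_yMean_line (contDiff_frameEval hd
    ![eC 0, Complex.I • eC 0, eC 1, Complex.I • eC 1, Complex.I • eC 3]) r
  have h2 := hasDerivAt_yMean_line (contDiff_frameEval hJ
    ![eC 2, -Complex.I • eC 1, eC 1, -Complex.I • eC 3]) r
  have h3 := hasDerivAt_yMean_line (contDiff_frameEval hJ
    ![eC 2, -Complex.I • eC 0, eC 0, -Complex.I • eC 3]) r
  exact ((h1.sub (h2.const_mul 2)).sub (h3.const_mul 4)).congr_deriv key

theorem yMean_divForm_pos (x : Cn 4) : 0 < yMean (frameEval (divForm g)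
    ![eC 2, Complex.I • eC 2, eC 3, Complex.I • eC 3]) x := by
  have hc : ContDiff ℝ 1 (frameEval (divForm g)
      ![eC 2, Complex.I • eC 2, eC 3, Complex.I • eC 3]) :=
    (contDiff_frameEval (contDiff_divForm g) _).of_le (by simp)
  exact avgs_pos _ (contDiff_avgs _ hc).continuous
    (avgs_pos _ hc.continuous (frameEval_divForm_pos g)) x

/-- The flux would be strictly increasing with limit 0 at both ends, hence at most 0 at r = 1 and at
least 0 at r = 0. -/
theorem not_ddcPowClosed_two : ¬ g.DdcPowClosed 2 := by
  intro hg
  have hmono : StrictMono (divFlux g) := strictMono_of_hasDerivAt_pos (hasDerivAt_divFlux g hg)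
    fun r => mul_pos (by norm_num) (yMean_divForm_pos g _)
  have hbot : Filter.Tendsto (divFlux g) Filter.atBot (𝓝 0) :=
    tendsto_divFlux g (by decide) (by simp) divMap_eq_left (by simpa using! Filter.tendsto_id)
  have htop : Filter.Tendsto (divFlux g) Filter.atTop (𝓝 0) :=
    tendsto_divFlux g (by decide) (by simp) divMap_eq_right
      (by simpa using Filter.tendsto_neg_atTop_atBot)
  exact ((hmono.monotone.le_of_tendsto hbot 0).trans_lt (hmono one_pos)).not_ge
    (hmono.monotone.ge_of_tendsto htop 1)

theorem not_exists_isDdcSpecial_nilBlowup : ¬ ∃ g : HermitianMetric 5 NilBlowup, g.IsDdcSpecial :=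
  fun ⟨g, hg⟩ => not_ddcPowClosed_two g hg.2

end Obstruction
end

theorem theorem5 :
    ∃ (Γ : Subgroup NilG) (_ : DiscreteTopology Γ)
      (_ : T2Space (Nilmanifold Γ)) (_ : CompactSpace (Nilmanifold Γ))
      (_ : ChartedSpace (Cn 5) (Nilmanifold Γ))
      (_ : IsManifold 𝓘(ℂ, Cn 5) ω (Nilmanifold Γ)),
      IsLocalDiffeomorph 𝓘(ℂ, Cn 5) 𝓘(ℂ, Cn 5) ω (nilProj Γ) ∧
      (∃ g : HermitianMetric 5 (Nilmanifold Γ), IsNilDiagonal Γ g ∧ g.IsDdcSpecial) ∧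
      IsCompact (nilY Γ) ∧ IsComplexSubmanifold 5 3 (nilY Γ) ∧
      ∃ (B : Type) (_ : TopologicalSpace B) (_ : T2Space B) (_ : CompactSpace B)
        (_ : ChartedSpace (Cn 5) B) (_ : IsManifold 𝓘(ℂ, Cn 5) ω B) (π : B → Nilmanifold Γ),
        IsBlowup 5 3 (nilY Γ) π ∧ ¬ ∃ g : HermitianMetric 5 B, g.IsDdcSpecial :=
  ⟨nilLattice, inferInstance, inferInstance, inferInstance, inferInstance, inferInstance,
    isLocalDiffeomorph_nilProj, ⟨nilMetric, isNilDiagonal_nilMetric, isDdcSpecial_nilMetric⟩,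
    isCompact_nilY, isComplexSubmanifold_nilY, NilBlowup, inferInstance, inferInstance,
    inferInstance, inferInstance, inferInstance, nilBlowDown, isBlowup_nilBlowDown,
    not_exists_isDdcSpecial_nilBlowup⟩
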